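/- Let $\mathbb K$ be an algebraically closed field of characteristic $0$, $G$ a reductive algebraic group over $\mathbb K$ with Lie algebra $\mathfrak g$, and $\mathcal U=U(\mathfrak g)$. Fix a nonzero nilpotent element $e\in\mathfrak g$, an $\mathfrak{sl}_2$-triple $(e,h,f)$ in $\mathfrak g$, a maximal torus $T$ of $Q=Z_G(e,h,f)$ with Lie algebra $\mathfrak t$, and a $G$-invariant symmetric bilinear form $(\cdot,\cdot)$ on $\mathfrak g$ whose restriction to the Lie algebra of every reductive algebraic subgroup of $G$ is nondegenerate. Put $\chi=(e,\cdot)\in\mathfrak g^*$ and $\mathfrak g(i)=\{\xi\in\mathfrak g : [h,\xi]=i\xi\}$. Let $l\subset\mathfrak g(-1)$ be a $T$-stable subspace that is lagrangian for the symplectic form $(\xi,\eta)\mapsto\chi([\xi,\eta])$, and put $\mathfrak m=l\oplus\bigoplus_{i\le -2}\mathfrak g(i)$ and $\mathfrak m_\chi=\{\xi-\chi(\xi):\xi\in\mathfrak m\}\subset\mathcal U$. The W-algebra is $\mathcal W=(\mathcal U/\mathcal U\mathfrak m_\chi)^{\operatorname{ad}\mathfrak m}$, with the product induced from $\mathcal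 U$; the inclusion $\mathfrak t\subset\mathfrak g\subset\mathcal U$ induces a map $\mathfrak t\to\mathcal W$, through which $\mathfrak t$ acts on all $\mathcal W$-modules. Let $\theta\in\operatorname{Hom}(\mathbb K^\times,T)$ be a cocharacter, regarded as an element of $\mathfrak t$ through its differential. Let $L=Z_G(\theta)$, let $T_0$ be the identity component of $Z(L)\cap T$, and let $\mathfrak t_0\subset\mathfrak t$ be its Lie algebra. For $\alpha\in\mathbb Z$ put $\mathcal W_\alpha=\{w\in\mathcal W : [\theta,w]=\alpha w\}$, and put $\mathcal W_{>0}=\bigoplus_{\alpha>0}\mathcal W_\alpha$. A left $\mathcal W$-module $M$ belongs to $\mathcal O(\theta)$ if it is finitely generated, for every $m\in M$ there is $\alpha\in\mathbb Z$ with $\mathcal W_\beta m=0$ for all $\beta\ge\alpha$, and the space $\{m\in M : wm=0 \text{ for all } w\in\mathcal W_{>0}\}$ is finite dimensional over $\mathbb K$. It belongs to $\mathcal O^{\mathfrak t_0}(\theta)$ if, in addition, $\mathfrak t_0$ acts on $M$ diagonalizably, i.e. $M$ is the sum of its $\mathfrak t_0$-weight spaces. Then for every module $M$ in $\mathcal O(\theta)$: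 1. the action of $\mathfrak t_0$ on $M$ is locally finite, i.e. every element of $M$ lies in a finite dimensional $\mathfrak t_0$-stable subspace of $M$; 2. $M$ contains a $\mathcal W$-submodule that belongs to $\mathcal O^{\mathfrak t_0}(\theta)$, and this submodule can be chosen nonzero if $M\neq 0$. -/

import Mathlib

noncomputable section

namespace FiniteW

open TrivSqZeroExt

attribute [local instance] LieRing.ofAssociativeRing

/-! ### Linear algebraic groups as Zariski closed subgroups of `GL n K` -/

section Groups

variable {K : Type*} [Field K] {n : ℕ}

/-- Evaluation of a polynomial in the `n × n` matrix coordinates at a matrix `A` with entries in a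
commutative `K`-algebra. -/
def evalAt {R : Type*} [CommRing R] [Algebra K R] (A : Matrix (Fin n) (Fin n) R) :
    MvPolynomial (Fin n × Fin n) K →ₐ[K] R :=
  MvPolynomial.aeval fun ij => A ij.1 ij.2

/-- The Zariski topology on `GL n K`: the non-vanishing loci of polynomials in the matrix entries
form a basis of open sets. -/
@[reducible] def zariski (K : Type*) [Field K] (n : ℕ) : TopologicalSpace (GL (Fin n) K) :=
  TopologicalSpace.generateFrom
    {U | ∃ p : MvPolynomial (Fin n × Fin n) K,
      U = {g : GL (Fin n) K | evalAt (g : Matrix (Fin n) (Fin n) K) p ≠ 0}}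

/-- A closed subgroup of `GL n K` in the Zariski topology. -/
def IsZariskiClosed (H : Subgroup (GL (Fin n) K)) : Prop :=
  @IsClosed _ (zariski K n) (H : Set (GL (Fin n) K))

/-- A subgroup of `GL n K` that is connected in the Zariski topology. -/
def IsZariskiConnected (H : Subgroup (GL (Fin n) K)) : Prop :=
  @IsConnected _ (zariski K n) (H : Set (GL (Fin n) K))

/-- The polynomials vanishing on a subgroup of `GL n K`. -/
def vanishingIdeal (H : Subgroup (GL (Fin n) K)) : Ideal (MvPolynomial (Fin n × Fin n) K) where
  carrier := {p | ∀ g ∈ H, evalAt (g : Matrix (Fin n) (Fin n) K) p = 0}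
  zero_mem' := fun g _ => map_zero _
  add_mem' := fun hp hq g hg => by rw [map_add, hp g hg, hq g hg, add_zero]
  smul_mem' := fun c p hp g hg => by rw [smul_eq_mul, map_mul, hp g hg, mul_zero]

/-- The matrix `A + ε B` over the dual numbers `K[ε]`. -/
def dualMatrix {R : Type*} [CommRing R] (A B : Matrix (Fin n) (Fin n) R) :
    Matrix (Fin n) (Fin n) (DualNumber R) :=
  Matrix.of fun i j => inl (A i j) + inr (B i j)

/-- The substitution `p(x) ↦ p(P x Q)`. -/
def substMatrix (P Q : Matrix (Fin n) (Fin n) K) :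
    MvPolynomial (Fin n × Fin n) K →ₐ[K] MvPolynomial (Fin n × Fin n) K :=
  evalAt (P.map MvPolynomial.C * (Matrix.of fun i j => MvPolynomial.X (i, j)) *
    Q.map MvPolynomial.C)

lemma evalAt_substMatrix {R : Type*} [CommRing R] [Algebra K R] (A : Matrix (Fin n) (Fin n) R)
    (P Q : Matrix (Fin n) (Fin n) K) (p : MvPolynomial (Fin n × Fin n) K) :
    evalAt A (substMatrix P Q p) =
      evalAt (P.map (algebraMap K R) * A * Q.map (algebraMap K R)) p := by
  rw [← AlgHom.comp_apply]
  congr 1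
  apply MvPolynomial.algHom_ext
  intro ij
  simp [evalAt, substMatrix, Matrix.mul_apply]

lemma evalAt_substMatrix_self (A P Q : Matrix (Fin n) (Fin n) K)
    (p : MvPolynomial (Fin n × Fin n) K) :
    evalAt A (substMatrix P Q p) = evalAt (P * A * Q) p := by
  rw [evalAt_substMatrix]
  simp

lemma map_eq_dualMatrix (A : Matrix (Fin n) (Fin n) K) :
    A.map (algebraMap K (DualNumber K)) = dualMatrix A 0 := by
  ext i j <;> simp [dualMatrix, TrivSqZeroExt.algebraMap_eq_inl]

lemma dualMatrix_mul (A B C D : Matrix (Fin n) (Fin n) K) :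
    dualMatrix A B * dualMatrix C D = dualMatrix (A * C) (A * D + B * C) := by
  ext i j
  · simp only [Matrix.mul_apply, dualMatrix, Matrix.of_apply, fst_sum, fst_mul, fst_add, fst_inl,
      fst_inr, add_zero]
  · simp only [Matrix.mul_apply, dualMatrix, Matrix.of_apply, snd_sum, DualNumber.snd_mul, fst_add,
      fst_inl, fst_inr, add_zero, snd_add, snd_inl, snd_inr, zero_add, Matrix.add_apply,
      Finset.sum_add_distrib]

lemma continuous_zariski_mul_left (g : GL (Fin n) K) :
    @Continuous _ _ (zariski K n) (zariski K n) (fun x => g * x) := by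
  let _ := zariski K n
  refine continuous_generateFrom_iff.2 ?_
  rintro U ⟨p, rfl⟩
  refine TopologicalSpace.isOpen_generateFrom_of_mem ⟨substMatrix (g : Matrix _ _ K) 1 p, ?_⟩
  ext x
  simp [evalAt_substMatrix_self]

/-- The identity component of a subgroup of `GL n K`: the connected component of `1` in the
Zariski topology. -/
def identityComponent (H : Subgroup (GL (Fin n) K)) : Subgroup (GL (Fin n) K) :=
  letI := zariski K n
  have key : ∀ x ∈ connectedComponentIn (H : Set (GL (Fin n) K)) 1,
      ∀ y ∈ connectedComponentIn (H : Set (GL (Fin n) K)) 1,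
        x⁻¹ * y ∈ connectedComponentIn (H : Set (GL (Fin n) K)) 1 := by
    intro x hx y hy
    have hpre : IsPreconnected ((fun z => x⁻¹ * z) ''
        connectedComponentIn (H : Set (GL (Fin n) K)) 1) :=
      isPreconnected_connectedComponentIn.image _
        (continuous_zariski_mul_left x⁻¹).continuousOn
    have hsub : ((fun z => x⁻¹ * z) '' connectedComponentIn (H : Set (GL (Fin n) K)) 1) ⊆
        (H : Set (GL (Fin n) K)) := by
      rintro _ ⟨z, hz, rfl⟩
      exact H.mul_mem (H.inv_mem (connectedComponentIn_subset _ _ hx))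
        (connectedComponentIn_subset _ _ hz)
    exact hpre.subset_connectedComponentIn ⟨x, hx, by simp⟩ hsub ⟨y, hy, rfl⟩
  have hone : (1 : GL (Fin n) K) ∈ connectedComponentIn (H : Set (GL (Fin n) K)) 1 :=
    mem_connectedComponentIn H.one_mem
  have hinv : ∀ x ∈ connectedComponentIn (H : Set (GL (Fin n) K)) 1,
      x⁻¹ ∈ connectedComponentIn (H : Set (GL (Fin n) K)) 1 := fun x hx => by
    simpa using key x hx 1 hone
  { carrier := connectedComponentIn (H : Set (GL (Fin n) K)) 1
    one_mem' := hone
    inv_mem' := fun {x} hx => hinv x hx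
    mul_mem' := fun {x y} hx hy => by simpa using key x⁻¹ (hinv x hx) y hy }

lemma identityComponent_le (H : Subgroup (GL (Fin n) K)) : identityComponent H ≤ H :=
  letI := zariski K n
  connectedComponentIn_subset (H : Set (GL (Fin n) K)) 1

/-- A unipotent subgroup: `g - 1` is nilpotent for all its elements `g`. -/
def IsUnipotent (H : Subgroup (GL (Fin n) K)) : Prop :=
  ∀ g ∈ H, IsNilpotent ((g : Matrix (Fin n) (Fin n) K) - 1)

/-- A reductive algebraic group, realized as a closed subgroup of some `GL n K`: the unipotent
radical is trivial, i.e. there is no nontrivial closed connected normal unipotent subgroup. -/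
structure IsReductive (G : Subgroup (GL (Fin n) K)) : Prop where
  closed : IsZariskiClosed G
  radical_trivial : ∀ N : Subgroup (GL (Fin n) K), N ≤ G → IsZariskiClosed N →
    IsZariskiConnected N → (N.subgroupOf G).Normal → IsUnipotent N → N = ⊥

/-- A torus: a closed connected subgroup that can be conjugated into the diagonal matrices. -/
structure IsTorus (T : Subgroup (GL (Fin n) K)) : Prop where
  closed : IsZariskiClosed T
  connected : IsZariskiConnected T
  diagonalizable : ∃ P : GL (Fin n) K, ∀ g ∈ T,
    ((P * g * P⁻¹ : GL (Fin n) K) : Matrix (Fin n) (Fin n) K).IsDiag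

/-- A maximal torus of `Q`. -/
structure IsMaximalTorus (T Q : Subgroup (GL (Fin n) K)) : Prop where
  torus : IsTorus T
  le : T ≤ Q
  maximal : ∀ T' : Subgroup (GL (Fin n) K), IsTorus T' → T ≤ T' → T' ≤ Q → T' = T

/-! ### The Lie algebra of a linear algebraic group -/

/-- The polynomial derivation `D_X p (g) = d/dε p (g (1 + ε X))`. -/
def invDer (X : Matrix (Fin n) (Fin n) K) :
    Derivation K (MvPolynomial (Fin n × Fin n) K) (MvPolynomial (Fin n × Fin n) K) :=
  MvPolynomial.mkDerivation K fun ij => ∑ k, MvPolynomial.X (ij.1, k) * MvPolynomial.C (X k ij.2)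

lemma evalAt_dualMatrix (A X : Matrix (Fin n) (Fin n) K) (p : MvPolynomial (Fin n × Fin n) K) :
    evalAt (dualMatrix A (A * X)) p = inl (evalAt A p) + inr (evalAt A (invDer X p)) := by
  induction p using MvPolynomial.induction_on with
  | C a =>
    have : invDer X (MvPolynomial.C a) = 0 := (invDer X).map_algebraMap a
    rw [this]
    simp [evalAt, TrivSqZeroExt.algebraMap_eq_inl]
  | add p q hp hq =>
    simp only [map_add, hp, hq, inl_add, inr_add]
    abel
  | mul_X p ij hp =>
    have h1 : invDer X (MvPolynomial.X ij) =
      ∑ k, MvPolynomial.X (ij.1, k) * MvPolynomial.C (X k ij.2) := MvPolynomial.mkDerivation_X _ _ _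
    rw [map_mul, hp, Derivation.leibniz, h1]
    ext
    · simp [evalAt, dualMatrix]
    · simp [evalAt, dualMatrix, Matrix.mul_apply]
      ring

lemma invDer_add (X Y : Matrix (Fin n) (Fin n) K) : invDer (X + Y) = invDer X + invDer Y := by
  apply MvPolynomial.derivation_ext
  intro ij
  simp [invDer, MvPolynomial.mkDerivation_X, mul_add, Finset.sum_add_distrib]

lemma invDer_smul (c : K) (X : Matrix (Fin n) (Fin n) K) : invDer (c • X) = c • invDer X := by
  apply MvPolynomial.derivation_ext
  intro ij
  simp [invDer, MvPolynomial.mkDerivation_X, Finset.smul_sum, MvPolynomial.smul_eq_C_mul]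
  exact Finset.sum_congr rfl fun _ _ => by ring

lemma invDer_lie (X Y : Matrix (Fin n) (Fin n) K) : invDer ⁅X, Y⁆ = ⁅invDer X, invDer Y⁆ := by
  have hX : ∀ Z : Matrix (Fin n) (Fin n) K, ∀ ij, invDer Z (MvPolynomial.X ij) =
    ∑ k, MvPolynomial.X (ij.1, k) * MvPolynomial.C (Z k ij.2) :=
      fun Z ij => MvPolynomial.mkDerivation_X _ _ _
  have hC : ∀ Z : Matrix (Fin n) (Fin n) K, ∀ a : K, invDer Z (MvPolynomial.C a) = 0 :=
      fun Z a => (invDer Z).map_algebraMap a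
  have h2 : ∀ Z W : Matrix (Fin n) (Fin n) K, ∀ ij, invDer Z (invDer W (MvPolynomial.X ij)) =
      ∑ k, MvPolynomial.X (ij.1, k) * MvPolynomial.C ((Z * W) k ij.2) := by
    intro Z W ij
    have h3 : ∀ k, invDer Z (MvPolynomial.X (ij.1, k) * MvPolynomial.C (W k ij.2)) =
        ∑ l, MvPolynomial.C (W k ij.2) *
          (MvPolynomial.X (ij.1, l) * MvPolynomial.C (Z l k)) := by
      intro k
      rw [Derivation.leibniz, hC, smul_zero, zero_add, smul_eq_mul, hX, Finset.mul_sum]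
    rw [hX, map_sum]
    simp only [h3, Matrix.mul_apply, Finset.mul_sum, map_sum, map_mul]
    rw [Finset.sum_comm]
    exact Finset.sum_congr rfl fun _ _ => Finset.sum_congr rfl fun _ _ => by ring
  apply MvPolynomial.derivation_ext
  intro ij
  rw [Derivation.commutator_apply, h2, h2, hX, ← Finset.sum_sub_distrib]
  exact Finset.sum_congr rfl fun _ _ => by
    rw [Ring.lie_def, Matrix.sub_apply, map_sub, mul_sub]

/-- `X` is tangent to `H` at `1`: the matrix `1 + ε X` over the dual numbers is a zero of all
polynomials that vanish on `H`. -/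
def IsTangent (H : Subgroup (GL (Fin n) K)) (X : Matrix (Fin n) (Fin n) K) : Prop :=
  ∀ p ∈ vanishingIdeal H, evalAt (dualMatrix 1 X) p = 0

lemma isTangent_iff (H : Subgroup (GL (Fin n) K)) (X : Matrix (Fin n) (Fin n) K) :
    IsTangent H X ↔
      ∀ p ∈ vanishingIdeal H, evalAt (1 : Matrix (Fin n) (Fin n) K) (invDer X p) = 0 := by
  refine forall₂_congr fun p hp => ?_
  have h1 : evalAt (1 : Matrix (Fin n) (Fin n) K) p = 0 := by
    simpa using hp 1 H.one_mem
  have := evalAt_dualMatrix 1 X p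
  rw [one_mul, h1, inl_zero, zero_add] at this
  rw [this]
  exact ⟨fun h => inr_injective (h.trans (inr_zero K).symm), fun h => by rw [h, inr_zero]⟩

lemma IsTangent.invDer_mem {H : Subgroup (GL (Fin n) K)} {X : Matrix (Fin n) (Fin n) K}
    (hX : IsTangent H X) {p : MvPolynomial (Fin n × Fin n) K} (hp : p ∈ vanishingIdeal H) :
    invDer X p ∈ vanishingIdeal H := by
  intro g hg
  have h0 := hX (substMatrix (g : Matrix _ _ K) 1 p) (fun k hk => by
    rw [evalAt_substMatrix_self, mul_one]
    exact hp (g * k) (H.mul_mem hg hk))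
  rw [evalAt_substMatrix, map_eq_dualMatrix, map_eq_dualMatrix, dualMatrix_mul, dualMatrix_mul] at h0
  simp only [mul_one, add_zero, mul_zero, zero_add] at h0
  rw [evalAt_dualMatrix] at h0
  simpa using congrArg snd h0

/-- The Lie algebra of an algebraic subgroup of `GL n K`: the tangent space at `1`, as a Lie
subalgebra of the matrices with the commutator bracket. -/
def lieAlg (H : Subgroup (GL (Fin n) K)) : LieSubalgebra K (Matrix (Fin n) (Fin n) K) where
  carrier := {X | IsTangent H X}
  zero_mem' := (isTangent_iff H 0).2 fun p _ => by
    have : invDer (0 : Matrix (Fin n) (Fin n) K) = 0 := by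
      simpa using invDer_smul (0 : K) (0 : Matrix (Fin n) (Fin n) K)
    rw [this]
    simp
  add_mem' := fun {X Y} hX hY => (isTangent_iff H _).2 fun p hp => by
    rw [invDer_add, Derivation.add_apply, map_add, (isTangent_iff H X).1 hX p hp,
      (isTangent_iff H Y).1 hY p hp, add_zero]
  smul_mem' := fun c X hX => (isTangent_iff H _).2 fun p hp => by
    rw [invDer_smul, Derivation.smul_apply, map_smul, (isTangent_iff H X).1 hX p hp, smul_zero]
  lie_mem' := fun {X Y} hX hY => (isTangent_iff H _).2 fun p hp => by
    rw [invDer_lie, Derivation.commutator_apply, map_sub,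
      (isTangent_iff H X).1 hX _ (hY.invDer_mem hp),
      (isTangent_iff H Y).1 hY _ (hX.invDer_mem hp), sub_zero]

lemma lieAlg_mono {H H' : Subgroup (GL (Fin n) K)} (h : H ≤ H') : lieAlg H ≤ lieAlg H' :=
  fun X (hX : IsTangent H X) => fun p hp => hX p fun g hg => hp g (h hg)

lemma IsTangent.conj {H : Subgroup (GL (Fin n) K)} {X : Matrix (Fin n) (Fin n) K}
    (hX : IsTangent H X) {g : GL (Fin n) K} (hg : g ∈ H) :
    IsTangent H ((g : Matrix (Fin n) (Fin n) K) * X * (g⁻¹ : GL (Fin n) K)) := by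
  intro p hp
  have h0 := hX (substMatrix (g : Matrix _ _ K) ((g⁻¹ : GL (Fin n) K) : Matrix _ _ K) p)
    (fun k hk => by
      rw [evalAt_substMatrix_self]
      exact hp (g * k * g⁻¹) (H.mul_mem (H.mul_mem hg hk) (H.inv_mem hg)))
  rw [evalAt_substMatrix, map_eq_dualMatrix, map_eq_dualMatrix, dualMatrix_mul, dualMatrix_mul] at h0
  have h1 : (g : Matrix (Fin n) (Fin n) K) * ((g⁻¹ : GL (Fin n) K) : Matrix _ _ K) = 1 := by
    rw [← Units.val_mul, mul_inv_cancel, Units.val_one]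
  simpa only [mul_one, zero_mul, add_zero, mul_zero, zero_add, h1] using h0

/-- The adjoint action of `G` on its Lie algebra. -/
def Ad (G : Subgroup (GL (Fin n) K)) (g : G) (x : lieAlg G) : lieAlg G :=
  ⟨((g : GL (Fin n) K) : Matrix (Fin n) (Fin n) K) * x.1 * ((g : GL (Fin n) K)⁻¹ : GL (Fin n) K),
    IsTangent.conj x.2 g.2⟩

/-- A linear functional which is constant on the `H`-orbit of `x` vanishes on `[Lie H, x]`. -/
lemma functional_lie_eq_zero {H : Subgroup (GL (Fin n) K)} {X : Matrix (Fin n) (Fin n) K}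
    (hX : IsTangent H X) (φ : Matrix (Fin n) (Fin n) K →ₗ[K] K) (x : Matrix (Fin n) (Fin n) K)
    (hφ : ∀ g ∈ H, φ ((g : Matrix (Fin n) (Fin n) K) * x * (g⁻¹ : GL (Fin n) K)) = φ x) :
    φ (X * x - x * X) = 0 := by
  have hsum : ∀ M : Matrix (Fin n) (Fin n) K,
      ∑ i, ∑ j, φ (Matrix.single i j 1) * M i j = φ M := by
    intro M
    conv_rhs => rw [Matrix.matrix_eq_sum_single M]
    simp only [map_sum]
    refine Finset.sum_congr rfl fun i _ => Finset.sum_congr rfl fun j _ => ?_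
    have : Matrix.single i j (M i j) = M i j • Matrix.single i j (1 : K) := by simp
    rw [this, map_smul, smul_eq_mul, mul_comm]
  let gen : Matrix (Fin n) (Fin n) (MvPolynomial (Fin n × Fin n) K) :=
    Matrix.of fun i j => MvPolynomial.X (i, j)
  let big : Matrix (Fin n) (Fin n) (MvPolynomial (Fin n × Fin n) K) :=
    gen * x.map MvPolynomial.C * gen.adjugate
  let q : MvPolynomial (Fin n × Fin n) K :=
    (∑ i, ∑ j, MvPolynomial.C (φ (Matrix.single i j 1)) * big i j) - MvPolynomial.C (φ x) * gen.det
  have hgen : ∀ {R : Type _} [CommRing R] [Algebra K R] (A : Matrix (Fin n) (Fin n) R),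
      gen.map (evalAt (K := K) A) = A := by
    intro R _ _ A
    ext i j
    simp [gen, evalAt]
  have hq : ∀ {R : Type _} [CommRing R] [Algebra K R] (A : Matrix (Fin n) (Fin n) R),
      evalAt A q = (∑ i, ∑ j, algebraMap K R (φ (Matrix.single i j 1)) *
        (A * x.map (algebraMap K R) * A.adjugate) i j) - algebraMap K R (φ x) * A.det := by
    intro R _ _ A
    have hC : ∀ a : K, evalAt A (MvPolynomial.C a) = algebraMap K R a := fun a =>
      MvPolynomial.aeval_C _ _
    have hdet : evalAt A gen.det = A.det := by
      rw [AlgHom.map_det, AlgHom.mapMatrix_apply, hgen]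
    have hent : ∀ i j, evalAt A (big i j) =
        (A * x.map (algebraMap K R) * A.adjugate) i j := by
      intro i j
      have h1 : (evalAt A).mapMatrix big =
          A * x.map (algebraMap K R) * A.adjugate := by
        simp only [big]
        rw [map_mul, map_mul, AlgHom.map_adjugate, AlgHom.mapMatrix_apply, hgen]
        congr 2
        ext i j
        simp [hC]
      rw [← h1]
      rfl
    simp only [q, map_sub, map_sum, map_mul, hC, hdet, hent]
  have hqmem : q ∈ vanishingIdeal H := by
    intro g hg
    have hadj : (g : Matrix (Fin n) (Fin n) K).adjugate =
        (g : Matrix (Fin n) (Fin n) K).det • ((g⁻¹ : GL (Fin n) K) : Matrix (Fin n) (Fin n) K) := by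
      have h1 : (g : Matrix (Fin n) (Fin n) K) * ((g⁻¹ : GL (Fin n) K) : Matrix _ _ K) = 1 := by
        rw [← Units.val_mul, mul_inv_cancel, Units.val_one]
      calc (g : Matrix (Fin n) (Fin n) K).adjugate
          = (g : Matrix (Fin n) (Fin n) K).adjugate *
            ((g : Matrix (Fin n) (Fin n) K) * ((g⁻¹ : GL (Fin n) K) : Matrix _ _ K)) := by
              rw [h1, mul_one]
        _ = _ := by rw [← mul_assoc, Matrix.adjugate_mul, Matrix.smul_mul, one_mul]
    rw [hq, hadj]
    simp only [Algebra.algebraMap_self, RingHom.id_apply]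
    rw [hsum, show x.map (RingHom.id K) = x from by ext; simp, Matrix.mul_smul, map_smul, hφ g hg,
      smul_eq_mul]
    ring
  have h0 := hX q hqmem
  set A : Matrix (Fin n) (Fin n) (DualNumber K) := dualMatrix 1 X with hA
  have hAA : A * dualMatrix 1 (-X) = 1 := by
    rw [hA, dualMatrix_mul, one_mul, one_mul, mul_one, neg_add_cancel]
    rw [← map_eq_dualMatrix]
    exact Matrix.map_one _ (map_zero _) (map_one _)
  have hadj : A.adjugate = A.det • dualMatrix 1 (-X) := by
    calc A.adjugate = A.adjugate * (A * dualMatrix 1 (-X)) := by rw [hAA, mul_one]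
      _ = _ := by rw [← mul_assoc, Matrix.adjugate_mul, Matrix.smul_mul, one_mul]
  have hdet : IsUnit A.det := by
    have := congrArg Matrix.det hAA
    rw [Matrix.det_mul, Matrix.det_one] at this
    exact IsUnit.of_mul_eq_one _ this
  have hsumD : ∀ M N : Matrix (Fin n) (Fin n) K,
      ∑ i, ∑ j, algebraMap K (DualNumber K) (φ (Matrix.single i j 1)) * dualMatrix M N i j =
        inl (φ M) + inr (φ N) := by
    intro M N
    ext
    · simp only [fst_sum, fst_mul, TrivSqZeroExt.algebraMap_eq_inl, fst_inl, dualMatrix,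
        Matrix.of_apply, fst_add, fst_inr, add_zero, hsum]
    · simp only [snd_sum, DualNumber.snd_mul, TrivSqZeroExt.algebraMap_eq_inl, fst_inl, snd_inl,
        dualMatrix, Matrix.of_apply, snd_add, snd_inr, zero_mul, add_zero, zero_add, hsum]
  rw [hq, hadj, map_eq_dualMatrix, Matrix.mul_smul, dualMatrix_mul, dualMatrix_mul] at h0
  simp only [Matrix.smul_apply, smul_eq_mul, mul_left_comm _ A.det, ← Finset.mul_sum] at h0
  rw [hsumD, TrivSqZeroExt.algebraMap_eq_inl, mul_comm (inl (φ x)) A.det, ← mul_sub] at h0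
  have h2 := (hdet.mul_right_eq_zero).1 h0
  have h3 := congrArg snd h2
  simp only [snd_sub, snd_add, snd_inl, snd_inr, zero_add, sub_zero, snd_zero, one_mul, mul_one,
    mul_neg] at h3
  rw [← h3]
  congr 1
  abel

/-! ### Cocharacters -/

/-- A cocharacter `λ` of `H`: a homomorphism of algebraic groups from the multiplicative group to
`H`, i.e. a group homomorphism whose matrix is a Laurent polynomial `λ(t) = ∑ₖ tᵏ Aₖ` in `t`. -/
structure Cocharacter (H : Subgroup (GL (Fin n) K)) where
  hom : Kˣ →* GL (Fin n) K
  mem : ∀ t, hom t ∈ H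
  coeff : ℤ →₀ Matrix (Fin n) (Fin n) K
  hom_eq : ∀ t : Kˣ, (hom t : Matrix (Fin n) (Fin n) K) =
    coeff.sum fun k A => ((t ^ k : Kˣ) : K) • A

/-- The differential of a cocharacter: the derivative `∑ₖ k Aₖ` of `λ(t) = ∑ₖ tᵏ Aₖ` at `t = 1`. -/
def Cocharacter.differential {H : Subgroup (GL (Fin n) K)} (c : Cocharacter H) :
    Matrix (Fin n) (Fin n) K :=
  c.coeff.sum fun k A => (k : K) • A

lemma laurent_eq_zero [Infinite K] (F : LaurentPolynomial K)
    (h : ∀ t : Kˣ, LaurentPolynomial.eval₂ (RingHom.id K) t F = 0) : F = 0 := by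
  obtain ⟨N, P, hP⟩ := F.exists_T_pow
  have hP0 : P = 0 := by
    by_contra hne
    have hfin : Set.Finite {x | P.IsRoot x} := Polynomial.finite_setOfPred_isRoot hne
    have hinf : Set.Infinite ({0}ᶜ : Set K) := (Set.finite_singleton 0).infinite_compl
    refine hinf (hfin.subset fun x hx => ?_)
    have hx0 : x ≠ 0 := hx
    have := congrArg (LaurentPolynomial.eval₂ (RingHom.id K) (Units.mk0 x hx0)) hP
    rw [LaurentPolynomial.eval₂_toLaurent, map_mul, h, zero_mul] at this
    exact this
  have h1 : F * LaurentPolynomial.T N = 0 := by rw [← hP, hP0, map_zero]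
  have h2 : F * LaurentPolynomial.T N * LaurentPolynomial.T (-N) = 0 := by rw [h1, zero_mul]
  rwa [mul_assoc, ← LaurentPolynomial.T_add, add_neg_cancel, LaurentPolynomial.T_zero,
    mul_one] at h2

lemma Cocharacter.isTangent_differential [Infinite K] {H : Subgroup (GL (Fin n) K)}
    (c : Cocharacter H) : IsTangent H c.differential := by
  intro p hp
  let F : Matrix (Fin n) (Fin n) (LaurentPolynomial K) :=
    Matrix.of fun i j => c.coeff.sum fun k A => LaurentPolynomial.C (A i j) * LaurentPolynomial.T k
  have hC : ∀ {S : Type _} [CommRing S] [Algebra K S] (u : Sˣ) (q : MvPolynomial (Fin n × Fin n) K),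
      LaurentPolynomial.eval₂ (algebraMap K S) u (evalAt F q) =
        evalAt (F.map (LaurentPolynomial.eval₂ (algebraMap K S) u)) q := by
    intro S _ _ u q
    induction q using MvPolynomial.induction_on with
    | C a =>
      simp only [evalAt, MvPolynomial.aeval_C]
      exact LaurentPolynomial.eval₂_C _ _ _
    | add p q hp hq => rw [map_add, map_add, map_add, hp, hq]
    | mul_X p ij hp => rw [map_mul, map_mul, map_mul, hp]; simp [evalAt]
  have hF : ∀ {S : Type _} [CommRing S] [Algebra K S] (u : Sˣ) (i j : Fin n),
      LaurentPolynomial.eval₂ (algebraMap K S) u (F i j) =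
        c.coeff.sum fun k A => algebraMap K S (A i j) * ((u ^ k : Sˣ) : S) := by
    intro S _ _ u i j
    simp only [F, Matrix.of_apply, Finsupp.sum, map_sum, LaurentPolynomial.eval₂_C_mul_T]
  have hzero : evalAt F p = 0 := by
    apply laurent_eq_zero
    intro t
    have h1 := hC (S := K) t p
    rw [Algebra.algebraMap_self] at h1
    rw [h1]
    have h2 : F.map (LaurentPolynomial.eval₂ (RingHom.id K) t) =
        (c.hom t : Matrix (Fin n) (Fin n) K) := by
      ext i j
      have h3 := hF (S := K) t i j
      rw [Algebra.algebraMap_self] at h3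
      rw [Matrix.map_apply, h3, c.hom_eq]
      simp [Finsupp.sum, Matrix.sum_apply, mul_comm]
    rw [h2]
    exact hp _ (c.mem t)
  let u : (DualNumber K)ˣ :=
    { val := inl 1 + inr 1
      inv := inl 1 + inr (-1)
      val_inv := by ext <;> simp
      inv_val := by ext <;> simp }
  have hu : ∀ k : ℤ, ((u ^ k : (DualNumber K)ˣ) : DualNumber K) = inl 1 + inr (k : K) := by
    have hn : ∀ k : ℕ, ((u ^ k : (DualNumber K)ˣ) : DualNumber K) = inl 1 + inr (k : K) := by
      intro k
      induction k with
      | zero => ext <;> simp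
      | succ k ih =>
        rw [pow_succ, Units.val_mul, ih]
        ext <;> simp [u]
        ring
    intro k
    obtain ⟨m, rfl | rfl⟩ := k.eq_nat_or_neg
    · rw [zpow_natCast, hn]; simp
    · rw [zpow_neg, zpow_natCast]
      have hm : ((u ^ m : (DualNumber K)ˣ) : DualNumber K) * (inl 1 + inr (-(m : K))) = 1 := by
        rw [hn]
        ext <;> simp
      rw [Units.inv_eq_of_mul_eq_one_right hm]
      simp
  have h1 := hC (S := DualNumber K) u p
  rw [hzero, map_zero] at h1
  have h2 : F.map (LaurentPolynomial.eval₂ (algebraMap K (DualNumber K)) u) =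
      dualMatrix 1 c.differential := by
    have hone : (1 : Matrix (Fin n) (Fin n) K) = c.coeff.sum fun _ A => A := by
      have := c.hom_eq 1
      simpa using this
    rw [hone]
    ext i j
    · rw [Matrix.map_apply, hF]
      simp only [Finsupp.sum, hu, dualMatrix, TrivSqZeroExt.algebraMap_eq_inl, Matrix.sum_apply,
        fst_sum, fst_mul, fst_add, fst_inl, fst_inr, add_zero, mul_one, Matrix.of_apply]
    · rw [Matrix.map_apply, hF]
      simp only [Finsupp.sum, hu, dualMatrix, TrivSqZeroExt.algebraMap_eq_inl, Matrix.sum_apply,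
        snd_sum, DualNumber.snd_mul, snd_add, fst_inl, snd_inl, snd_inr, zero_add, zero_mul,
        add_zero, Matrix.of_apply, Cocharacter.differential, Matrix.smul_apply, smul_eq_mul]
      exact Finset.sum_congr rfl fun _ _ => mul_comm _ _
  rw [← h2, ← h1]

end Groups

/-! ### Quantum Hamiltonian reduction `(U / U 𝔪_χ)^{ad 𝔪}` -/

section Reduction

variable {K : Type*} [Field K] {L : Type*} [LieRing L] [LieAlgebra K L]

/-- The left ideal of `U(L)` generated by all `ξ - χ(ξ)`, `ξ ∈ 𝔪`. -/
def shiftIdeal (m : Submodule K L) (χ : L →ₗ[K] K) : Ideal (UniversalEnvelopingAlgebra K L) :=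
  Ideal.span {u | ∃ ξ ∈ m, u = UniversalEnvelopingAlgebra.ι K ξ - algebraMap K (UniversalEnvelopingAlgebra K L) (χ ξ)}

/-- An element of the normalizer below multiplies the left ideal into itself from the right. -/
lemma shiftIdeal_mul_mem {m : Submodule K L} {χ : L →ₗ[K] K} {v : UniversalEnvelopingAlgebra K L}
    (hv : ∀ ξ ∈ m, UniversalEnvelopingAlgebra.ι K ξ * v - v * UniversalEnvelopingAlgebra.ι K ξ ∈
      shiftIdeal m χ) {a : UniversalEnvelopingAlgebra K L} (ha : a ∈ shiftIdeal m χ) : a * v ∈ shiftIdeal m χ := by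
  induction ha using Submodule.span_induction with
  | mem x hx =>
    obtain ⟨ξ, hξ, rfl⟩ := hx
    have h1 : (UniversalEnvelopingAlgebra.ι K ξ - algebraMap K (UniversalEnvelopingAlgebra K L) (χ ξ)) * v =
        (UniversalEnvelopingAlgebra.ι K ξ * v - v * UniversalEnvelopingAlgebra.ι K ξ) +
        v * (UniversalEnvelopingAlgebra.ι K ξ - algebraMap K (UniversalEnvelopingAlgebra K L) (χ ξ)) := by
      rw [sub_mul, mul_sub, Algebra.commutes (χ ξ) v]
      abel
    rw [h1]
    exact add_mem (hv ξ hξ) (Ideal.mul_mem_left _ _ (Submodule.subset_span ⟨ξ, hξ, rfl⟩))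
  | zero => rw [zero_mul]; exact zero_mem _
  | add x y _ _ hx hy => rw [add_mul]; exact add_mem hx hy
  | smul c x _ hx => rw [smul_eq_mul, mul_assoc]; exact Ideal.mul_mem_left _ _ hx

/-- The elements `u ∈ U(L)` whose class in `U / U 𝔪_χ` is `ad 𝔪`-invariant:
`[ξ, u] ∈ U 𝔪_χ` for all `ξ ∈ 𝔪`. -/
def adInvariants (m : Submodule K L) (χ : L →ₗ[K] K) : Subalgebra K (UniversalEnvelopingAlgebra K L) where
  carrier := {u | ∀ ξ ∈ m, UniversalEnvelopingAlgebra.ι K ξ * u -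
    u * UniversalEnvelopingAlgebra.ι K ξ ∈ shiftIdeal m χ}
  mul_mem' := fun {u v} hu hv ξ hξ => by
    have h1 : UniversalEnvelopingAlgebra.ι K ξ * (u * v) - u * v * UniversalEnvelopingAlgebra.ι K ξ
        = (UniversalEnvelopingAlgebra.ι K ξ * u - u * UniversalEnvelopingAlgebra.ι K ξ) * v +
          u * (UniversalEnvelopingAlgebra.ι K ξ * v - v * UniversalEnvelopingAlgebra.ι K ξ) := by
      noncomm_ring
    rw [h1]
    exact add_mem (shiftIdeal_mul_mem hv (hu ξ hξ)) (Ideal.mul_mem_left _ _ (hv ξ hξ))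
  add_mem' := fun {u v} hu hv ξ hξ => by
    have h1 : UniversalEnvelopingAlgebra.ι K ξ * (u + v) - (u + v) * UniversalEnvelopingAlgebra.ι K ξ
        = (UniversalEnvelopingAlgebra.ι K ξ * u - u * UniversalEnvelopingAlgebra.ι K ξ) +
          (UniversalEnvelopingAlgebra.ι K ξ * v - v * UniversalEnvelopingAlgebra.ι K ξ) := by
      noncomm_ring
    rw [h1]
    exact add_mem (hu ξ hξ) (hv ξ hξ)
  algebraMap_mem' := fun c ξ _ => by
    rw [Algebra.commutes c, sub_self]
    exact zero_mem _

/-- The left ideal `U 𝔪_χ` inside the algebra of elements with `ad 𝔪`-invariant class. -/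
def reductionIdeal (m : Submodule K L) (χ : L →ₗ[K] K) : Ideal (adInvariants m χ) :=
  (shiftIdeal m χ).comap (adInvariants m χ).val

instance (m : Submodule K L) (χ : L →ₗ[K] K) : (reductionIdeal m χ).IsTwoSided :=
  ⟨fun b ha => shiftIdeal_mul_mem b.2 ha⟩

/-- The algebra `(U / U 𝔪_χ)^{ad 𝔪}`: the classes `u + U 𝔪_χ` that are `ad 𝔪`-invariant,
with the product `(u + U 𝔪_χ) (v + U 𝔪_χ) = u v + U 𝔪_χ`. -/
def Reduction (m : Submodule K L) (χ : L →ₗ[K] K) : Type _ :=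
  adInvariants m χ ⧸ reductionIdeal m χ

instance (m : Submodule K L) (χ : L →ₗ[K] K) : Ring (Reduction m χ) :=
  inferInstanceAs (Ring (adInvariants m χ ⧸ reductionIdeal m χ))

instance (m : Submodule K L) (χ : L →ₗ[K] K) : Algebra K (Reduction m χ) :=
  inferInstanceAs (Algebra K (adInvariants m χ ⧸ reductionIdeal m χ))

/-- The class of an element of `U(L)` in the reduction. -/
def Reduction.mk (m : Submodule K L) (χ : L →ₗ[K] K) : adInvariants m χ →ₐ[K] Reduction m χ :=
  Ideal.Quotient.mkₐ K (reductionIdeal m χ)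

lemma ι_mem_adInvariants {m : Submodule K L} {χ : L →ₗ[K] K} {ξ : L}
    (h1 : ∀ η ∈ m, ⁅ξ, η⁆ ∈ m) (h2 : ∀ η ∈ m, χ ⁅ξ, η⁆ = 0) :
    UniversalEnvelopingAlgebra.ι K ξ ∈ adInvariants m χ := by
  intro η hη
  refine Submodule.subset_span ⟨-⁅ξ, η⁆, neg_mem (h1 η hη), ?_⟩
  rw [map_neg χ, h2 η hη, neg_zero, map_zero, sub_zero, lie_skew, LieHom.map_lie]
  rfl

/-- A linear map `V → L` whose values have `ad 𝔪`-invariant classes induces a linear map from `V`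
to the reduction, `v ↦ j(v) + U 𝔪_χ`. -/
def Reduction.lift {V : Type*} [AddCommGroup V] [Module K V] (m : Submodule K L) (χ : L →ₗ[K] K)
    (j : V →ₗ[K] L) (hj : ∀ v, UniversalEnvelopingAlgebra.ι K (j v) ∈ adInvariants m χ) :
    V →ₗ[K] Reduction m χ where
  toFun v := Reduction.mk m χ ⟨UniversalEnvelopingAlgebra.ι K (j v), hj v⟩
  map_add' v w := by
    rw [← map_add]
    exact congrArg _ (Subtype.ext (by simp))
  map_smul' c v := by
    rw [RingHom.id_apply, ← map_smul]
    exact congrArg _ (Subtype.ext (by simp))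

end Reduction

/-! ### The finite W-algebra -/

section WAlgebra

variable {K : Type*} [Field K] {n : ℕ}

/-- The common centralizer `Z_G(e, h, f)`. -/
def centralizerTriple (G : Subgroup (GL (Fin n) K)) (e h f : lieAlg G) :
    Subgroup (GL (Fin n) K) :=
  G ⊓ (Submonoid.centralizer ({e.1, h.1, f.1} : Set (Matrix (Fin n) (Fin n) K))).units

/-- The eigenspace `𝔤(i) = {ξ ∈ 𝔤 | [h, ξ] = i ξ}`. -/
def grading {L : Type*} [LieRing L] [LieAlgebra K L] (h : L) (i : ℤ) : Submodule K L where
  carrier := {ξ | ⁅h, ξ⁆ = (i : K) • ξ}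
  zero_mem' := by simp
  add_mem' := fun {x y} (hx : _ = _) (hy : _ = _) => by
    simp only [Set.mem_ofPred_eq, lie_add, hx, hy, smul_add]
  smul_mem' := fun c x (hx : _ = _) => by
    simp only [Set.mem_ofPred_eq, lie_smul, hx, smul_comm c]

/-- The input of the construction of a W-algebra and of its categories `O`: a reductive algebraic
group `G` with Lie algebra `𝔤`, an invariant form on `𝔤`, a nonzero nilpotent `e ∈ 𝔤` included in
an `sl₂`-triple, a maximal torus `T` of `Q = Z_G(e, h, f)`, a `T`-stable lagrangian subspace `l` of
`𝔤(-1)`, and a cocharacter `θ` of `T`. -/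
structure Datum (K : Type*) [Field K] (n : ℕ) where
  G : Subgroup (GL (Fin n) K)
  reductive : IsReductive G
  /-- The `G`-invariant symmetric form on `𝔤`. -/
  form : LinearMap.BilinForm K (lieAlg G)
  form_symm : ∀ x y, form x y = form y x
  form_invariant : ∀ (g : G) (x y : lieAlg G), form (Ad G g x) (Ad G g y) = form x y
  /-- The form is nondegenerate on the Lie algebra of every reductive subgroup. -/
  form_nondegenerate : ∀ H : Subgroup (GL (Fin n) K), H ≤ G → IsReductive H →
    ∀ x : lieAlg G, x.1 ∈ lieAlg H → (∀ y : lieAlg G, y.1 ∈ lieAlg H → form x y = 0) → x = 0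
  e : lieAlg G
  h : lieAlg G
  f : lieAlg G
  e_ne_zero : e ≠ 0
  e_nilpotent : IsNilpotent e.1
  triple : IsSl2Triple h e f
  T : Subgroup (GL (Fin n) K)
  maximalTorus : IsMaximalTorus T (centralizerTriple G e h f)
  /-- The lagrangian subspace of `𝔤(-1)` for the form `ω(ξ, η) = (e, [ξ, η])`. -/
  l : Submodule K (lieAlg G)
  l_lagrangian : ∀ ξ, ξ ∈ l ↔ ξ ∈ grading (K := K) h (-1) ∧ ∀ η ∈ l, form e ⁅ξ, η⁆ = 0
  l_stable : ∀ g : G, g.1 ∈ T → ∀ ξ ∈ l, Ad G g ξ ∈ l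
  θ : Cocharacter T

namespace Datum

variable (D : Datum K n)

/-- The linear functional `χ = (e, ·)`. -/
def χ : lieAlg D.G →ₗ[K] K := D.form D.e

/-- The subspace `𝔪 = l ⊕ ⨁_{i ≤ -2} 𝔤(i)`. -/
def m : Submodule K (lieAlg D.G) := D.l ⊔ ⨆ i : ℤ, ⨆ _ : i ≤ -2, grading D.h i

/-- The W-algebra `(U / U 𝔪_χ)^{ad 𝔪}`. -/
abbrev W : Type _ := Reduction D.m D.χ

lemma T_le_G : D.T ≤ D.G := D.maximalTorus.le.trans inf_le_left

/-- An element of `𝔱 = Lie T`, viewed in `𝔤`. -/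
def torusIncl : lieAlg D.T →ₗ[K] lieAlg D.G :=
  (LieSubalgebra.inclusion (lieAlg_mono D.T_le_G) : lieAlg D.T →ₗ[K] lieAlg D.G)

lemma torusIncl_lie_eq_zero {x : lieAlg D.G}
    (hx : x.1 ∈ ({D.e.1, D.h.1, D.f.1} : Set (Matrix (Fin n) (Fin n) K))) (ξ : lieAlg D.T) :
    ⁅D.torusIncl ξ, x⁆ = 0 := by
  have key : ∀ φ : Matrix (Fin n) (Fin n) K →ₗ[K] K, φ (ξ.1 * x.1 - x.1 * ξ.1) = 0 := by
    intro φ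
    refine functional_lie_eq_zero ξ.2 φ x.1 fun g hg => ?_
    have h1 := (D.maximalTorus.le hg).2
    have h2 : x.1 * (g : Matrix (Fin n) (Fin n) K) = g * x.1 :=
      Submonoid.mem_centralizer_iff.1 ((Submonoid.mem_units_iff _ _).1 h1).1 _ hx
    rw [← h2, mul_assoc, ← Units.val_mul, mul_inv_cancel, Units.val_one, mul_one]
  have h0 : ξ.1 * x.1 - x.1 * ξ.1 = 0 := (Module.forall_dual_apply_eq_zero_iff K _).1 key
  exact Subtype.ext h0

lemma functional_torusIncl_lie (φ : lieAlg D.G →ₗ[K] K) (x : lieAlg D.G) (ξ : lieAlg D.T)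
    (h : ∀ g : D.G, g.1 ∈ D.T → φ (Ad D.G g x) = φ x) : φ ⁅D.torusIncl ξ, x⁆ = 0 := by
  obtain ⟨ψ, hψ⟩ := LinearMap.exists_extend (p := (lieAlg D.G).toSubmodule) φ
  have hψ' : ∀ y : lieAlg D.G, ψ y.1 = φ y := fun y => LinearMap.congr_fun hψ y
  rw [← hψ']
  refine functional_lie_eq_zero ξ.2 ψ x.1 fun g hg => ?_
  rw [hψ' x, ← h ⟨g, D.T_le_G hg⟩ hg, ← hψ']
  rfl

lemma torusIncl_lie_mem (ξ : lieAlg D.T) (η : lieAlg D.G) (hη : η ∈ D.m) :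
    ⁅D.torusIncl ξ, η⁆ ∈ D.m := by
  have hle : D.m ≤ D.m.comap (LieModule.toEnd K (lieAlg D.G) (lieAlg D.G) (D.torusIncl ξ)) := by
    refine sup_le ?_ (iSup₂_le fun i hi => ?_)
    · intro x hx
      refine Submodule.mem_sup_left ?_
      by_contra hnot
      obtain ⟨φ, hφ1, hφ2⟩ := Submodule.exists_le_ker_of_notMem hnot
      refine hφ1 (D.functional_torusIncl_lie φ x ξ fun g hg => ?_)
      rw [hφ2 hx]
      exact hφ2 (D.l_stable g hg x hx)
    · intro x hx
      refine Submodule.mem_sup_right (Submodule.mem_iSup_of_mem i (Submodule.mem_iSup_of_mem hi ?_))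
      have hx' : ⁅D.h, x⁆ = (i : K) • x := hx
      have h0 : ⁅D.h, D.torusIncl ξ⁆ = 0 := by
        rw [← lie_skew, D.torusIncl_lie_eq_zero (by simp), neg_zero]
      change ⁅D.h, ⁅D.torusIncl ξ, x⁆⁆ = (i : K) • ⁅D.torusIncl ξ, x⁆
      rw [leibniz_lie, h0, zero_lie, zero_add, hx', lie_smul]
  exact hle hη

lemma χ_torusIncl_lie (ξ : lieAlg D.T) (η : lieAlg D.G) : D.χ ⁅D.torusIncl ξ, η⁆ = 0 := by
  refine D.functional_torusIncl_lie D.χ η ξ fun g hg => ?_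
  have h1 := (D.maximalTorus.le hg).2
  have h2 : D.e.1 * (g.1 : Matrix (Fin n) (Fin n) K) = g.1 * D.e.1 :=
    Submonoid.mem_centralizer_iff.1 ((Submonoid.mem_units_iff _ _).1 h1).1 _ (by simp)
  have h3 : Ad D.G g D.e = D.e := by
    refine Subtype.ext ?_
    change (g.1 : Matrix (Fin n) (Fin n) K) * D.e.1 * (g.1⁻¹ : GL (Fin n) K) = D.e.1
    rw [← h2, mul_assoc, ← Units.val_mul, mul_inv_cancel, Units.val_one, mul_one]
  have h4 := D.form_invariant g D.e η
  rwa [h3] at h4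

/-- The map `𝔱 → W` that sends `ξ ∈ 𝔱 ⊆ 𝔤` to its class in `U / U 𝔪_χ`. -/
def torusToW : lieAlg D.T →ₗ[K] D.W :=
  Reduction.lift D.m D.χ D.torusIncl fun ξ =>
    ι_mem_adInvariants (D.torusIncl_lie_mem ξ) fun η _ => D.χ_torusIncl_lie ξ η

/-- The cocharacter `θ`, viewed as an element of `𝔱` through its differential. -/
def θLie [Infinite K] : lieAlg D.T := ⟨D.θ.differential, D.θ.isTangent_differential⟩

/-- The Levi subgroup `L`: the centralizer of `θ` in `G`. -/
def L : Subgroup (GL (Fin n) K) :=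
  D.G ⊓ (Submonoid.centralizer ({D.θ.differential} : Set (Matrix (Fin n) (Fin n) K))).units

/-- The torus `T₀`: the identity component of `Z(L) ∩ T`. -/
def T₀ : Subgroup (GL (Fin n) K) :=
  identityComponent (D.L ⊓ Subgroup.centralizer (D.L : Set (GL (Fin n) K)) ⊓ D.T)

lemma T₀_le_T : D.T₀ ≤ D.T := (identityComponent_le _).trans inf_le_right

/-- The map `𝔱₀ = Lie T₀ → W`. -/
def t₀ToW : lieAlg D.T₀ →ₗ[K] D.W :=
  D.torusToW ∘ₗ (LieSubalgebra.inclusion (lieAlg_mono D.T₀_le_T) : lieAlg D.T₀ →ₗ[K] lieAlg D.T)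

/-- The weight space `W_α` for `ad θ`. -/
def weightSpace [Infinite K] (α : ℤ) : Submodule K D.W where
  carrier := {w | D.torusToW D.θLie * w - w * D.torusToW D.θLie = (α : K) • w}
  zero_mem' := by simp
  add_mem' := fun {x y} (hx : _ = _) (hy : _ = _) => by
    simp only [Set.mem_ofPred_eq, smul_add, ← hx, ← hy]
    noncomm_ring
  smul_mem' := fun c x (hx : _ = _) => by
    simp only [Set.mem_ofPred_eq, smul_comm (α : K) c, ← hx, mul_smul_comm, smul_mul_assoc,
      smul_sub]

/-- The subspace `W_{>0}`, the sum of all `W_α` with `α > 0`. -/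
def Wpos [Infinite K] : Submodule K D.W := ⨆ α : ℤ, ⨆ _ : 0 < α, D.weightSpace α

section Modules

variable [Infinite K] (M : Type*) [AddCommGroup M] [Module K M] [Module D.W M]
  [IsScalarTower K D.W M]

/-- Membership in the category `Õ(θ)`: `M` is finitely generated, and every `m ∈ M` is annihilated
by `W_β` for all sufficiently large `β`. -/
structure MemOTilde : Prop where
  finite : Module.Finite D.W M
  bounded : ∀ x : M, ∃ α : ℤ, ∀ β : ℤ, α ≤ β → ∀ w ∈ D.weightSpace β, w • x = 0

/-- The space `F(M)` of `W_{>0}`-invariants. -/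
def invariants : Submodule K M where
  carrier := {x | ∀ w ∈ D.Wpos, w • x = 0}
  zero_mem' := fun w _ => smul_zero w
  add_mem' := fun {x y} hx hy w hw => by rw [smul_add, hx w hw, hy w hw, add_zero]
  smul_mem' := fun c x hx w hw => by
    rw [← algebraMap_smul D.W c x, ← mul_smul, ← Algebra.commutes, mul_smul, hx w hw, smul_zero]

/-- Membership in the category `O(θ)`: `M` lies in `Õ(θ)` and `F(M)` is finite dimensional. -/
structure MemO : Prop extends MemOTilde D M where
  finiteDimensional : FiniteDimensional K (D.invariants M)

/-- The `𝔱₀`-weight space of `M` of weight `μ ∈ 𝔱₀*`. -/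
def t₀WeightSpace (μ : Module.Dual K (lieAlg D.T₀)) : Submodule K M where
  carrier := {x | ∀ ξ, D.t₀ToW ξ • x = μ ξ • x}
  zero_mem' := fun ξ => by rw [smul_zero, smul_zero]
  add_mem' := fun {x y} hx hy ξ => by rw [smul_add, smul_add, hx ξ, hy ξ]
  smul_mem' := fun c x hx ξ => by
    rw [← algebraMap_smul D.W c x, ← mul_smul, ← Algebra.commutes, mul_smul, hx ξ,
      algebraMap_smul, algebraMap_smul, smul_comm]

/-- The action of `𝔱₀` on `M` is diagonalizable: `M` is the sum of its `𝔱₀`-weight spaces. -/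
def IsT₀Diagonalizable : Prop := ⨆ μ, D.t₀WeightSpace M μ = ⊤

/-- Membership in the category `O^{𝔱₀}(θ)`: `M` lies in `O(θ)` and the action of `𝔱₀` on `M` is
diagonalizable. -/
structure MemOT₀ : Prop extends MemO D M where
  diagonalizable : D.IsT₀Diagonalizable M

/-- The action of `𝔱₀` on `M` is locally finite: every element of `M` lies in a finite dimensional
`𝔱₀`-stable subspace. -/
def IsT₀LocallyFinite : Prop :=
  ∀ x : M, ∃ V : Submodule K M, x ∈ V ∧ FiniteDimensional K V ∧
    ∀ ξ, ∀ v ∈ V, D.t₀ToW ξ • v ∈ V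

end Modules

end Datum

end WAlgebra

end FiniteW

end

noncomputable section

set_option linter.unusedSectionVars false

/-! The argument rests on two facts about $\mathcal W$: it is left noetherian, and
$\operatorname{ad}\mathfrak t$ acts on it diagonalizably.

Local finiteness. Let `killedBy` $\alpha$ be the space of vectors of $M$ annihilated by every
$\mathcal W_\beta$ with $\beta\ge\alpha$. It is $\mathfrak t_0$-stable because $\mathfrak t_0$ has
$\theta$-weight 0, and by the definition of $\mathcal O(\theta)$ every vector lies in one of these
spaces. For $\alpha=1$ it is the space $F(M)$ of $\mathcal W_{>0}$-invariants, finite dimensional by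
assumption. To pass from $\alpha$ to $\alpha+1$, choose finitely many homogeneous generators
$w_1,\dots,w_r$ of weight $\ge\alpha$ of the left ideal generated by all $\mathcal W_\beta$,
$\beta\ge\alpha$. The map $x\mapsto(w_ix)_i$ sends `killedBy` $(\alpha+1)$ into $F(M)^r$, and its
kernel lies in `killedBy` $\alpha$; this is `finiteDimensional_killedBy`, and the only place where
noetherianity enters.

The submodule. If $M\ne0$, then $F(M)\ne0$, and the commuting operators from $\mathfrak t_0$ have a
joint eigenvector $v$ in it. Since $\mathcal W$ is spanned by $\operatorname{ad}\mathfrak t$-weight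
vectors, the cyclic module $\mathcal Wv$ is spanned by $\mathfrak t_0$-weight vectors. A finitely
generated submodule of $M$ stays in $\mathcal O(\theta)$.

Noetherianity. $\mathcal U$ is left noetherian because its associated graded ring is a quotient of a
polynomial ring. The space of Whittaker vectors of $\mathcal U/\mathcal U\mathfrak m_\chi$ is
$\mathcal W$. A left ideal $I$ of $\mathcal W$ is recovered as the set of Whittaker vectors of the
$\mathcal U$-submodule it generates, so $I\mapsto\mathcal UI$ is strictly monotone and the ascending
chain condition descends to $\mathcal W$. The recovery is a Skryabin type statement: for a
homogeneous basis $x_j$ of $\mathfrak m$ and vectors $u_j$ dual to it under $\chi([\cdot,\cdot])$,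
ordered monomials in the $u_j$ form a basis of $\mathcal U/\mathcal U\mathfrak m_\chi$ over
$\mathcal W$. Its source is that $x_j-\chi(x_j)$ acts like $\partial/\partial u_j$ up to terms of
smaller weight (`exists_xAct_uWord_eq`).

The weight of $y\in\mathfrak g(k)$ is taken to be $2k+3=2(k+2)-1$, a variant of the Kazhdan degree.
With this choice every commutator costs an extra 1, except for its scalar part $\chi([z,y])$, so
that only the dual pairing survives in top weight. The dual vectors $u_j$ exist because
$\ker\operatorname{ad}e$ has no negative $h$-weights and the form on $\mathfrak g$ is nondegenerate
and infinitesimally invariant. -/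

namespace FiniteW

open TrivSqZeroExt
open UniversalEnvelopingAlgebra (ι)

attribute [local instance] LieRing.ofAssociativeRing

/-! ### Almost commutative algebras are noetherian -/

section AlmostCommutative

variable {K A ι : Type*} [Field K] [Ring A] [Algebra K A]

/-- The span of the products of fewer than `n` generators `x i`. -/
def wordFiltration (K : Type*) {A ι : Type*} [Field K] [Ring A] [Algebra K A] (x : ι → A) (n : ℕ) :
    Submodule K A :=
  Submodule.span K {a | ∃ l : List ι, l.length < n ∧ a = (l.map x).prod}

variable {x : ι → A}

lemma prod_mem_wordFiltration {l : List ι} {n : ℕ} (h : l.length < n) :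
    (l.map x).prod ∈ wordFiltration K x n :=
  Submodule.subset_span ⟨l, h, rfl⟩

lemma wordFiltration_mono {m n : ℕ} (h : m ≤ n) : wordFiltration K x m ≤ wordFiltration K x n :=
  Submodule.span_mono fun _ ⟨l, hl, e⟩ => ⟨l, hl.trans_le h, e⟩

lemma prod_mul_mem_wordFiltration (l : List ι) {n : ℕ} {a : A} (ha : a ∈ wordFiltration K x n) :
    (l.map x).prod * a ∈ wordFiltration K x (l.length + n) := by
  induction ha using Submodule.span_induction with
  | mem a h =>
    obtain ⟨l', hl', rfl⟩ := h
    rw [← List.prod_append, ← List.map_append]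
    exact prod_mem_wordFiltration (by rw [List.length_append]; omega)
  | zero => rw [mul_zero]; exact zero_mem _
  | add a b _ _ ha hb => rw [mul_add]; exact add_mem ha hb
  | smul c a _ ha => rw [mul_smul_comm]; exact Submodule.smul_mem _ _ ha

lemma mul_mem_wordFiltration_of_mem_span {a b : A} {n : ℕ} (ha : a ∈ Submodule.span K (Set.range x))
    (hb : b ∈ wordFiltration K x n) : a * b ∈ wordFiltration K x (n + 1) := by
  induction ha using Submodule.span_induction with
  | mem a h =>
    obtain ⟨i, rfl⟩ := h
    simpa [add_comm] using prod_mul_mem_wordFiltration [i] hb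
  | zero => rw [zero_mul]; exact zero_mem _
  | add a b _ _ ha hb => rw [add_mul]; exact add_mem ha hb
  | smul c a _ ha => rw [smul_mul_assoc]; exact Submodule.smul_mem _ _ ha

/-- Swapping two neighbours replaces them by their commutator, a combination of single generators,
so the error is a combination of words shorter by one. The filtration counts words of length
strictly below the index, so this is a drop in degree. -/
lemma prod_sub_prod_mem_of_perm
    (hx : ∀ i j, x i * x j - x j * x i ∈ Submodule.span K (Set.range x)) {l l' : List ι}
    (h : l.Perm l') : (l.map x).prod - (l'.map x).prod ∈ wordFiltration K x l.length := by
  induction h with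
  | nil => simp
  | cons i _ ih =>
    simpa [mul_sub, add_comm] using prod_mul_mem_wordFiltration [i] ih
  | swap i j l =>
    have h1 := mul_mem_wordFiltration_of_mem_span (hx j i)
      (prod_mem_wordFiltration (K := K) (x := x) (Nat.lt_succ_self l.length))
    simpa [sub_mul, mul_assoc] using h1
  | trans h1 _ ih1 ih2 =>
    rw [← h1.length_eq] at ih2
    simpa using add_mem ih1 ih2

variable (K x) in
/-- The linear map that replaces the variables of a polynomial by generators, in some order. -/
def orderedEval : MvPolynomial ι K →ₗ[K] A :=
  (MvPolynomial.basisMonomials ι K).constr K fun d => (d.toMultiset.toList.map x).prod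

lemma orderedEval_monomial (d : ι →₀ ℕ) (c : K) :
    orderedEval K x (MvPolynomial.monomial d c) = c • (d.toMultiset.toList.map x).prod := by
  have h : MvPolynomial.monomial d c = c • MvPolynomial.basisMonomials ι K d := by
    simp [MvPolynomial.smul_monomial]
  rw [h, map_smul, orderedEval, Module.Basis.constr_basis]

lemma length_toList_toMultiset (d : ι →₀ ℕ) : d.toMultiset.toList.length = d.degree := by
  rw [Multiset.length_toList, Finsupp.card_toMultiset]
  rfl

/-- `orderedEval` is multiplicative modulo lower order terms, since the two sides differ only by the
order of the letters. -/
lemma orderedEval_mul_sub_mem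
    (hx : ∀ i j, x i * x j - x j * x i ∈ Submodule.span K (Set.range x)) (d : ι →₀ ℕ) (c : K)
    {p : MvPolynomial ι K} {n : ℕ} (hp : p.IsHomogeneous n) :
    orderedEval K x (MvPolynomial.monomial d c) * orderedEval K x p -
      orderedEval K x (MvPolynomial.monomial d c * p) ∈ wordFiltration K x (d.degree + n) := by
  rw [p.as_sum, map_sum, Finset.mul_sum, Finset.mul_sum, map_sum, ← Finset.sum_sub_distrib]
  refine Submodule.sum_mem _ fun d' hd' => ?_
  have hdeg : d'.degree = n := by
    by_contra hne
    exact (MvPolynomial.mem_support_iff.1 hd') (hp.coeff_eq_zero hne)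
  rw [MvPolynomial.monomial_mul, orderedEval_monomial, orderedEval_monomial, orderedEval_monomial,
    smul_mul_smul_comm, ← smul_sub, ← List.prod_append, ← List.map_append]
  refine Submodule.smul_mem _ _ ?_
  have h := prod_sub_prod_mem_of_perm (K := K) hx
    (l := d.toMultiset.toList ++ d'.toMultiset.toList) (l' := (d + d').toMultiset.toList) (by
      rw [← Multiset.coe_eq_coe, ← Multiset.coe_add]; simp)
  rwa [List.length_append, length_toList_toMultiset, length_toList_toMultiset, hdeg] at h

/-- Gives each element of order at most `n` a symbol, possibly zero, of degree exactly `n`. -/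
lemma exists_isHomogeneous_sub_mem
    (hx : ∀ i j, x i * x j - x j * x i ∈ Submodule.span K (Set.range x)) {n : ℕ} {a : A}
    (ha : a ∈ wordFiltration K x (n + 1)) :
    ∃ p : MvPolynomial ι K, p.IsHomogeneous n ∧ a - orderedEval K x p ∈ wordFiltration K x n := by
  classical
  induction ha using Submodule.span_induction with
  | mem a h =>
    obtain ⟨l, hl, rfl⟩ := h
    obtain hl' | hl' := (Nat.lt_succ_iff.1 hl).lt_or_eq
    · exact ⟨0, MvPolynomial.isHomogeneous_zero _ _ _, by
        simpa using prod_mem_wordFiltration hl'⟩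
    · have hl2 : (Multiset.toFinsupp (l : Multiset ι)).toMultiset = l :=
        Multiset.toFinsupp_toMultiset _
      refine ⟨MvPolynomial.monomial (Multiset.toFinsupp (l : Multiset ι)) 1,
        MvPolynomial.isHomogeneous_monomial _ ?_, ?_⟩
      · rw [← length_toList_toMultiset, hl2]; simpa
      · rw [orderedEval_monomial, one_smul, ← hl']
        refine prod_sub_prod_mem_of_perm hx ?_
        rw [← Multiset.coe_eq_coe]
        simp
  | zero => exact ⟨0, MvPolynomial.isHomogeneous_zero _ _ _, by simp⟩
  | add a b _ _ ha hb =>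
    obtain ⟨p, hp, hpa⟩ := ha
    obtain ⟨q, hq, hqb⟩ := hb
    refine ⟨p + q, hp.add hq, ?_⟩
    rw [map_add, add_sub_add_comm]
    exact add_mem hpa hqb
  | smul c a _ ha =>
    obtain ⟨p, hp, hpa⟩ := ha
    refine ⟨c • p, by
      rw [MvPolynomial.smul_eq_C_mul]; simpa using (MvPolynomial.isHomogeneous_C ι c).mul hp, ?_⟩
    rw [map_smul, ← smul_sub]
    exact Submodule.smul_mem _ _ hpa

/-- An algebra with finitely many generators whose commutators are linear combinations of the
generators is left noetherian. -/
theorem isNoetherianRing_of_commutators [Finite ι]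
    (hx : ∀ i j, x i * x j - x j * x i ∈ Submodule.span K (Set.range x))
    (htop : Algebra.adjoin K (Set.range x) = ⊤) : IsNoetherianRing A := by
  classical
  rw [isNoetherianRing_iff, isNoetherian_def]
  intro J
  -- The symbols of elements of `J`. By Hilbert's basis theorem finitely many of them generate their
  -- ideal, and `J'` is generated by chosen lifts of these.
  let gr : Set (MvPolynomial ι K) := {p | ∃ n, p.IsHomogeneous n ∧
    ∃ j ∈ J, j - orderedEval K x p ∈ wordFiltration K x n}
  obtain ⟨t, htgr, ht⟩ := (Submodule.fg_span_iff_fg_span_finset_subset gr).1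
    (IsNoetherian.noetherian (Ideal.span gr))
  choose! deg hdeg lift hlift hsub using fun p (hp : p ∈ gr) => hp
  let J' : Ideal A := Ideal.span (t.image lift)
  have hJ' : J' ≤ J := by
    refine Ideal.span_le.2 fun a ha => ?_
    obtain ⟨p, hp, rfl⟩ := Finset.mem_image.1 (Finset.mem_coe.1 ha)
    exact hlift p (htgr hp)
  have key : ∀ r ∈ Ideal.span gr, ∀ n, ∃ j ∈ J',
      j - orderedEval K x (MvPolynomial.homogeneousComponent n r) ∈ wordFiltration K x n := by
    intro r hr n
    have hr' : r ∈ Submodule.span (MvPolynomial ι K) (t : Set (MvPolynomial ι K)) := by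
      rw [← ht]; exact hr
    obtain ⟨a, -, rfl⟩ := Submodule.mem_span_finset.1 hr'
    rw [map_sum, map_sum]
    have h1 : ∀ p ∈ t, ∃ j ∈ J', j - orderedEval K x
        (MvPolynomial.homogeneousComponent n (a p • p)) ∈ wordFiltration K x n := by
      intro p hp
      -- By additivity the coefficient may be taken to be a monomial. Its product with the symbol
      -- `p` is then homogeneous and is the symbol of the ordered monomial times the lift of `p`.
      generalize a p = f
      induction f using MvPolynomial.induction_on' with
      | monomial d c =>
        have hp' := hdeg p (htgr hp)
        have hdp : (MvPolynomial.monomial d c * p).IsHomogeneous (d.degree + deg p) :=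
          (MvPolynomial.isHomogeneous_monomial c rfl).mul hp'
        rw [smul_eq_mul, MvPolynomial.homogeneousComponent_of_mem hdp]
        split_ifs with hn
        · refine ⟨orderedEval K x (MvPolynomial.monomial d c) * lift p, Ideal.mul_mem_left _ _
            (Submodule.subset_span (Finset.mem_coe.2 (Finset.mem_image_of_mem _ hp))), ?_⟩
          have h1 := orderedEval_mul_sub_mem hx d c hp'
          have h2 := prod_mul_mem_wordFiltration d.toMultiset.toList (hsub p (htgr hp))
          rw [length_toList_toMultiset] at h2
          have h3 := add_mem (Submodule.smul_mem _ c h2) h1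
          rw [hn]
          convert h3 using 1
          rw [orderedEval_monomial, mul_sub, smul_sub, smul_mul_assoc, smul_mul_assoc]
          abel
        · exact ⟨0, zero_mem _, by simp⟩
      | add f g hf hg =>
        obtain ⟨j, hj, hjf⟩ := hf
        obtain ⟨k, hk, hkg⟩ := hg
        refine ⟨j + k, add_mem hj hk, ?_⟩
        rw [add_smul, map_add, map_add, add_sub_add_comm]
        exact add_mem hjf hkg
    choose! j hj1 hj2 using h1
    exact ⟨∑ p ∈ t, j p, sum_mem hj1, by
      rw [← Finset.sum_sub_distrib]; exact sum_mem hj2⟩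
  -- Subtracting an element of `J'` with the same symbol lowers the order, and order zero means
  -- zero.
  have hle : ∀ n, ∀ j ∈ J, j ∈ wordFiltration K x n → j ∈ J' := by
    intro n
    induction n with
    | zero =>
      intro j _ hj
      have : wordFiltration K x 0 = ⊥ := by simp [wordFiltration]
      rw [this, Submodule.mem_bot] at hj
      rw [hj]; exact zero_mem _
    | succ n ih =>
      intro j hjJ hj
      obtain ⟨p, hp, hjp⟩ := exists_isHomogeneous_sub_mem hx hj
      obtain ⟨j', hj', hsub'⟩ := key p (Ideal.subset_span ⟨n, hp, j, hjJ, hjp⟩) n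
      rw [MvPolynomial.homogeneousComponent_of_mem hp, if_pos rfl] at hsub'
      have h2 := ih (j - j') (sub_mem hjJ (hJ' hj')) (by simpa using sub_mem hjp hsub')
      simpa using add_mem h2 hj'
  have hall : ∀ a : A, ∃ n, a ∈ wordFiltration K x n := by
    intro a
    have ha : a ∈ Algebra.adjoin K (Set.range x) := by rw [htop]; trivial
    rw [← Subalgebra.mem_toSubmodule, Algebra.adjoin_eq_span] at ha
    induction ha using Submodule.span_induction with
    | mem a h =>
      obtain ⟨l, hl, rfl⟩ := Submonoid.exists_list_of_mem_closure h
      obtain ⟨l', rfl⟩ : l ∈ Set.range (List.map x) := by rwa [Set.range_list_map]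
      exact ⟨l'.length + 1, prod_mem_wordFiltration (Nat.lt_succ_self _)⟩
    | zero => exact ⟨0, zero_mem _⟩
    | add a b _ _ ha hb =>
      obtain ⟨m, hm⟩ := ha
      obtain ⟨n, hn⟩ := hb
      exact ⟨max m n, add_mem (wordFiltration_mono (le_max_left _ _) hm)
        (wordFiltration_mono (le_max_right _ _) hn)⟩
    | smul c a _ ha => exact ha.imp fun n hn => Submodule.smul_mem _ _ hn
  have hJJ' : J = J' := le_antisymm (fun j hj => (hall j).elim fun n hn => hle n j hj hn) hJ'
  rw [hJJ']
  exact ⟨t.image lift, rfl⟩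

end AlmostCommutative

/-! ### Noetherianity of the enveloping algebra -/

section Enveloping

variable {K : Type*} [Field K] {L : Type*} [LieRing L] [LieAlgebra K L]

local notation "𝓤" => UniversalEnvelopingAlgebra K L

/-- By the universal property the identity of `𝓤` factors through the subalgebra `S`. -/
lemma adjoin_range_ι : Algebra.adjoin K (Set.range (ι K : L → 𝓤)) = ⊤ := by
  let S := Algebra.adjoin K (Set.range (ι K : L → 𝓤))
  have hS : ∀ y : L, ι K y ∈ S := fun y => Algebra.subset_adjoin ⟨y, rfl⟩
  let j : L →ₗ⁅K⁆ S :=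
    { toFun := fun y => ⟨ι K y, hS y⟩
      map_add' := fun y z => Subtype.ext (map_add (ι K) y z)
      map_smul' := fun c y => Subtype.ext (map_smul (ι K) c y)
      map_lie' := fun {y z} => Subtype.ext (LieHom.map_lie (ι K) y z) }
  have hid : S.val.comp (UniversalEnvelopingAlgebra.lift K j) = AlgHom.id K 𝓤 := by
    apply UniversalEnvelopingAlgebra.hom_ext
    ext y
    change ((UniversalEnvelopingAlgebra.lift K j (ι K y) : S) : 𝓤) = ι K y
    rw [UniversalEnvelopingAlgebra.lift_ι_apply]
    rfl
  rw [eq_top_iff]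
  intro a _
  have := DFunLike.congr_fun hid a
  rw [AlgHom.id_apply] at this
  rw [← this]
  exact (UniversalEnvelopingAlgebra.lift K j a).2

lemma ι_mul_sub (y z : L) : ι K y * ι K z - ι K z * ι K y = (ι K ⁅y, z⁆ : 𝓤) := by
  rw [LieHom.map_lie]; rfl

/-- The universal enveloping algebra of a finite dimensional Lie algebra is left noetherian. -/
theorem isNoetherianRing_universalEnvelopingAlgebra [FiniteDimensional K L] :
    IsNoetherianRing 𝓤 := by
  let b := Module.finBasis K L
  have hspan : Submodule.span K (Set.range fun i => (ι K (b i) : 𝓤)) =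
      LinearMap.range (ι K : L →ₗ⁅K⁆ 𝓤).toLinearMap := by
    rw [LinearMap.range_eq_map, ← b.span_eq, Submodule.map_span, ← Set.range_comp]
    rfl
  refine isNoetherianRing_of_commutators (K := K) (x := fun i => (ι K (b i) : 𝓤)) ?_ ?_
  · intro i j
    rw [hspan, ι_mul_sub]
    exact ⟨_, rfl⟩
  · rw [← Algebra.adjoin_span, hspan, ← adjoin_range_ι]
    rfl

end Enveloping

/-! ### Whittaker vectors and the Kazhdan filtration -/

/-- A graded Lie algebra with a functional `χ` of degree `2`, a homogeneous basis `x` of a subspace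
`m` of negative elements, and elements `u` that are dual to `x` for the pairing
`(ξ, η) ↦ χ [ξ, η]`. -/
structure IsWhittakerSystem {K L J : Type*} [Field K] [LieRing L] [LieAlgebra K L]
    (g : ℤ → Submodule K L) (m : Submodule K L) (χ : L →ₗ[K] K) (x u : J → L) (d : J → ℤ) :
    Prop where
  lie_mem : ∀ {i j y z}, y ∈ g i → z ∈ g j → ⁅y, z⁆ ∈ g (i + j)
  iSup_eq : ⨆ i, g i = ⊤
  le : ∀ i ≤ -2, g i ≤ m
  χ_eq_zero : ∀ {i y}, i ≠ -2 → y ∈ g i → χ y = 0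
  d_pos : ∀ i, 1 ≤ d i
  x_mem : ∀ i, x i ∈ m
  x_mem_grading : ∀ i, x i ∈ g (-d i)
  le_span : m ≤ Submodule.span K (Set.range x)
  mem_span : ∀ {i y}, i ≤ -2 → y ∈ g i → y ∈ Submodule.span K (x '' {j | -d j = i})
  χ_lie : ∀ i j, χ ⁅x i, x j⁆ = 0
  u_mem : ∀ i, u i ∈ g (d i - 2)
  pairing : ∀ i, χ ⁅x i, u i⁆ = 1
  pairing_ne : ∀ i j, i ≠ j → χ ⁅x i, u j⁆ = 0

section Whittaker

variable {K : Type*} [Field K] {L : Type*} [LieRing L] [LieAlgebra K L]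
variable {E : Type*} [AddCommGroup E] [Module K E] [Module (UniversalEnvelopingAlgebra K L) E]
  [IsScalarTower K (UniversalEnvelopingAlgebra K L) E]

local notation "𝓤" => UniversalEnvelopingAlgebra K L

variable (E) in
/-- The action of `ξ - χ(ξ)` on a `U(L)`-module. -/
def shiftAct (χ : L →ₗ[K] K) : L →ₗ[K] Module.End K E :=
  (Algebra.lsmul K K E : 𝓤 →ₐ[K] Module.End K E).toLinearMap ∘ₗ
    ((ι K : L →ₗ⁅K⁆ 𝓤).toLinearMap - Algebra.linearMap K 𝓤 ∘ₗ χ)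

lemma shiftAct_apply (χ : L →ₗ[K] K) (z : L) (e : E) :
    shiftAct E χ z e = (ι K z : 𝓤) • e - χ z • e := by
  change ((ι K z : 𝓤) - algebraMap K 𝓤 (χ z)) • e = _
  rw [sub_smul, algebraMap_smul]

lemma ι_smul_eq (χ : L →ₗ[K] K) (z : L) (e : E) :
    (ι K z : 𝓤) • e = χ z • e + shiftAct E χ z e := by
  rw [shiftAct_apply]; abel

lemma shiftAct_ι_smul (χ : L →ₗ[K] K) (z y : L) (e : E) :
    shiftAct E χ z ((ι K y : 𝓤) • e) = (ι K ⁅z, y⁆ : 𝓤) • e + (ι K y : 𝓤) • shiftAct E χ z e := by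
  rw [shiftAct_apply, shiftAct_apply, ← ι_mul_sub, sub_smul, smul_sub, mul_smul, mul_smul,
    smul_comm (χ z)]
  abel

/-- When `χ` vanishes on the bracket, the shifted operators have the same commutator as the
unshifted ones, so no scalar is left over. -/
lemma shiftAct_lie (χ : L →ₗ[K] K) {z y : L} (h : χ ⁅z, y⁆ = 0) (e : E) :
    shiftAct E χ z (shiftAct E χ y e) = shiftAct E χ y (shiftAct E χ z e) +
      shiftAct E χ ⁅z, y⁆ e := by
  rw [shiftAct_apply χ y e, map_sub, shiftAct_ι_smul, ι_smul_eq χ ⁅z, y⁆, h, zero_smul, zero_add,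
    map_smul, shiftAct_apply χ y (shiftAct E χ z e)]
  abel

variable (E) in
/-- The Whittaker vectors: the vectors on which each `ξ ∈ 𝔪` acts by `χ(ξ)`. -/
def whittaker (m : Submodule K L) (χ : L →ₗ[K] K) : Submodule K E where
  carrier := {e | ∀ z ∈ m, shiftAct E χ z e = 0}
  zero_mem' := fun z _ => map_zero _
  add_mem' := fun {a b} ha hb z hz => by rw [map_add, ha z hz, hb z hz, add_zero]
  smul_mem' := fun c a ha z hz => by rw [map_smul, ha z hz, smul_zero]

variable (E) in
/-- The span of the vectors `y₁ ⋯ yₜ v` with `v` a Whittaker vector and `yᵢ` homogeneous of degrees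
`kᵢ ≥ -1` such that `∑ (2 kᵢ + 3) ≤ q`. -/
def kazhdan (g : ℤ → Submodule K L) (m : Submodule K L) (χ : L →ₗ[K] K) (q : ℤ) : Submodule K E :=
  Submodule.span K {e | ∃ l : List (ℤ × L), (∀ p ∈ l, -1 ≤ p.1 ∧ p.2 ∈ g p.1) ∧
    (l.map fun p => 2 * p.1 + 3).sum ≤ q ∧ ∃ v ∈ whittaker E m χ,
      e = (l.map fun p => (ι K p.2 : 𝓤)).prod • v}

variable {g : ℤ → Submodule K L} {m : Submodule K L} {χ : L →ₗ[K] K}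

lemma kazhdan_mono {p q : ℤ} (h : p ≤ q) : kazhdan E g m χ p ≤ kazhdan E g m χ q :=
  Submodule.span_mono fun _ ⟨l, h1, h2, h3⟩ => ⟨l, h1, h2.trans h, h3⟩

lemma le_kazhdan : whittaker E m χ ≤ kazhdan E g m χ 0 := fun v hv =>
  Submodule.subset_span ⟨[], by simp, by simp, v, hv, by simp⟩

lemma length_le_sum {l : List (ℤ × L)} (h : ∀ p ∈ l, -1 ≤ p.1 ∧ p.2 ∈ g p.1) :
    (l.length : ℤ) ≤ (l.map fun p => 2 * p.1 + 3).sum := by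
  induction l with
  | nil => simp
  | cons p l ih =>
    have h1 := (h p (by simp)).1
    have h2 := ih fun p hp => h p (by simp [hp])
    simp only [List.length_cons, List.map_cons, List.sum_cons]
    push_cast
    linarith

/-- Every factor has weight at least 1 because `k ≥ -1`. Error terms of negative weight therefore
vanish, which turns the congruences below into equalities. -/
lemma kazhdan_eq_bot {q : ℤ} (hq : q < 0) : kazhdan E g m χ q = ⊥ := by
  rw [kazhdan, Submodule.span_eq_bot]
  rintro _ ⟨l, h1, h2, -⟩
  have := length_le_sum h1
  omega

lemma ι_smul_mem_kazhdan {k : ℤ} (hk : -1 ≤ k) {y : L} (hy : y ∈ g k) {q q' : ℤ} {e : E}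
    (he : e ∈ kazhdan E g m χ q) (hq : 2 * k + 3 + q ≤ q') : (ι K y : 𝓤) • e ∈ kazhdan E g m χ q' := by
  refine kazhdan_mono hq ?_
  have hle : kazhdan E g m χ q ≤ (kazhdan E g m χ (2 * k + 3 + q)).comap
      (Algebra.lsmul K K E (ι K y : 𝓤)) := by
    refine Submodule.span_le.2 ?_
    rintro _ ⟨l, h1, h2, v, hv, rfl⟩
    refine Submodule.subset_span ⟨(k, y) :: l, ?_, ?_, v, hv, ?_⟩
    · intro p hp
      obtain rfl | hp := List.mem_cons.1 hp
      · exact ⟨hk, hy⟩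
      · exact h1 p hp
    · simpa using h2
    · simp [mul_smul]
  exact hle he

variable {J : Type*} {x u : J → L} {d : J → ℤ}

variable (K) in
/-- The product of the elements `u j` of `U(L)` along a list. -/
def uWord (u : J → L) (l : List J) : 𝓤 := (l.map fun j => (ι K (u j) : 𝓤)).prod

lemma uWord_cons (u : J → L) (j : J) (l : List J) :
    uWord K u (j :: l) = (ι K (u j) : 𝓤) * uWord K u l := by
  simp [uWord]

variable (E) in
/-- The successive actions of the elements `x j - χ (x j)` along a list. -/
def xAct (χ : L →ₗ[K] K) (x : J → L) : List J → Module.End K E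
  | [] => LinearMap.id
  | j :: l => xAct χ x l ∘ₗ shiftAct E χ (x j)

lemma xAct_append_singleton (χ : L →ₗ[K] K) (x : J → L) (l : List J) (j : J) (e : E) :
    xAct E χ x (l ++ [j]) e = shiftAct E χ (x j) (xAct E χ x l e) := by
  induction l generalizing e with
  | nil => rfl
  | cons i l ih => exact ih _

/-- The total weight of a list of indices, where the index `j` has weight `2 d j - 1`. -/
def wordWeight (d : J → ℤ) (l : List J) : ℤ := (l.map fun j => 2 * d j - 1).sum

lemma wordWeight_cons (d : J → ℤ) (j : J) (l : List J) :
    wordWeight d (j :: l) = 2 * d j - 1 + wordWeight d l := by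
  simp [wordWeight]

lemma wordWeight_perm (d : J → ℤ) {l l' : List J} (h : l.Perm l') :
    wordWeight d l = wordWeight d l' :=
  (h.map _).sum_eq

variable (E) in
/-- The vectors that are killed by all words in the `x j - χ (x j)` of weight more than `p`. -/
def killedAbove (χ : L →ₗ[K] K) (x : J → L) (d : J → ℤ) (p : ℤ) : Submodule K E where
  carrier := {e | ∀ l, p < wordWeight d l → xAct E χ x l e = 0}
  zero_mem' := fun l _ => map_zero _
  add_mem' := fun {a b} ha hb l hl => by rw [map_add, ha l hl, hb l hl, add_zero]
  smul_mem' := fun c a ha l hl => by rw [map_smul, ha l hl, smul_zero]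

/-! ### Duality between words in the `x j` and words in the `u j` -/

namespace IsWhittakerSystem

variable (H : IsWhittakerSystem g m χ x u d)
include H

lemma χ_smul_mem {k : ℤ} {y : L} (hy : y ∈ g k) {q q' : ℤ} {e : E} (he : e ∈ kazhdan E g m χ q)
    (hq : k = -2 → q ≤ q') : χ y • e ∈ kazhdan E g m χ q' := by
  by_cases hk : k = -2
  · exact kazhdan_mono (hq hk) (Submodule.smul_mem _ _ he)
  · rw [H.χ_eq_zero hk hy, zero_smul]
    exact zero_mem _

/-- Move `z - χ z` to the right until it reaches the Whittaker vector, which it kills. A commutator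
with `y ∈ g k` has degree `k - c`; it is a new factor if that is at least `-1`, a scalar plus a
shifted operator if it is `-2`, and a shifted operator below. -/
lemma shiftAct_mem {z : L} (hzm : z ∈ m) {c : ℤ} (hc : 1 ≤ c) (hz : z ∈ g (-c)) {q q' : ℤ} {e : E}
    (he : e ∈ kazhdan E g m χ q) (hq : q - (2 * c - 1) ≤ q') :
    shiftAct E χ z e ∈ kazhdan E g m χ q' := by
  refine kazhdan_mono hq ?_
  -- The element `z` and its degree are quantified after the word, because the induction hypothesis
  -- is also applied to the commutator `⁅z, y⁆`, which may lie deeper in `m`.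
  suffices hw : ∀ l : List (ℤ × L), (∀ p ∈ l, -1 ≤ p.1 ∧ p.2 ∈ g p.1) → ∀ v ∈ whittaker E m χ,
      ∀ z ∈ m, ∀ c : ℤ, 1 ≤ c → z ∈ g (-c) →
        shiftAct E χ z ((l.map fun p => (ι K p.2 : 𝓤)).prod • v) ∈
          kazhdan E g m χ ((l.map fun p => 2 * p.1 + 3).sum - (2 * c - 1)) by
    have hle : kazhdan E g m χ q ≤ (kazhdan E g m χ (q - (2 * c - 1))).comap (shiftAct E χ z) := by
      refine Submodule.span_le.2 ?_
      rintro _ ⟨l, h1, h2, v, hv, rfl⟩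
      exact kazhdan_mono (by omega) (hw l h1 v hv z hzm c hc hz)
    exact hle he
  intro l
  induction l with
  | nil =>
    intro _ v hv z hzm c _ _
    simp [hv z hzm]
  | cons p l ih =>
    intro h1 v hv z hzm c hc hz
    obtain ⟨k, y⟩ := p
    obtain ⟨hk, hy⟩ : -1 ≤ k ∧ y ∈ g k := h1 (k, y) (by simp)
    have h1' := fun p hp => h1 p (List.mem_cons_of_mem _ hp)
    have ih' := ih h1' v hv
    have hmem : (l.map fun p => (ι K p.2 : 𝓤)).prod • v ∈
        kazhdan E g m χ (l.map fun p => 2 * p.1 + 3).sum :=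
      Submodule.subset_span ⟨l, h1', le_rfl, v, hv, rfl⟩
    simp only [List.map_cons, List.prod_cons, List.sum_cons, mul_smul]
    set e := (l.map fun p => (ι K p.2 : 𝓤)).prod • v
    set s := (l.map fun p => 2 * p.1 + 3).sum
    rw [shiftAct_ι_smul]
    refine add_mem ?_ (ι_smul_mem_kazhdan hk hy (ih' z hzm c hc hz) (by omega))
    have hzy := H.lie_mem hz hy
    by_cases hkc : -1 ≤ -c + k
    · exact ι_smul_mem_kazhdan hkc hzy hmem (by omega)
    · rw [ι_smul_eq χ]
      refine add_mem (H.χ_smul_mem hzy hmem (by omega)) ?_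
      exact kazhdan_mono (by omega) (ih' _ (H.le _ (by omega) hzy) (c - k) (by omega)
        (by rwa [neg_sub, sub_eq_neg_add]))

/-- The extra `- 1` in the bound is the purpose of the weights `2 k + 3`. A commutator of degree `k
- c ≥ -1` has weight `2 (k - c) + 3 = (2 k + 3) - (2 c - 1) - 1`, while the scalar at `k - c = -2`
sits exactly at `(2 k + 3) - (2 c - 1) = 0`. Only the scalar is visible in top weight. -/
lemma ι_lie_smul_sub_mem {z : L} {c : ℤ} (hz : z ∈ g (-c)) {k : ℤ} (_ : -1 ≤ k)
    {y : L} (hy : y ∈ g k) {q q' : ℤ} {e : E} (he : e ∈ kazhdan E g m χ q)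
    (hq : q + (2 * k + 3) - (2 * c - 1) - 1 ≤ q') :
    (ι K ⁅z, y⁆ : 𝓤) • e - χ ⁅z, y⁆ • e ∈ kazhdan E g m χ q' := by
  have hzy := H.lie_mem hz hy
  by_cases hkc : -1 ≤ -c + k
  · rw [H.χ_eq_zero (by omega) hzy, zero_smul, sub_zero]
    exact ι_smul_mem_kazhdan hkc hzy he (by omega)
  · rw [← shiftAct_apply]
    exact H.shiftAct_mem (c := c - k) (H.le _ (by omega) hzy) (by omega)
      (by rwa [neg_sub, sub_eq_neg_add]) he (by omega)

lemma length_le_wordWeight (l : List J) : (l.length : ℤ) ≤ wordWeight d l := by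
  induction l with
  | nil => simp [wordWeight]
  | cons j l ih =>
    have := H.d_pos j
    rw [wordWeight_cons, List.length_cons]
    push_cast
    linarith

lemma xAct_mem (l : List J) {q q' : ℤ} {e : E} (he : e ∈ kazhdan E g m χ q)
    (hq : q - wordWeight d l ≤ q') : xAct E χ x l e ∈ kazhdan E g m χ q' := by
  induction l generalizing q e with
  | nil => exact kazhdan_mono (by simpa [wordWeight] using hq) he
  | cons j l ih =>
    rw [wordWeight_cons] at hq
    exact ih (H.shiftAct_mem (H.x_mem j) (H.d_pos j) (H.x_mem_grading j) he le_rfl) (by linarith)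

lemma uWord_smul_mem (l : List J) {q q' : ℤ} {e : E} (he : e ∈ kazhdan E g m χ q)
    (hq : wordWeight d l + q ≤ q') : uWord K u l • e ∈ kazhdan E g m χ q' := by
  induction l generalizing q' with
  | nil => simpa [uWord] using kazhdan_mono (by simpa [wordWeight] using hq) he
  | cons j l ih =>
    rw [wordWeight_cons] at hq
    rw [uWord_cons, mul_smul]
    exact ι_smul_mem_kazhdan (by have := H.d_pos j; omega) (H.u_mem j) (ih le_rfl) (by linarith)

/-- To leading order `x i - χ (x i)` acts as the derivation `∂/∂u i`: `S` lists the words obtained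
by deleting one occurrence of `i` from `l`, and all other commutators have smaller weight. -/
lemma exists_shiftAct_uWord_sub_mem (i : J) (l : List J) :
    ∃ S : Multiset (List J), (∀ l' ∈ S, (i :: l').Perm l) ∧ (i ∈ l → S ≠ 0) ∧
      ∀ v ∈ whittaker E m χ, shiftAct E χ (x i) (uWord K u l • v) -
        (S.map fun l' => uWord K u l' • v).sum ∈
          kazhdan E g m χ (wordWeight d l - (2 * d i - 1) - 1) := by
  classical
  induction l with
  | nil => exact ⟨0, by simp, by simp, fun v hv => by simp [uWord, hv _ (H.x_mem i)]⟩
  | cons j l ih =>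
    obtain ⟨S, hS1, hS2, hS3⟩ := ih
    refine ⟨(if i = j then {l} else 0) + S.map (j :: ·), ?_, ?_, ?_⟩
    · intro l' hl'
      obtain h | h := Multiset.mem_add.1 hl'
      · split_ifs at h with hij
        · rw [Multiset.mem_singleton.1 h, hij]
        · simp at h
      · obtain ⟨l'', hl'', rfl⟩ := Multiset.mem_map.1 h
        exact (List.Perm.swap _ _ _).trans ((hS1 _ hl'').cons j)
    · intro hi
      obtain rfl | hi := List.mem_cons.1 hi
      · simp
      · simp [hS2 hi]
    · intro v hv
      have hd := H.d_pos j
      have hv0 := H.uWord_smul_mem l (le_kazhdan hv) (add_zero _).le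
      have h1 := H.ι_lie_smul_sub_mem (H.x_mem_grading i) (by omega) (H.u_mem j) hv0
        (q' := wordWeight d (j :: l) - (2 * d i - 1) - 1) (by rw [wordWeight_cons]; omega)
      have h2 := ι_smul_mem_kazhdan (by omega) (H.u_mem j) (hS3 v hv)
        (q' := wordWeight d (j :: l) - (2 * d i - 1) - 1) (by rw [wordWeight_cons]; omega)
      convert add_mem h1 h2 using 1
      rw [uWord_cons, mul_smul, shiftAct_ι_smul, Multiset.map_add, Multiset.sum_add,
        Multiset.map_map, smul_sub, Multiset.smul_sum, Multiset.map_map]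
      have h3 : (Multiset.map (fun l' => uWord K u l' • v) (if i = j then {l} else 0)).sum =
          χ ⁅x i, u j⁆ • uWord K u l • v := by
        split_ifs with hij
        · subst hij; simp [H.pairing]
        · simp [H.pairing_ne i j hij]
      simp only [h3, Function.comp_def, uWord_cons, mul_smul]
      abel

/-- Words in the `x j - χ (x j)` and words in the `u j` of the same weight are dual to each other on
Whittaker vectors. -/
lemma exists_xAct_uWord_eq (l l' : List J) (h : wordWeight d l = wordWeight d l') :
    ∃ c : ℕ, (c ≠ 0 ↔ l.Perm l') ∧
      ∀ v ∈ whittaker E m χ, xAct E χ x l (uWord K u l' • v) = c • v := by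
  induction l generalizing l' with
  | nil =>
    have h1 := H.length_le_wordWeight l'
    have hl' : l' = [] := List.length_eq_zero_iff.1 (by simp [wordWeight] at h h1; omega)
    subst hl'
    exact ⟨1, by simp, fun v _ => by simp [uWord, xAct]⟩
  | cons i l ih =>
    obtain ⟨S, hS1, hS2, hS3⟩ := H.exists_shiftAct_uWord_sub_mem (E := E) i l'
    rw [wordWeight_cons] at h
    have hw : ∀ l'' ∈ S, wordWeight d l = wordWeight d l'' := by
      intro l'' hl''
      have := wordWeight_perm d (hS1 l'' hl'')
      rw [wordWeight_cons] at this
      omega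
    choose! c hc1 hc2 using fun l'' (hl'' : l'' ∈ S) => ih l'' (hw l'' hl'')
    -- The constant counts successive deletions that exhaust `l'`. It is a sum of natural numbers,
    -- so there is no cancellation and it is nonzero as soon as one term is.
    refine ⟨(S.map c).sum, ?_, fun v hv => ?_⟩
    · rw [Ne, Multiset.sum_eq_zero_iff]
      constructor
      · intro hne
        by_contra hnp
        refine hne fun y hy => ?_
        obtain ⟨l'', hl'', rfl⟩ := Multiset.mem_map.1 hy
        by_contra hcne
        exact hnp ((((hc1 l'' hl'').1 hcne).cons i).trans (hS1 l'' hl''))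
      · intro hp hall
        obtain ⟨l'', hl''⟩ := Multiset.exists_mem_of_ne_zero (hS2 (hp.subset (by simp)))
        refine (hc1 l'' hl'').2 ((List.perm_cons i).1 (hp.trans (hS1 l'' hl'').symm)) ?_
        exact hall _ (Multiset.mem_map_of_mem c hl'')
    · have h1 := H.xAct_mem (q' := -1) l (hS3 v hv) (by omega)
      rw [kazhdan_eq_bot (by omega), Submodule.mem_bot, map_sub, sub_eq_zero,
        map_multiset_sum, Multiset.map_map] at h1
      change xAct E χ x l (shiftAct E χ (x i) (uWord K u l' • v)) = _
      rw [h1, Multiset.sum_smul]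
      congr 1
      rw [Multiset.map_map]
      exact Multiset.map_congr rfl fun l'' hl'' => hc2 l'' hl'' v hv

lemma xAct_uWord_eq_zero {l l' : List J} (h : wordWeight d l' < wordWeight d l) {v : E}
    (hv : v ∈ whittaker E m χ) : xAct E χ x l (uWord K u l' • v) = 0 := by
  have h1 := H.xAct_mem (q' := -1) l (H.uWord_smul_mem l' (le_kazhdan hv) (add_zero _).le)
    (by omega)
  rwa [kazhdan_eq_bot (by omega)] at h1

lemma shiftAct_mem_killedAbove (i : J) {p : ℤ} {e : E} (he : e ∈ killedAbove E χ x d p) {p' : ℤ}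
    (hp : p - (2 * d i - 1) ≤ p') :
    shiftAct E χ (x i) e ∈ killedAbove E χ x d p' :=
  fun l hl => he (i :: l) (by rw [wordWeight_cons]; omega)

/-- The commutator of the operators of `x i` and `x j` is a combination of operators of `x k` with
`d k = d i + d j`. Such an index has weight `2 (d i + d j) - 1`, one more than `i` and `j` together,
so the commutator term is killed. -/
lemma xAct_eq_of_perm {l l' : List J} (h : l.Perm l') {e : E}
    (he : e ∈ killedAbove E χ x d (wordWeight d l)) : xAct E χ x l e = xAct E χ x l' e := by
  induction h generalizing e with
  | nil => rfl
  | cons i _ ih =>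
    exact ih (H.shiftAct_mem_killedAbove i he (by rw [wordWeight_cons]; omega))
  | swap i j l =>
    change xAct E χ x l (shiftAct E χ (x i) (shiftAct E χ (x j) e)) =
      xAct E χ x l (shiftAct E χ (x j) (shiftAct E χ (x i) e))
    rw [shiftAct_lie χ (H.χ_lie i j), map_add, add_eq_left]
    have hi := H.d_pos i
    have hj := H.d_pos j
    have h1 := H.mem_span (by omega) (H.lie_mem (H.x_mem_grading i) (H.x_mem_grading j))
    generalize ⁅x i, x j⁆ = z at h1
    induction h1 using Submodule.span_induction with
    | mem z hz =>
      obtain ⟨k, hk, rfl⟩ := hz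
      have hk' : -d k = -d i + -d j := hk
      exact he (k :: l) (by rw [wordWeight_cons, wordWeight_cons, wordWeight_cons]; omega)
    | zero => simp
    | add y z _ _ hy hz => rw [map_add, LinearMap.add_apply, map_add, hy, hz, add_zero]
    | smul c z _ hz => rw [map_smul, LinearMap.smul_apply, map_smul, hz, smul_zero]
  | trans h1 _ ih1 ih2 =>
    rw [ih1 he, ih2 (by rwa [← wordWeight_perm d h1])]

/-- Every vector that is killed by all words of large weight is a combination of vectors `u v` with
`v` a Whittaker vector. -/
lemma mem_span_uWord_smul [Finite J] [CharZero K] (p : ℤ) {e : E}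
    (he : e ∈ killedAbove E χ x d p) :
    e ∈ Submodule.span K {e | ∃ (s : Multiset J), ∃ v ∈ whittaker E m χ,
      e = uWord K u s.toList • v} := by
  classical
  have := Fintype.ofFinite J
  obtain hp | hp := lt_or_ge p 0
  · have h0 : e = 0 := he [] (by simpa [wordWeight] using hp)
    rw [h0]; exact zero_mem _
  lift p to ℕ using hp
  induction p using Nat.strong_induction_on generalizing e with
  | _ p ih =>
  -- All multisets of weight `p`. Each index has weight at least 1, so multiplicities are at most
  -- `p` and the set is finite.
  let B : Finset (Multiset J) := {s ∈ Finset.Iic (p • Finset.univ.val) | wordWeight d s.toList = p}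
  have hB : ∀ l : List J, wordWeight d l = p → (l : Multiset J) ∈ B := by
    intro l hl
    refine Finset.mem_filter.2 ⟨Finset.mem_Iic.2 (Multiset.le_iff_count.2 fun j => ?_), ?_⟩
    · have h1 := H.length_le_wordWeight l
      have h2 : l.count j ≤ l.length := List.count_le_length
      simp
      omega
    · rw [← hl]
      exact wordWeight_perm d (by rw [← Multiset.coe_eq_coe]; simp)
  have hBw : ∀ s ∈ B, wordWeight d s.toList = p := fun s hs => (Finset.mem_filter.1 hs).2
  -- A further `x k` would bring the weight above `p`, where `e` is killed.
  have hv : ∀ l : List J, wordWeight d l = p → xAct E χ x l e ∈ whittaker E m χ := by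
    intro l hl z hz
    have hz' := H.le_span hz
    clear hz
    induction hz' using Submodule.span_induction with
    | mem z hz =>
      obtain ⟨k, rfl⟩ := hz
      rw [← xAct_append_singleton]
      refine he _ ?_
      have := H.d_pos k
      rw [wordWeight_perm d (List.perm_append_singleton k l), wordWeight_cons]
      omega
    | zero => simp
    | add y z _ _ hy hz => rw [map_add, LinearMap.add_apply, hy, hz, add_zero]
    | smul c z _ hz => rw [map_smul, LinearMap.smul_apply, hz, smul_zero]
  choose! c hc1 hc2 using fun (s t : Multiset J)
    (h : wordWeight d s.toList = wordWeight d t.toList) =>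
      H.exists_xAct_uWord_eq (E := E) s.toList t.toList h
  -- A Taylor expansion: `c s s` plays the role of a product of factorials, invertible in
  -- characteristic zero. Subtracting the top terms leaves a vector killed by all words of weight at
  -- least `p`.
  let e' := e - ∑ s ∈ B, uWord K u s.toList • ((c s s : K)⁻¹ • xAct E χ x s.toList e)
  have hsum : ∑ s ∈ B, uWord K u s.toList • ((c s s : K)⁻¹ • xAct E χ x s.toList e) ∈
      Submodule.span K {e | ∃ (s : Multiset J), ∃ v ∈ whittaker E m χ,
        e = uWord K u s.toList • v} := by
    refine sum_mem fun s hs => Submodule.subset_span ⟨s, _, ?_, rfl⟩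
    exact Submodule.smul_mem _ _ (hv _ (hBw s hs))
  have he'p : e' ∈ killedAbove E χ x d p := by
    intro l hl
    rw [map_sub, he l hl, map_sum, zero_sub, neg_eq_zero]
    refine Finset.sum_eq_zero fun s hs => H.xAct_uWord_eq_zero (by rwa [hBw s hs]) ?_
    exact Submodule.smul_mem _ _ (hv _ (hBw s hs))
  have he' : e' ∈ killedAbove E χ x d (p - 1) := by
    intro l hl
    obtain hl' | hl' : wordWeight d l = p ∨ (p : ℤ) < wordWeight d l := by omega
    · have hl0 := hB l hl'
      have hperm : l.Perm (l : Multiset J).toList := by rw [← Multiset.coe_eq_coe]; simp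
      rw [H.xAct_eq_of_perm hperm (by rwa [hl'])]
      generalize (l : Multiset J) = t at hl0
      have hterm : ∀ s ∈ B, xAct E χ x t.toList
          (uWord K u s.toList • ((c s s : K)⁻¹ • xAct E χ x s.toList e)) =
            if s = t then xAct E χ x t.toList e else 0 := by
        intro s hs
        have hw : wordWeight d t.toList = wordWeight d s.toList := by rw [hBw s hs, hBw t hl0]
        rw [hc2 t s hw _ (Submodule.smul_mem _ _ (hv _ (hBw s hs)))]
        split_ifs with hst
        · subst hst
          have hne : (c s s : K) ≠ 0 := Nat.cast_ne_zero.2 ((hc1 s s rfl).2 (List.Perm.refl _))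
          rw [← Nat.cast_smul_eq_nsmul K, smul_smul, mul_inv_cancel₀ hne, one_smul]
        · have : c t s = 0 := by
            by_contra hne
            have h1 := (hc1 t s hw).1 hne
            rw [← Multiset.coe_eq_coe, Multiset.coe_toList, Multiset.coe_toList] at h1
            exact hst h1.symm
          rw [this, zero_smul]
      rw [map_sub, map_sum, Finset.sum_congr rfl hterm, Finset.sum_ite_eq' B t, if_pos hl0,
        sub_self]
    · exact he'p l hl'
  have hmem : e' ∈ Submodule.span K {e | ∃ (s : Multiset J), ∃ v ∈ whittaker E m χ,
      e = uWord K u s.toList • v} := by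
    obtain rfl | hp0 := Nat.eq_zero_or_pos p
    · have h0 : e' = 0 := he' [] (by simp [wordWeight])
      rw [h0]; exact zero_mem _
    · exact ih (p - 1) (by omega) (by rwa [Nat.cast_sub hp0, Nat.cast_one])
  have := add_mem hmem hsum
  simpa [e'] using this

/-- The vectors `u v`, with `u` a monomial in the `u j` and `v` a Whittaker vector, are linearly
independent over the Whittaker vectors. -/
lemma eq_of_sum_mem_whittaker [CharZero K] (c : Multiset J →₀ E)
    (hc : ∀ s, c s ∈ whittaker E m χ)
    (hsum : (c.sum fun s v => uWord K u s.toList • v) ∈ whittaker E m χ) :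
    (c.sum fun s v => uWord K u s.toList • v) = c 0 := by
  classical
  suffices hs : ∀ s ∈ c.support, s = 0 by
    by_cases h0 : c 0 = 0
    · have : c = 0 := by
        ext s
        by_contra hne
        obtain rfl := hs s (Finsupp.mem_support_iff.2 hne)
        exact hne h0
      simp [this]
    · have : c.support = {0} := Finset.eq_singleton_iff_unique_mem.2
        ⟨Finsupp.mem_support_iff.2 h0, hs⟩
      simp [Finsupp.sum, this, uWord]
  by_contra! hne
  obtain ⟨s₁, hs₁, hs₁0⟩ := hne
  obtain ⟨s, hs, hmax⟩ := c.support.exists_max_image (fun s => wordWeight d s.toList) ⟨s₁, hs₁⟩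
  have hpos : 0 < s.toList.length := by
    by_contra hlen
    have h1 := H.length_le_wordWeight s₁.toList
    have h2 := hmax s₁ hs₁
    have h3 : s.toList = [] := List.length_eq_zero_iff.1 (by omega)
    rw [h3] at h2
    simp only [wordWeight, List.map_nil, List.sum_nil] at h1 h2
    have h4 : s₁.toList = [] := List.length_eq_zero_iff.1 (by omega)
    exact hs₁0 (by rwa [Multiset.toList_eq_nil] at h4)
  -- Here `s` is a nonempty monomial of maximal weight in the support. Its dual word kills the sum,
  -- which is a Whittaker vector, but by duality it also extracts a nonzero multiple of `c s`.
  have hkill : xAct E χ x s.toList (c.sum fun s v => uWord K u s.toList • v) = 0 := by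
    obtain ⟨j, l, hl⟩ := List.exists_cons_of_length_pos hpos
    rw [hl]
    change xAct E χ x l (shiftAct E χ (x j) _) = 0
    rw [hsum _ (H.x_mem j), map_zero]
  rw [Finsupp.sum, map_sum] at hkill
  obtain ⟨k, hk1, hk2⟩ := H.exists_xAct_uWord_eq (E := E) s.toList s.toList rfl
  rw [Finset.sum_eq_single s, hk2 _ (hc s)] at hkill
  · have hk : (k : K) ≠ 0 := Nat.cast_ne_zero.2 (hk1.2 (List.Perm.refl _))
    rw [← Nat.cast_smul_eq_nsmul K, smul_eq_zero_iff_right hk] at hkill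
    exact Finsupp.mem_support_iff.1 hs hkill
  · intro t ht hts
    obtain hlt | heq := (hmax t ht).lt_or_eq
    · exact H.xAct_uWord_eq_zero hlt (hc t)
    · obtain ⟨k, hk1, hk2⟩ := H.exists_xAct_uWord_eq (E := E) s.toList t.toList heq.symm
      rw [hk2 _ (hc t)]
      have : k = 0 := by
        by_contra hne
        have h1 := hk1.1 hne
        rw [← Multiset.coe_eq_coe, Multiset.coe_toList, Multiset.coe_toList] at h1
        exact hts h1.symm
      rw [this, zero_smul]
  · intro h; exact absurd hs h

/-- The filtration exhausts the `𝓤`-module generated by a Whittaker vector: each homogeneous element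
of `L` is either an admissible factor or, in degree at most `-2`, a scalar plus an operator that
does not raise the weight. -/
lemma exists_mem_kazhdan {a : E} (ha : a ∈ whittaker E m χ) (b : 𝓤) :
    ∃ q, b • a ∈ kazhdan E g m χ q := by
  have hL : ∀ y : L, ∀ q, ∀ e ∈ kazhdan E g m χ q, ∃ q', (ι K y : 𝓤) • e ∈ kazhdan E g m χ q' := by
    intro y q e he
    have hy : y ∈ ⨆ i, g i := by rw [H.iSup_eq]; trivial
    induction hy using Submodule.iSup_induction' with
    | mem k y hy =>
      by_cases hk : -1 ≤ k
      · exact ⟨_, ι_smul_mem_kazhdan hk hy he le_rfl⟩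
      · refine ⟨q, ?_⟩
        rw [ι_smul_eq χ]
        exact add_mem (Submodule.smul_mem _ _ he)
          (H.shiftAct_mem (H.le k (by omega) hy) (c := -k) (by omega) (by rwa [neg_neg]) he
            (by omega))
    | zero => exact ⟨q, by simp⟩
    | add y z _ _ hy hz =>
      obtain ⟨p, hp⟩ := hy
      obtain ⟨r, hr⟩ := hz
      refine ⟨max p r, ?_⟩
      rw [map_add, add_smul]
      exact add_mem (kazhdan_mono (le_max_left _ _) hp) (kazhdan_mono (le_max_right _ _) hr)
  have hb : b ∈ Algebra.adjoin K (Set.range (ι K : L → 𝓤)) := by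
    rw [adjoin_range_ι]; trivial
  suffices h : ∀ q, ∀ e ∈ kazhdan E g m χ q, ∃ q', b • e ∈ kazhdan E g m χ q' from
    h 0 a (le_kazhdan ha)
  induction hb using Algebra.adjoin_induction with
  | mem b hb =>
    obtain ⟨y, rfl⟩ := hb
    exact hL y
  | algebraMap c =>
    intro q e he
    exact ⟨q, by rw [algebraMap_smul]; exact Submodule.smul_mem _ _ he⟩
  | add b c _ _ hb hc =>
    intro q e he
    obtain ⟨p, hp⟩ := hb q e he
    obtain ⟨r, hr⟩ := hc q e he
    refine ⟨max p r, ?_⟩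
    rw [add_smul]
    exact add_mem (kazhdan_mono (le_max_left _ _) hp) (kazhdan_mono (le_max_right _ _) hr)
  | mul b c _ _ hb hc =>
    intro q e he
    obtain ⟨p, hp⟩ := hc q e he
    obtain ⟨r, hr⟩ := hb p _ hp
    exact ⟨r, by rwa [mul_smul]⟩

lemma mem_killedAbove_of_mem_kazhdan {q : ℤ} {e : E} (he : e ∈ kazhdan E g m χ q) :
    e ∈ killedAbove E χ x d q := by
  intro l hl
  have h1 := H.xAct_mem (q' := -1) l he (by omega)
  rwa [kazhdan_eq_bot (by omega)] at h1

end IsWhittakerSystem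

end Whittaker

/-! ### From the enveloping algebra to its reduction -/

section ReductionNoetherian

variable {K : Type*} [Field K] {L : Type*} [LieRing L] [LieAlgebra K L]

local notation "𝓤" => UniversalEnvelopingAlgebra K L

variable {m : Submodule K L} {χ : L →ₗ[K] K}

lemma Reduction.mk_surjective : Function.Surjective (Reduction.mk m χ) :=
  Ideal.Quotient.mk_surjective

lemma Reduction.mk_eq_mk_iff {a b : adInvariants m χ} :
    Reduction.mk m χ a = Reduction.mk m χ b ↔ (a : 𝓤) - b ∈ shiftIdeal m χ :=
  Ideal.Quotient.eq

/-- Modulo `𝓤 𝔪_χ` the shifted left action of `z ∈ m` on the class of `a` agrees with the commutator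
of `z` with `a`. Thus the reduction is the space of Whittaker vectors of the quotient module. -/
lemma mk_mem_whittaker_iff (a : 𝓤) :
    (shiftIdeal m χ).mkQ a ∈ whittaker (𝓤 ⧸ shiftIdeal m χ) m χ ↔ a ∈ adInvariants m χ := by
  refine forall₂_congr fun z hz => ?_
  have h1 : a * (ι K z - algebraMap K 𝓤 (χ z)) ∈ shiftIdeal m χ :=
    Ideal.mul_mem_left _ _ (Submodule.subset_span ⟨z, hz, rfl⟩)
  have h2 : shiftAct (𝓤 ⧸ shiftIdeal m χ) χ z ((shiftIdeal m χ).mkQ a) =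
      (shiftIdeal m χ).mkQ ((ι K z - algebraMap K 𝓤 (χ z)) * a) := by
    rw [shiftAct_apply, sub_mul, map_sub, ← Algebra.smul_def]
    rfl
  have h3 : (ι K z - algebraMap K 𝓤 (χ z)) * a =
      (ι K z * a - a * ι K z) + a * (ι K z - algebraMap K 𝓤 (χ z)) := by
    rw [sub_mul, mul_sub, Algebra.commutes (χ z) a]
    abel
  rw [h2, Submodule.mkQ_apply, Submodule.Quotient.mk_eq_zero, h3, Submodule.add_mem_iff_left _ h1]

/-- Right multiplication by an element with `ad 𝔪`-invariant class on `U / U 𝔪_χ`. -/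
def rightMul (a : adInvariants m χ) : (𝓤 ⧸ shiftIdeal m χ) →ₗ[𝓤] (𝓤 ⧸ shiftIdeal m χ) :=
  (shiftIdeal m χ).mapQ (shiftIdeal m χ) (LinearMap.toSpanSingleton 𝓤 𝓤 a)
    fun _ hb => shiftIdeal_mul_mem a.2 hb

lemma rightMul_mkQ (a : adInvariants m χ) (b : 𝓤) :
    rightMul a ((shiftIdeal m χ).mkQ b) = (shiftIdeal m χ).mkQ (b * a) := rfl

/-- The `U`-submodule of `U / U 𝔪_χ` generated by a left ideal of the reduction. -/
def idealSpan (I : Ideal (Reduction m χ)) : Submodule 𝓤 (𝓤 ⧸ shiftIdeal m χ) :=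
  Submodule.span 𝓤 {q | ∃ a : adInvariants m χ, Reduction.mk m χ a ∈ I ∧
    q = (shiftIdeal m χ).mkQ (a : 𝓤)}

variable {J : Type*} [Finite J] [CharZero K] {g : ℤ → Submodule K L} {x u : J → L} {d : J → ℤ}

/-- The submodule generated by `I` is the sum of the spaces `uˢ I`, and a Whittaker vector in such a
sum equals its component at the empty monomial. -/
lemma IsWhittakerSystem.mem_of_mem_idealSpan (H : IsWhittakerSystem g m χ x u d)
    {I : Ideal (Reduction m χ)} {a : adInvariants m χ}
    (ha : (shiftIdeal m χ).mkQ (a : 𝓤) ∈ idealSpan I) : Reduction.mk m χ a ∈ I := by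
  classical
  let VI : Submodule K (𝓤 ⧸ shiftIdeal m χ) :=
    { carrier := {q | ∃ a : adInvariants m χ, Reduction.mk m χ a ∈ I ∧
        q = (shiftIdeal m χ).mkQ (a : 𝓤)}
      zero_mem' := ⟨0, by simp, by simp⟩
      add_mem' := by
        rintro _ _ ⟨a, ha, rfl⟩ ⟨b, hb, rfl⟩
        exact ⟨a + b, by rw [map_add]; exact add_mem ha hb, by simp⟩
      smul_mem' := by
        rintro c _ ⟨a, ha, rfl⟩
        refine ⟨c • a, ?_, rfl⟩
        rw [map_smul, Algebra.smul_def]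
        exact Ideal.mul_mem_left _ _ ha }
  have hVI : VI ≤ whittaker _ m χ := by
    rintro _ ⟨a, -, rfl⟩
    exact (mk_mem_whittaker_iff _).2 a.2
  let Sp : Submodule K (𝓤 ⧸ shiftIdeal m χ) := Submodule.span K
    {e | ∃ (s : Multiset J), ∃ v ∈ VI, e = uWord K u s.toList • v}
  have hone : (shiftIdeal m χ).mkQ (1 : 𝓤) ∈ whittaker (𝓤 ⧸ shiftIdeal m χ) m χ :=
    (mk_mem_whittaker_iff _).2 (one_mem _)
  have hsp : ∀ q ∈ idealSpan I, q ∈ Sp := by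
    intro q hq
    induction hq using Submodule.span_induction with
    | mem q hq => exact Submodule.subset_span ⟨0, q, hq, by simp [uWord]⟩
    | zero => exact zero_mem _
    | add p q _ _ hp hq => exact add_mem hp hq
    | smul b q hqI hq =>
      clear hqI
      induction hq using Submodule.span_induction with
      | zero => rw [smul_zero]; exact zero_mem _
      | add p q _ _ hp hq => rw [smul_add]; exact add_mem hp hq
      | smul c q _ hq => rw [smul_comm]; exact Submodule.smul_mem _ _ hq
      | mem q hq =>
        obtain ⟨s, _, ⟨a, haI, rfl⟩, rfl⟩ := hq
        -- Stability under `𝓤`: expand `b uˢ · 1` as a sum of `uᵗ w` with `w` in the reduction, then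
        -- multiply on the right by `a`. The products `w a` stay in the left ideal `I`.
        obtain ⟨p, hp⟩ := H.exists_mem_kazhdan hone (b * uWord K u s.toList)
        have h1 := H.mem_span_uWord_smul p (H.mem_killedAbove_of_mem_kazhdan hp)
        have h2 : b • uWord K u s.toList • (shiftIdeal m χ).mkQ (a : 𝓤) =
            rightMul a ((b * uWord K u s.toList) • (shiftIdeal m χ).mkQ (1 : 𝓤)) := by
          rw [map_smul, rightMul_mkQ, one_mul, mul_smul]
        rw [h2]
        generalize (b * uWord K u s.toList) • (shiftIdeal m χ).mkQ (1 : 𝓤) = e at h1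
        induction h1 using Submodule.span_induction with
        | zero => rw [map_zero]; exact zero_mem _
        | add p q _ _ hp hq => rw [map_add]; exact add_mem hp hq
        | smul c q _ hq =>
          rw [LinearMap.map_smul_of_tower]; exact Submodule.smul_mem _ _ hq
        | mem q hq =>
          obtain ⟨t, v, hv, rfl⟩ := hq
          obtain ⟨w, rfl⟩ := (shiftIdeal m χ).mkQ_surjective v
          have hw := (mk_mem_whittaker_iff w).1 hv
          refine Submodule.subset_span ⟨t, _, ⟨⟨w, hw⟩ * a, ?_, rfl⟩, ?_⟩
          · rw [map_mul]; exact Ideal.mul_mem_left _ _ haI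
          · rw [map_smul, rightMul_mkQ]; rfl
  have hfin : ∀ q ∈ Sp, ∃ c : Multiset J →₀ (𝓤 ⧸ shiftIdeal m χ), (∀ s, c s ∈ VI) ∧
      q = c.sum fun s v => uWord K u s.toList • v := by
    intro q hq
    induction hq using Submodule.span_induction with
    | zero => exact ⟨0, fun _ => zero_mem _, by simp⟩
    | add p q _ _ hp hq =>
      obtain ⟨c, hc, rfl⟩ := hp
      obtain ⟨c', hc', rfl⟩ := hq
      exact ⟨c + c', fun s => add_mem (hc s) (hc' s),
        (Finsupp.sum_add_index' (by simp) (by simp [smul_add])).symm⟩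
    | smul k q _ hq =>
      obtain ⟨c, hc, rfl⟩ := hq
      refine ⟨k • c, fun s => VI.smul_mem k (hc s), ?_⟩
      rw [Finsupp.sum_smul_index' (by simp), Finsupp.smul_sum]
      exact Finsupp.sum_congr fun s _ => smul_comm _ _ _
    | mem q hq =>
      obtain ⟨s, v, hv, rfl⟩ := hq
      refine ⟨Finsupp.single s v, fun t => ?_, by simp⟩
      rw [Finsupp.single_apply]
      split_ifs
      exacts [hv, zero_mem _]
  obtain ⟨c, hc, hac⟩ := hfin _ (hsp _ ha)
  have h1 := H.eq_of_sum_mem_whittaker c (fun s => hVI (hc s))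
    (by rw [← hac]; exact (mk_mem_whittaker_iff _).2 a.2)
  obtain ⟨b, hbI, hb⟩ := hc 0
  rw [← hac, hb, Submodule.mkQ_apply, Submodule.mkQ_apply, Submodule.Quotient.eq] at h1
  rwa [Reduction.mk_eq_mk_iff.2 h1]

/-- The reduction `(U / U 𝔪_χ)^{ad 𝔪}` is left noetherian. -/
theorem IsWhittakerSystem.isNoetherianRing [FiniteDimensional K L]
    (H : IsWhittakerSystem g m χ x u d) : IsNoetherianRing (Reduction m χ) := by
  have := isNoetherianRing_universalEnvelopingAlgebra (K := K) (L := L)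
  have hle : ∀ I I' : Ideal (Reduction m χ), idealSpan I ≤ idealSpan I' → I ≤ I' := by
    intro I I' h w hw
    obtain ⟨a, rfl⟩ := Reduction.mk_surjective w
    exact H.mem_of_mem_idealSpan (h (Submodule.subset_span ⟨a, hw, rfl⟩))
  -- Since `I` is recovered from the submodule it generates, a strictly increasing chain of left
  -- ideals gives one in a noetherian `𝓤`-module.
  have hmono : StrictMono (idealSpan : Ideal (Reduction m χ) → _) := by
    intro I I' h
    refine lt_of_le_not_ge (Submodule.span_mono ?_) fun h' => h.not_ge (hle _ _ h')
    rintro _ ⟨a, ha, rfl⟩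
    exact ⟨a, h.le ha, rfl⟩
  rw [isNoetherianRing_iff, isNoetherian_iff']
  exact hmono.wellFoundedGT

end ReductionNoetherian

/-! ### Diagonalizability of `h` in representations of `sl₂` -/

section Sl2

variable {K : Type*} [Field K] [CharZero K] {V : Type*} [AddCommGroup V] [Module K V]

/-- An endomorphism `a` with `[h, a] = c a` for some `c ≠ 0` is nilpotent. -/
lemma exists_pow_eq_zero_of_commutator [FiniteDimensional K V] {h a : Module.End K V} {c : K}
    (hc : c ≠ 0) (ha : h * a = a * h + c • a) : ∃ n : ℕ, a ^ n = 0 := by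
  by_contra! hne
  let A : Module.End K (Module.End K V) := LinearMap.mulLeft K h - LinearMap.mulRight K h
  have hpow : ∀ n : ℕ, h * a ^ n = a ^ n * h + (n * c) • a ^ n := by
    intro n
    induction n with
    | zero => simp
    | succ n ih =>
      rw [pow_succ, ← mul_assoc, ih, add_mul, mul_assoc, ha]
      push_cast
      simp only [mul_add, add_mul, one_mul, add_smul, smul_mul_assoc, mul_smul_comm, mul_assoc]
      abel
  -- If no power vanished, the powers of `a` would give infinitely many eigenvalues `n c` of `ad h`
  -- on a finite dimensional space.
  have hev : ∀ n : ℕ, A.HasEigenvalue (n * c) := fun n =>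
    Module.End.hasEigenvalue_of_hasEigenvector (x := a ^ n)
      ⟨Module.End.mem_eigenspace_iff.2 (by simp [A, hpow n]), hne n⟩
  refine Set.infinite_of_injective_forall_mem (f := fun n : ℕ => (n : K) * c) ?_ hev
    A.finite_hasEigenvalue
  intro m n hmn
  exact Nat.cast_injective (mul_right_cancel₀ hc hmn)

/-- The sum of the eigenspaces of `h` with eigenvalues in a set of integers. -/
def eigenSum (h : Module.End K V) (S : Set ℤ) : Submodule K V := ⨆ k ∈ S, h.eigenspace (k : K)

lemma eigenSum_mono (h : Module.End K V) {S S' : Set ℤ} (hS : S ⊆ S') :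
    eigenSum h S ≤ eigenSum h S' :=
  biSup_mono hS

/-- On the sum of the eigenspaces indexed by `S` the operator `h - k` is surjective when `k ∉ S`, so
`v` can be corrected to an honest eigenvector. Using a new eigenvalue each time is what avoids
generalized eigenspaces. -/
lemma mem_eigenSum_insert {h : Module.End K V} {S : Set ℤ} {k : ℤ} (hk : k ∉ S) {v : V}
    (hv : h v - (k : K) • v ∈ eigenSum h S) : v ∈ eigenSum h (insert k S) := by
  have hle : eigenSum h S ≤ (eigenSum h S).map (h - algebraMap K _ (k : K)) := by
    refine iSup₂_le fun j hj w hw => ?_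
    have hne : (j : K) - k ≠ 0 := by
      rw [sub_ne_zero, Ne, Int.cast_inj]
      rintro rfl
      exact hk hj
    refine ⟨((j : K) - k)⁻¹ • w, Submodule.smul_mem _ _
      ((le_iSup₂ (f := fun (k : ℤ) (_ : k ∈ S) => h.eigenspace (k : K)) j hj) hw), ?_⟩
    rw [map_smul, LinearMap.sub_apply, Module.End.mem_eigenspace_iff.1 hw,
      Module.algebraMap_end_apply, ← sub_smul, smul_smul, inv_mul_cancel₀ hne, one_smul]
  obtain ⟨w, hw, hwv⟩ := hle hv
  rw [LinearMap.sub_apply, Module.algebraMap_end_apply] at hwv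
  have h1 : v - w ∈ h.eigenspace (k : K) := by
    rw [Module.End.mem_eigenspace_iff, map_sub, smul_sub]
    rw [sub_eq_sub_iff_add_eq_add] at hwv ⊢
    rw [add_comm _ (h w), add_comm _ (_ • w)] at *
    rw [hwv]
  have h2 : v - w + w ∈ eigenSum h (insert k S) := add_mem ((le_iSup₂ (f := fun (j : ℤ) (_ : j ∈ insert k S) => h.eigenspace (j : K)) k
    (Set.mem_insert k S)) h1) (eigenSum_mono h (Set.subset_insert k S) hw)
  rwa [sub_add_cancel] at h2

variable {e h f : Module.End K V}

lemma commutator_e_pow_f (hhf : h * f = f * h - (2 : K) • f) (hef : e * f = f * e + h) (n : ℕ) :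
    e * f ^ (n + 1) = f ^ (n + 1) * e + ((n : K) + 1) • (f ^ n * h - (n : K) • f ^ n) := by
  induction n with
  | zero => simp [hef]
  | succ n ih =>
    rw [pow_succ f (n + 1), ← mul_assoc, ih]
    have h1 : f ^ n * h * f = f ^ (n + 1) * h - (2 : K) • f ^ (n + 1) := by
      rw [mul_assoc, hhf, mul_sub, ← mul_assoc, mul_smul_comm, ← pow_succ]
    rw [add_mul, smul_mul_assoc, sub_mul, h1, mul_assoc, hef, smul_mul_assoc, ← pow_succ, mul_add,
      ← mul_assoc]
    push_cast
    module

/-- A vector of `ker e` is a sum of eigenvectors of `h` with eigenvalues in `ℕ`. -/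
lemma mem_eigenSum_of_e_eq_zero (hhe : h * e = e * h + (2 : K) • e)
    (hhf : h * f = f * h - (2 : K) • f) (hef : e * f = f * e + h) (n : ℕ) {v : V}
    (he : e v = 0) (hf : (f ^ n) v = 0) : v ∈ eigenSum h {k | 0 ≤ k ∧ k < n} := by
  induction n generalizing v with
  | zero => rw [show v = 0 from hf]; exact zero_mem _
  | succ n ih =>
    -- Applying `e` to `f ^ (n + 1) v = 0` gives `f ^ n ((h - n) v) = 0`, and `(h - n) v` is again
    -- in `ker e`.
    have h1 := LinearMap.congr_fun (commutator_e_pow_f hhf hef n) v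
    rw [Module.End.mul_apply, hf, map_zero, LinearMap.add_apply, Module.End.mul_apply, he, map_zero,
      zero_add, LinearMap.smul_apply, eq_comm, smul_eq_zero_iff_right (Nat.cast_add_one_ne_zero n),
      LinearMap.sub_apply, Module.End.mul_apply, LinearMap.smul_apply, ← map_smul, ← map_sub] at h1
    have h2 : e (h v - (n : K) • v) = 0 := by
      have h3 := LinearMap.congr_fun hhe v
      simp only [Module.End.mul_apply, he, map_zero, LinearMap.add_apply, LinearMap.smul_apply,
        smul_zero, add_zero] at h3
      simp [← h3, he]
    refine eigenSum_mono h ?_ (mem_eigenSum_insert (k := n) (S := {k | 0 ≤ k ∧ k < n}) (by simp) ?_)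
    · rintro k (rfl | ⟨hk1, hk2⟩)
      · exact ⟨by simp, by simp⟩
      · exact ⟨hk1, by push_cast; omega⟩
    · rw [Int.cast_natCast]; exact ih h2 h1

/-- In a finite dimensional representation of `sl₂` the element `h` is diagonalizable, with integer
eigenvalues. -/
theorem iSup_eigenspace_int_eq_top [IsAlgClosed K] [FiniteDimensional K V]
    (hhe : h * e = e * h + (2 : K) • e)
    (hhf : h * f = f * h - (2 : K) • f) (hef : e * f = f * e + h) :
    ⨆ k : ℤ, h.eigenspace (k : K) = ⊤ := by
  -- The Casimir element. A vector in `ker e` of `h`-weight `μ` has Casimir eigenvalue `μ ^ 2 + 2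
  -- μ`, and this determines `μ` among the natural numbers.
  let Ω : Module.End K V := (4 : K) • (f * e) + h * h + (2 : K) • h
  have hΩh : Commute Ω h := by
    have h1 : f * e * h = h * (f * e) := by
      rw [← mul_assoc h, hhf, sub_mul, mul_assoc f h, hhe, mul_assoc, mul_add, mul_smul_comm,
        smul_mul_assoc, add_sub_cancel_right]
    rw [commute_iff_eq]
    simp only [Ω, add_mul, mul_add, smul_mul_assoc, mul_smul_comm, h1, mul_assoc]
  have hΩe : Commute Ω e := by
    have h1 : e * h = h * e - (2 : K) • e := by rw [hhe]; abel
    have h2 : e * (h * h) = h * h * e - (4 : K) • (h * e) + (4 : K) • e := by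
      rw [← mul_assoc, h1, sub_mul, mul_assoc h e, h1, smul_mul_assoc, h1, mul_sub, mul_smul_comm,
        ← mul_assoc]
      module
    have h3 : e * (f * e) = f * e * e + h * e := by rw [← mul_assoc, hef, add_mul]
    rw [commute_iff_eq]
    simp only [Ω, add_mul, mul_add, smul_mul_assoc, mul_smul_comm, h1, h2, h3]
    module
  obtain ⟨N, hN⟩ := exists_pow_eq_zero_of_commutator (c := (-2 : K)) (by norm_num)
    (show h * f = f * h + (-2 : K) • f by rw [hhf, neg_smul, sub_eq_add_neg])
  obtain ⟨N', hN'⟩ := exists_pow_eq_zero_of_commutator (c := (2 : K)) (by norm_num) hhe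
  rw [eq_top_iff, ← Module.End.iSup_maxGenEigenspace_eq_top Ω]
  refine iSup_le fun c => ?_
  set E := Ω.maxGenEigenspace c
  have hEh : ∀ v ∈ E, h v ∈ E := Module.End.mapsTo_maxGenEigenspace_of_comm hΩh c
  have hEe : ∀ v ∈ E, e v ∈ E := Module.End.mapsTo_maxGenEigenspace_of_comm hΩe c
  let W : Submodule K V := LinearMap.ker e ⊓ E
  have hker : LinearMap.ker e ≤ ⨆ μ : K, h.genEigenspace μ 1 := by
    intro v hv
    refine (iSup₂_le fun k _ => ?_ : eigenSum h _ ≤ _)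
      (mem_eigenSum_of_e_eq_zero hhe hhf hef N hv (by rw [hN]; rfl))
    exact le_iSup (fun μ : K => h.genEigenspace μ 1) (k : K)
  have hWh : ∀ v ∈ W, h v ∈ W := by
    rintro v ⟨hv1, hv2⟩
    refine ⟨?_, hEh v hv2⟩
    have h3 := LinearMap.congr_fun hhe v
    simp only [Module.End.mul_apply, LinearMap.mem_ker.1 hv1, map_zero, LinearMap.add_apply,
      LinearMap.smul_apply, smul_zero, add_zero] at h3
    exact h3.symm
  have hnat : ∀ μ : K, ∀ v ∈ W, v ≠ 0 → h v = μ • v →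
      (∃ k : ℕ, μ = k) ∧ c = μ ^ 2 + 2 * μ := by
    intro μ v hv hv0 hμ
    have hev : e v = 0 := hv.1
    have h1 : Ω v = (μ ^ 2 + 2 * μ) • v := by
      simp only [Ω, LinearMap.add_apply, LinearMap.smul_apply, Module.End.mul_apply, hev, hμ,
        map_zero, map_smul]
      module
    constructor
    · by_contra hk
      have h2 := mem_eigenSum_of_e_eq_zero hhe hhf hef N hev (by rw [hN]; rfl)
      have h3 : Disjoint (h.eigenspace μ) (⨆ ν : K, ⨆ _ : ν ≠ μ, h.eigenspace ν) :=
        h.eigenspaces_iSupIndep μ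
      refine hv0 (Submodule.disjoint_def.1 h3 v (Module.End.mem_eigenspace_iff.2 hμ)
        ((iSup₂_le fun k hkN => ?_ : eigenSum h _ ≤ _) h2))
      refine le_iSup₂_of_le (k : K) ?_ le_rfl
      rintro rfl
      refine hk ⟨k.toNat, ?_⟩
      rw [← Int.cast_natCast, Int.toNat_of_nonneg hkN.1]
    · by_contra hc
      exact hv0 (Submodule.disjoint_def.1 (Ω.disjoint_genEigenspace hc ⊤ 1) v hv.2
        (Module.End.mem_eigenspace_iff.2 h1))
  -- On one generalized eigenspace `E` of the Casimir all vectors of `ker e` have the same weight;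
  -- if `c` is not of the form `k ^ 2 + 2 k` there are none, and any value serves.
  obtain ⟨k₀, hk₀⟩ : ∃ k₀ : ℤ, ∀ v ∈ W, h v = (k₀ : K) • v := by
    by_cases hW : ∃ k : ℕ, c = (k : K) ^ 2 + 2 * k
    · obtain ⟨k, hk⟩ := hW
      refine ⟨k, fun v hv => ?_⟩
      have h1 : v ∈ W ⊓ ⨆ μ, h.genEigenspace μ 1 := ⟨hv, hker hv.1⟩
      rw [Submodule.inf_iSup_genEigenspace hWh] at h1
      have h2 : (⨆ μ, W ⊓ h.genEigenspace μ 1) ≤ h.eigenspace (k : K) := by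
        refine iSup_le fun μ w hw => ?_
        obtain ⟨hw1, hw2⟩ := hw
        by_cases hw0 : w = 0
        · rw [hw0]; exact zero_mem _
        obtain ⟨⟨j, rfl⟩, hc⟩ := hnat μ w hw1 hw0 (Module.End.mem_eigenspace_iff.1 hw2)
        have hjk : j = k := by
          rw [hk] at hc
          have h3 : k ^ 2 + 2 * k = j ^ 2 + 2 * j := by exact_mod_cast hc
          nlinarith [mul_self_nonneg ((j : ℤ) - k)]
        rwa [← hjk]
      simpa using Module.End.mem_eigenspace_iff.1 (h2 h1)
    · refine ⟨0, fun v hv => ?_⟩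
      have h1 : v ∈ W ⊓ ⨆ μ, h.genEigenspace μ 1 := ⟨hv, hker hv.1⟩
      rw [Submodule.inf_iSup_genEigenspace hWh] at h1
      have h2 : (⨆ μ, W ⊓ h.genEigenspace μ 1) ≤ ⊥ := by
        refine iSup_le fun μ w hw => ?_
        by_contra hw0
        obtain ⟨⟨j, rfl⟩, hc⟩ := hnat μ w hw.1 hw0 (Module.End.mem_eigenspace_iff.1 hw.2)
        exact hW ⟨j, hc⟩
      rw [(Submodule.mem_bot K).1 (h2 h1)]
      simp
  -- If `e ^ (n + 1)` kills `v`, then `e ^ n v` has weight `k₀`, hence `(h - (k₀ - 2 n)) v` is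
  -- killed by `e ^ n`. The weights `k₀ - 2 j` are distinct, so `mem_eigenSum_insert` applies.
  have key : ∀ n : ℕ, ∀ v ∈ E, (e ^ n) v = 0 →
      v ∈ eigenSum h {k | ∃ j : ℕ, j < n ∧ k = k₀ - 2 * j} := by
    intro n
    induction n with
    | zero => intro v _ hv; rw [show v = 0 from hv]; exact zero_mem _
    | succ n ih =>
      intro v hvE hv
      have hpow : h * e ^ n = e ^ n * h + (2 * n : K) • e ^ n := by
        clear ih hv
        induction n with
        | zero => simp
        | succ n ih =>
          rw [pow_succ, ← mul_assoc, ih, add_mul, mul_assoc, hhe, smul_mul_assoc, mul_add,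
            mul_assoc, mul_smul_comm]
          push_cast
          module
      have hmem : (e ^ n) v ∈ W := by
        refine ⟨?_, ?_⟩
        · change e ((e ^ n) v) = 0
          rw [← Module.End.mul_apply, ← pow_succ', hv]
        · clear ih hv hpow
          induction n with
          | zero => exact hvE
          | succ n ih => rw [pow_succ', Module.End.mul_apply]; exact hEe _ ih
      have h1 := hk₀ _ hmem
      rw [← Module.End.mul_apply, hpow] at h1
      refine eigenSum_mono h ?_ (mem_eigenSum_insert (k := k₀ - 2 * n)
        (S := {k | ∃ j : ℕ, j < n ∧ k = k₀ - 2 * j}) ?_ (ih _ ?_ ?_))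
      · rintro k (rfl | ⟨j, hj, rfl⟩)
        · exact ⟨n, by simp, rfl⟩
        · exact ⟨j, by omega, rfl⟩
      · rintro ⟨j, hj, hjn⟩
        omega
      · exact sub_mem (hEh _ hvE) (Submodule.smul_mem _ _ hvE)
      · rw [LinearMap.add_apply, Module.End.mul_apply, LinearMap.smul_apply,
          ← eq_sub_iff_add_eq] at h1
        rw [map_sub, h1, map_smul]
        push_cast
        module
  intro v hv
  refine (iSup₂_le fun k _ => ?_ : eigenSum h _ ≤ _) (key N' v hv (by rw [hN']; rfl))
  exact le_iSup (fun k : ℤ => h.eigenspace (k : K)) k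

end Sl2

/-! ### Infinitesimal invariance of the form -/

section InvariantForm

variable {K : Type*} [Field K] {n : ℕ}

/-- The extension of scalars of a bilinear form on matrices. -/
def extendForm (β : Matrix (Fin n) (Fin n) K →ₗ[K] Matrix (Fin n) (Fin n) K →ₗ[K] K) (R : Type*)
    [CommRing R] [Algebra K R] (M N : Matrix (Fin n) (Fin n) R) : R :=
  ∑ p : Fin n × Fin n, ∑ q : Fin n × Fin n,
    algebraMap K R (β (Matrix.single p.1 p.2 1) (Matrix.single q.1 q.2 1)) * (M p.1 p.2 * N q.1 q.2)

variable (β : Matrix (Fin n) (Fin n) K →ₗ[K] Matrix (Fin n) (Fin n) K →ₗ[K] K)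

lemma extendForm_self (M N : Matrix (Fin n) (Fin n) K) : extendForm β K M N = β M N := by
  have hM : ∀ M : Matrix (Fin n) (Fin n) K,
      M = ∑ p : Fin n × Fin n, M p.1 p.2 • Matrix.single p.1 p.2 (1 : K) := by
    intro M
    rw [Fintype.sum_prod_type]
    conv_lhs => rw [Matrix.matrix_eq_sum_single M]
    simp
  conv_rhs => rw [hM M, hM N]
  simp only [extendForm, map_sum, LinearMap.sum_apply, map_smul, LinearMap.smul_apply, smul_eq_mul,
    Finset.mul_sum]
  rw [Finset.sum_comm]
  exact Finset.sum_congr rfl fun _ _ => Finset.sum_congr rfl fun _ _ => by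
    rw [Algebra.algebraMap_self, RingHom.id_apply]; ring

lemma map_extendForm {R S : Type*} [CommRing R] [Algebra K R] [CommRing S] [Algebra K S]
    (φ : R →ₐ[K] S) (M N : Matrix (Fin n) (Fin n) R) :
    φ (extendForm β R M N) = extendForm β S (φ.mapMatrix M) (φ.mapMatrix N) := by
  simp [extendForm]

lemma extendForm_smul_smul {R : Type*} [CommRing R] [Algebra K R] (c : R)
    (M N : Matrix (Fin n) (Fin n) R) :
    extendForm β R (c • M) (c • N) = c ^ 2 * extendForm β R M N := by
  simp only [extendForm, Matrix.smul_apply, smul_eq_mul, Finset.mul_sum]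
  exact Finset.sum_congr rfl fun _ _ => Finset.sum_congr rfl fun _ _ => by ring

lemma snd_extendForm_dualMatrix (M M' N N' : Matrix (Fin n) (Fin n) K) :
    snd (extendForm β (DualNumber K) (dualMatrix M M') (dualMatrix N N')) =
      β M N' + β M' N := by
  rw [← extendForm_self, ← extendForm_self]
  simp only [extendForm, snd_sum, DualNumber.snd_mul, fst_mul, algebraMap_eq_inl, fst_inl, snd_inl, dualMatrix,
    Matrix.of_apply, fst_add, fst_inr, snd_add, snd_inr, ← Finset.sum_add_distrib]
  exact Finset.sum_congr rfl fun _ _ => Finset.sum_congr rfl fun _ _ => by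
    rw [Algebra.algebraMap_self, RingHom.id_apply]; ring

/-- The generic conjugate of `x`, multiplied by the determinant. -/
def conjMatrix {R : Type*} [CommRing R] [Algebra K R] (x : Matrix (Fin n) (Fin n) K)
    (A : Matrix (Fin n) (Fin n) R) : Matrix (Fin n) (Fin n) R :=
  A * x.map (algebraMap K R) * A.adjugate

lemma map_conjMatrix {R S : Type*} [CommRing R] [Algebra K R] [CommRing S] [Algebra K S]
    (φ : R →ₐ[K] S) (x : Matrix (Fin n) (Fin n) K) (A : Matrix (Fin n) (Fin n) R) :
    φ.mapMatrix (conjMatrix x A) = conjMatrix x (φ.mapMatrix A) := by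
  rw [conjMatrix, map_mul, map_mul, AlgHom.map_adjugate]
  congr 2
  ext i j
  simp

lemma conjMatrix_of_mul_eq_one {R : Type*} [CommRing R] [Algebra K R]
    (x : Matrix (Fin n) (Fin n) K) {A B : Matrix (Fin n) (Fin n) R} (h : A * B = 1) :
    conjMatrix x A = A.det • (A * x.map (algebraMap K R) * B) := by
  have hadj : A.adjugate = A.det • B := by
    calc A.adjugate = A.adjugate * (A * B) := by rw [h, mul_one]
      _ = _ := by rw [← mul_assoc, Matrix.adjugate_mul, Matrix.smul_mul, one_mul]
  rw [conjMatrix, hadj, Matrix.mul_smul]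

/-- A bilinear form which is constant on the `H`-orbit of `(x, y)` is infinitesimally invariant. -/
lemma bilin_lie_eq_zero {H : Subgroup (GL (Fin n) K)} {X : Matrix (Fin n) (Fin n) K}
    (hX : IsTangent H X) (x y : Matrix (Fin n) (Fin n) K)
    (hβ : ∀ g ∈ H, β ((g : Matrix (Fin n) (Fin n) K) * x * (g⁻¹ : GL (Fin n) K))
      ((g : Matrix (Fin n) (Fin n) K) * y * (g⁻¹ : GL (Fin n) K)) = β x y) :
    β x (X * y - y * X) + β (X * x - x * X) y = 0 := by
  let gen : Matrix (Fin n) (Fin n) (MvPolynomial (Fin n × Fin n) K) :=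
    Matrix.of fun i j => MvPolynomial.X (i, j)
  -- Invariance under conjugation with denominators cleared: the adjugate replaces the inverse in
  -- both arguments, which costs `det ^ 2`. The polynomial vanishes on `H`, and its value at `1 + ε
  -- X` has the desired identity as coefficient of `ε`, up to a unit.
  let q : MvPolynomial (Fin n × Fin n) K :=
    extendForm β _ (conjMatrix x gen) (conjMatrix y gen) - algebraMap K _ (β x y) * gen.det ^ 2
  have hq : ∀ {R : Type _} [CommRing R] [Algebra K R] {A B : Matrix (Fin n) (Fin n) R},
      A * B = 1 → evalAt A q = A.det ^ 2 * (extendForm β R (A * x.map (algebraMap K R) * B)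
        (A * y.map (algebraMap K R) * B) - algebraMap K R (β x y)) := by
    intro R _ _ A B hAB
    have hgen : (evalAt A).mapMatrix gen = A := by
      ext i j
      simp [gen, evalAt]
    rw [map_sub, map_mul, map_pow, AlgHom.map_det, AlgHom.commutes, map_extendForm, map_conjMatrix,
      map_conjMatrix, hgen, conjMatrix_of_mul_eq_one x hAB, conjMatrix_of_mul_eq_one y hAB,
      extendForm_smul_smul]
    ring
  have hqmem : q ∈ vanishingIdeal H := by
    intro g hg
    have h1 : (g : Matrix (Fin n) (Fin n) K) * ((g⁻¹ : GL (Fin n) K) : Matrix _ _ K) = 1 := by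
      rw [← Units.val_mul, mul_inv_cancel, Units.val_one]
    have h2 : ∀ z : Matrix (Fin n) (Fin n) K, z.map (algebraMap K K) = z := fun z => by ext; simp
    rw [hq h1, extendForm_self, h2, h2, hβ g hg, Algebra.algebraMap_self, RingHom.id_apply,
      sub_self, mul_zero]
  have hAA : dualMatrix 1 X * dualMatrix 1 (-X) = 1 := by
    rw [dualMatrix_mul, one_mul, one_mul, mul_one, neg_add_cancel, ← map_eq_dualMatrix]
    exact Matrix.map_one _ (map_zero _) (map_one _)
  have hdet : IsUnit (dualMatrix 1 X).det := by
    have := congrArg Matrix.det hAA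
    rw [Matrix.det_mul, Matrix.det_one] at this
    exact IsUnit.of_mul_eq_one _ this
  have h0 := hX q hqmem
  rw [hq hAA] at h0
  have h1 := congrArg snd (((hdet.pow 2).mul_right_eq_zero).1 h0)
  have hconj : ∀ z : Matrix (Fin n) (Fin n) K,
      dualMatrix 1 X * z.map (algebraMap K (DualNumber K)) * dualMatrix 1 (-X) =
        dualMatrix z (X * z - z * X) := by
    intro z
    rw [map_eq_dualMatrix, dualMatrix_mul, dualMatrix_mul]
    simp only [one_mul, mul_one, mul_zero, zero_add, mul_neg]
    rw [neg_add_eq_sub]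
  rw [hconj, hconj, snd_sub, snd_extendForm_dualMatrix, algebraMap_eq_inl, snd_inl, sub_zero,
    snd_zero] at h1
  exact h1

/-- The form is extended to all matrices along a linear projection `π` onto the Lie algebra; only
its values on the `G`-orbits inside the Lie algebra matter. -/
lemma Datum.form_lie (D : Datum K n) (z x y : lieAlg D.G) :
    D.form x ⁅z, y⁆ + D.form ⁅z, x⁆ y = 0 := by
  obtain ⟨π, hπ⟩ := (lieAlg D.G).toSubmodule.subtype.exists_leftInverse_of_injective
    (Submodule.ker_subtype _)
  have hπ' : ∀ y : lieAlg D.G, π y.1 = y := fun y => LinearMap.congr_fun hπ y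
  have h1 := bilin_lie_eq_zero (D.form.compl₁₂ π π) z.2 x.1 y.1 fun g hg => by
    have h2 := D.form_invariant ⟨g, hg⟩ x y
    rw [← hπ' (Ad D.G ⟨g, hg⟩ x), ← hπ' (Ad D.G ⟨g, hg⟩ y)] at h2
    rw [LinearMap.compl₁₂_apply, LinearMap.compl₁₂_apply, hπ', hπ']
    exact h2
  rw [LinearMap.compl₁₂_apply, LinearMap.compl₁₂_apply, hπ', hπ'] at h1
  rw [← hπ' ⁅z, x⁆, ← hπ' ⁅z, y⁆]
  exact h1

end InvariantForm

/-! ### The grading of `𝔤` and noetherianity of the W-algebra -/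

namespace Datum

variable {K : Type*} [Field K] {n : ℕ} (D : Datum K n)

lemma mem_grading_iff {L : Type*} [LieRing L] [LieAlgebra K L] {h x : L} {i : ℤ} :
    x ∈ grading (K := K) h i ↔ ⁅h, x⁆ = (i : K) • x := Iff.rfl

lemma lie_mem_grading {L : Type*} [LieRing L] [LieAlgebra K L] {h x y : L} {i j : ℤ}
    (hx : x ∈ grading (K := K) h i) (hy : y ∈ grading (K := K) h j) :
    ⁅x, y⁆ ∈ grading (K := K) h (i + j) := by
  rw [mem_grading_iff] at *
  rw [leibniz_lie, hx, hy, smul_lie, lie_smul, ← add_smul, Int.cast_add]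

lemma e_mem_grading : D.e ∈ grading (K := K) D.h 2 := by
  rw [mem_grading_iff, D.triple.lie_h_e_smul K]
  norm_num

section CharZero

variable [CharZero K]

/-- Invariance under `h` gives `(i + j) (x, y) = 0`. -/
lemma form_eq_zero {i j : ℤ} (hij : i + j ≠ 0) {x y : lieAlg D.G}
    (hx : x ∈ grading (K := K) D.h i) (hy : y ∈ grading (K := K) D.h j) : D.form x y = 0 := by
  have h1 := D.form_lie D.h x y
  rw [mem_grading_iff.1 hx, mem_grading_iff.1 hy, map_smul, map_smul, LinearMap.smul_apply,
    ← add_smul, smul_eq_mul, mul_eq_zero] at h1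
  refine h1.resolve_left ?_
  rw [add_comm]
  exact_mod_cast hij

lemma χ_eq_zero {i : ℤ} (hi : i ≠ -2) {y : lieAlg D.G} (hy : y ∈ grading (K := K) D.h i) :
    D.χ y = 0 :=
  D.form_eq_zero (by omega) D.e_mem_grading hy

variable [IsAlgClosed K]

lemma iSup_grading : ⨆ i : ℤ, grading (K := K) D.h i = ⊤ := by
  let ad := LieModule.toEnd K (lieAlg D.G) (lieAlg D.G)
  have h1 : ad D.h * ad D.e = ad D.e * ad D.h + (2 : K) • ad D.e := by
    have h := LieHom.map_lie ad D.h D.e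
    rw [D.triple.lie_h_e_smul K, map_smul, Ring.lie_def] at h
    rw [h]; abel
  have h2 : ad D.h * ad D.f = ad D.f * ad D.h - (2 : K) • ad D.f := by
    have h := LieHom.map_lie ad D.h D.f
    rw [D.triple.lie_lie_smul_f K, map_neg, map_smul, Ring.lie_def] at h
    rw [sub_eq_add_neg, h]; abel
  have h3 : ad D.e * ad D.f = ad D.f * ad D.e + ad D.h := by
    have h := LieHom.map_lie ad D.e D.f
    rw [D.triple.lie_e_f, Ring.lie_def] at h
    rw [h]; abel
  rw [← iSup_eigenspace_int_eq_top h1 h2 h3]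
  congr 1
  ext i x
  rw [Module.End.mem_eigenspace_iff]
  rfl

/-- The pairing `(z, w) ↦ χ [z, w]` between `𝔤(-d)` and `𝔤(d - 2)` is nondegenerate on the left for
`d > 0`. -/
lemma eq_zero_of_χ_lie_eq_zero {d : ℤ} (hd : 1 ≤ d) {z : lieAlg D.G}
    (hz : z ∈ grading (K := K) D.h (-d))
    (h : ∀ w ∈ grading (K := K) D.h (d - 2), D.χ ⁅z, w⁆ = 0) : z = 0 := by
  -- By invariance `χ [z, w]` is the form on `[e, z]` and `w`. The remaining degrees are orthogonal
  -- to `[e, z]`, so nondegeneracy on `𝔤` gives `[e, z] = 0`. A nonzero such `z` would be a highest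
  -- weight vector of negative weight.
  have hez : ⁅D.e, z⁆ = 0 := by
    refine D.form_nondegenerate D.G le_rfl D.reductive _ (⁅D.e, z⁆).2 fun w _ => ?_
    have hw : w ∈ ⨆ i : ℤ, grading (K := K) D.h i := by rw [D.iSup_grading]; trivial
    induction hw using Submodule.iSup_induction' with
    | zero => rw [map_zero]
    | add x y _ _ hx hy => rw [map_add, hx x.2, hy y.2, add_zero]
    | mem j w hw =>
      by_cases hj : j = d - 2
      · subst hj
        have h1 := D.form_lie z D.e w
        rw [show D.form D.e ⁅z, w⁆ = 0 from h w hw, zero_add, ← lie_skew, map_neg,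
          LinearMap.neg_apply, neg_eq_zero] at h1
        exact h1
      · exact D.form_eq_zero (by omega) (lie_mem_grading D.e_mem_grading hz) hw
  by_contra hne
  have hP : D.triple.HasPrimitiveVectorWith z ((-d : ℤ) : K) := ⟨hne, hz, hez⟩
  obtain ⟨k, hk⟩ := hP.exists_nat
  have : (-d : ℤ) = k := by exact_mod_cast hk
  omega

/-- The component of degree `-d` of `𝔪`. -/
def mPart (d : ℤ) : Submodule K (lieAlg D.G) := if d = 1 then D.l else grading D.h (-d)

lemma mPart_one : D.mPart 1 = D.l := if_pos rfl

lemma mPart_of_ne {d : ℤ} (hd : d ≠ 1) : D.mPart d = grading D.h (-d) := if_neg hd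

lemma mPart_le_grading (d : ℤ) : D.mPart d ≤ grading D.h (-d) := by
  by_cases hd : d = 1
  · subst hd
    rw [mPart_one]
    exact fun x hx => ((D.l_lagrangian x).1 hx).1
  · rw [D.mPart_of_ne hd]

lemma grading_le_m {i : ℤ} (hi : i ≤ -2) : grading D.h i ≤ D.m := fun _ hx =>
  Submodule.mem_sup_right (Submodule.mem_iSup_of_mem i (Submodule.mem_iSup_of_mem hi hx))

lemma mPart_le_m {d : ℤ} (hd : 1 ≤ d) : D.mPart d ≤ D.m := by
  by_cases hd1 : d = 1
  · subst hd1
    rw [mPart_one]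
    exact le_sup_left
  · rw [D.mPart_of_ne hd1]
    exact D.grading_le_m (by omega)

lemma exists_grading_eq_bot : ∃ N : ℕ, ∀ i : ℤ, i ≤ -N → grading (K := K) D.h i = ⊥ := by
  have hfin := (LieModule.toEnd K (lieAlg D.G) (lieAlg D.G) D.h).finite_hasEigenvalue
  have hfin' : {i : ℤ | grading (K := K) D.h i ≠ ⊥}.Finite := by
    refine (hfin.preimage (f := fun i : ℤ => (i : K)) Int.cast_injective.injOn).subset ?_
    intro i hi hbot
    refine hi (le_bot_iff.1 fun x hx => ?_)
    have hx' : x ∈ (LieModule.toEnd K (lieAlg D.G) (lieAlg D.G) D.h).eigenspace (i : K) :=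
      Module.End.mem_eigenspace_iff.2 hx
    have hbot' : (LieModule.toEnd K (lieAlg D.G) (lieAlg D.G) D.h).eigenspace (i : K) = ⊥ := hbot
    rwa [hbot'] at hx'
  obtain ⟨b, hb⟩ := hfin'.bddBelow
  refine ⟨b.natAbs + 1, fun i hi => ?_⟩
  by_contra hne
  have hbi : b ≤ i := hb hne
  omega

/-- A pairing that is injective on the left, with finite dimensional spaces, realizes every
functional on `mPart d`; the `u j` realize the coordinates. -/
lemma exists_dual (d : ℤ) (hd : 1 ≤ d) {r : ℕ} (b : Module.Basis (Fin r) K (D.mPart d)) :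
    ∃ u : Fin r → lieAlg D.G, (∀ i, u i ∈ grading (K := K) D.h (d - 2)) ∧
      ∀ i j, D.χ ⁅(b i : lieAlg D.G), u j⁆ = if i = j then 1 else 0 := by
  let B : D.mPart d →ₗ[K] grading (K := K) D.h (d - 2) →ₗ[K] K :=
    ((LieModule.toEnd K (lieAlg D.G) (lieAlg D.G) : lieAlg D.G →ₗ[K] _).compr₂ D.χ).domRestrict₁₂ _ _
  have hB : Function.Injective B := by
    rw [← LinearMap.ker_eq_bot, LinearMap.ker_eq_bot']
    intro z hz
    refine Subtype.ext (D.eq_zero_of_χ_lie_eq_zero hd (D.mPart_le_grading d z.2) fun w hw => ?_)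
    exact LinearMap.congr_fun hz ⟨w, hw⟩
  have hs := LinearMap.flip_surjective_iff₁.2 hB
  choose u hu using fun j => hs (b.coord j)
  refine ⟨fun j => u j, fun j => (u j).2, fun i j => ?_⟩
  have h1 := LinearMap.congr_fun (hu j) (b i)
  rw [Module.Basis.coord_apply, Module.Basis.repr_self, Finsupp.single_apply] at h1
  exact h1

/-- The W-algebra is left noetherian. -/
theorem isNoetherianRing_W : IsNoetherianRing D.W := by
  obtain ⟨N, hN⟩ := D.exists_grading_eq_bot
  -- The index `k` stands for the component of degree `-(k + 1)`, so that the degrees start at `-1`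
  -- with `l`.
  let J := Σ k : Fin N, Fin (Module.finrank K (D.mPart (k + 1)))
  let b := fun k : Fin N => Module.finBasis K (D.mPart (k + 1))
  choose u' hu' hdual using fun k : Fin N => D.exists_dual (k + 1) (by omega) (b k)
  let x : J → lieAlg D.G := fun p => b p.1 p.2
  let u : J → lieAlg D.G := fun p => u' p.1 p.2
  let d : J → ℤ := fun p => p.1 + 1
  have hx : ∀ p, x p ∈ D.mPart (d p) := fun p => (b p.1 p.2).2
  have hspan : ∀ c : ℤ, 1 ≤ c → D.mPart c ≤ Submodule.span K (x '' {j | -d j = -c}) := by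
    intro c hc z hz
    by_cases hcN : c ≤ N
    · obtain ⟨k, rfl⟩ : ∃ k : Fin N, c = k + 1 := ⟨⟨(c - 1).toNat, by omega⟩, by simp; omega⟩
      have h1 : (⟨z, hz⟩ : D.mPart (k + 1)) ∈ Submodule.span K (Set.range (b k)) := by
        rw [(b k).span_eq]; trivial
      have h2 := Submodule.mem_map_of_mem (f := (D.mPart (k + 1)).subtype) h1
      rw [Submodule.map_span] at h2
      refine Submodule.span_mono ?_ h2
      rintro _ ⟨_, ⟨i, rfl⟩, rfl⟩
      exact ⟨⟨k, i⟩, rfl, rfl⟩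
    · have h1 := D.mPart_le_grading c hz
      rw [hN (-c) (by omega), Submodule.mem_bot] at h1
      rw [h1]; exact zero_mem _
  have H : IsWhittakerSystem (grading D.h) D.m D.χ x u d :=
    { lie_mem := fun hy hz => lie_mem_grading hy hz
      iSup_eq := D.iSup_grading
      le := fun i hi => D.grading_le_m hi
      χ_eq_zero := fun hi hy => D.χ_eq_zero hi hy
      d_pos := fun p => by simp only [d]; omega
      x_mem := fun p => D.mPart_le_m (by simp only [d]; omega) (hx p)
      x_mem_grading := fun p => D.mPart_le_grading _ (hx p)
      le_span := by
        have hle : ∀ c : ℤ, 1 ≤ c → D.mPart c ≤ Submodule.span K (Set.range x) := fun c hc =>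
          (hspan c hc).trans (Submodule.span_mono (Set.image_subset_range _ _))
        refine sup_le ?_ (iSup₂_le fun i hi => ?_)
        · rw [← mPart_one]; exact hle 1 le_rfl
        · have h1 := hle (-i) (by omega)
          rwa [D.mPart_of_ne (by omega), neg_neg] at h1
      mem_span := fun {i y} hi hy => by
        have h1 := hspan (-i) (by omega)
        rw [D.mPart_of_ne (by omega), neg_neg] at h1
        exact h1 hy
      χ_lie := fun p q => by
        -- The bracket lies in degree `-2`, the only one seen by `χ`, exactly when both elements lie
        -- in `l`; there isotropy of `l` gives zero.
        by_cases h : d p = 1 ∧ d q = 1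
        · have hp := hx p
          have hq := hx q
          rw [h.1, mPart_one] at hp
          rw [h.2, mPart_one] at hq
          exact ((D.l_lagrangian _).1 hp).2 _ hq
        · refine D.χ_eq_zero ?_ (lie_mem_grading (D.mPart_le_grading _ (hx p))
            (D.mPart_le_grading _ (hx q)))
          simp only [d] at h ⊢
          omega
      u_mem := fun p => hu' p.1 p.2
      pairing := fun p => by
        have := hdual p.1 p.2 p.2
        rwa [if_pos rfl] at this
      pairing_ne := fun p q hpq => by
        by_cases h : p.1 = q.1
        · obtain ⟨k, i⟩ := p
          obtain ⟨k', j⟩ := q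
          obtain rfl : k = k' := h
          have hij : i ≠ j := fun hij => hpq (by rw [hij])
          have := hdual k i j
          rwa [if_neg hij] at this
        · refine D.χ_eq_zero ?_ (lie_mem_grading (D.mPart_le_grading _ (hx p)) (hu' q.1 q.2))
          have h' : (p.1 : ℕ) ≠ q.1 := fun h' => h (Fin.ext h')
          simp only [d]
          omega }
  exact H.isNoetherianRing

end CharZero

end Datum

/-! ### Joint eigenvectors of commuting families -/

section Weights

variable {K t E : Type*} [Field K] [AddCommGroup t] [Module K t] [AddCommGroup E] [Module K E]

/-- The simultaneous eigenspace of a linear family of endomorphisms. -/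
def jointEigenspace (ρ : t →ₗ[K] Module.End K E) (μ : Module.Dual K t) : Submodule K E where
  carrier := {e | ∀ ξ, ρ ξ e = μ ξ • e}
  zero_mem' := fun ξ => by simp
  add_mem' := fun {a b} ha hb ξ => by rw [map_add, ha ξ, hb ξ, smul_add]
  smul_mem' := fun c a ha ξ => by rw [map_smul, ha ξ, smul_comm]

lemma mem_of_sum_mem_of_stable {ρ : t →ₗ[K] Module.End K E} {S : Submodule K E}
    (hS : ∀ ξ, ∀ e ∈ S, ρ ξ e ∈ S) (F : Finset (Module.Dual K t)) (c : Module.Dual K t → E)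
    (hc : ∀ μ ∈ F, c μ ∈ jointEigenspace ρ μ) (hsum : ∑ μ ∈ F, c μ ∈ S) : ∀ μ ∈ F, c μ ∈ S := by
  classical
  induction F using Finset.induction_on generalizing c with
  | empty => simp
  | insert ν F hν ih =>
    have hF : ∀ μ ∈ F, c μ ∈ S := by
      intro μ hμ
      have hne : μ ≠ ν := by rintro rfl; exact hν hμ
      obtain ⟨ξ, hξ⟩ : ∃ ξ, μ ξ ≠ ν ξ := by
        by_contra! h; exact hne (LinearMap.ext h)
      -- Applying `ρ ξ - ν ξ` removes the summand of weight `ν` and multiplies the one of weight `μ`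
      -- by a nonzero scalar.
      have h1 := ih (fun l => (l ξ - ν ξ) • c l)
        (fun l hl => Submodule.smul_mem _ _ (hc l (Finset.mem_insert_of_mem hl))) (by
          have h2 := sub_mem (hS ξ _ hsum) (S.smul_mem (ν ξ) hsum)
          rw [Finset.sum_insert hν, map_add, hc ν (Finset.mem_insert_self _ _) ξ, smul_add,
            add_sub_add_left_eq_sub, map_sum, Finset.smul_sum, ← Finset.sum_sub_distrib] at h2
          convert h2 using 2 with l hl
          rw [hc l (Finset.mem_insert_of_mem hl) ξ, sub_smul]) μ hμ
      exact (S.smul_mem_iff (sub_ne_zero.2 hξ)).1 h1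
    intro μ hμ
    obtain rfl | hμ := Finset.mem_insert.1 hμ
    · rw [Finset.sum_insert hν] at hsum
      simpa using sub_mem hsum (sum_mem hF)
    · exact hF μ hμ

/-- A stable subspace of a diagonalizable representation is spanned by joint eigenvectors. -/
lemma mem_iSup_inf_of_stable {ρ : t →ₗ[K] Module.End K E} {S : Submodule K E}
    (hS : ∀ ξ, ∀ e ∈ S, ρ ξ e ∈ S) {e : E} (he : e ∈ S) (he' : e ∈ ⨆ μ, jointEigenspace ρ μ) :
    e ∈ ⨆ μ, jointEigenspace ρ μ ⊓ S := by
  obtain ⟨c, hc, rfl⟩ := (Submodule.mem_iSup_iff_exists_finsupp _ _).1 he'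
  have h1 := mem_of_sum_mem_of_stable hS c.support c (fun μ _ => hc μ) he
  exact sum_mem fun μ hμ => Submodule.mem_iSup_of_mem μ ⟨hc μ, h1 μ hμ⟩

/-- A commuting family of endomorphisms has a joint eigenvector. -/
lemma exists_joint_eigenvector [IsAlgClosed K] [FiniteDimensional K E] [Nontrivial E]
    (ρ : t →ₗ[K] Module.End K E) (hρ : ∀ ξ η, Commute (ρ ξ) (ρ η)) :
    ∃ μ, ∃ v ∈ jointEigenspace ρ μ, v ≠ 0 := by
  -- On a minimal nonzero stable subspace every operator is scalar, because its eigenspaces are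
  -- stable under the commuting family.
  obtain ⟨Q, ⟨hQ0, hQ⟩, hmin⟩ := WellFounded.has_min
    (wellFounded_lt (α := Submodule K E)) {Q | Q ≠ ⊥ ∧ ∀ ξ, ∀ e ∈ Q, ρ ξ e ∈ Q}
    ⟨⊤, top_ne_bot, fun _ _ _ => trivial⟩
  have hscalar : ∀ ξ, ∃ c : K, ∀ e ∈ Q, ρ ξ e = c • e := by
    intro ξ
    have : Nontrivial Q := Submodule.nontrivial_iff_ne_bot.2 hQ0
    obtain ⟨c, hc⟩ := Module.End.exists_eigenvalue ((ρ ξ).restrict (hQ ξ))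
    obtain ⟨w, hw, hw0⟩ := hc.exists_hasEigenvector
    refine ⟨c, ?_⟩
    have hle : Q ⊓ (ρ ξ).eigenspace c = Q := by
      by_contra hne
      refine hmin (Q ⊓ (ρ ξ).eigenspace c) ⟨?_, ?_⟩ (lt_of_le_of_ne inf_le_left hne)
      · intro hbot
        have h1 : (w : E) ∈ Q ⊓ (ρ ξ).eigenspace c :=
          ⟨w.2, Module.End.mem_eigenspace_iff.2
            (congrArg Subtype.val (Module.End.mem_eigenspace_iff.1 hw))⟩
        rw [hbot, Submodule.mem_bot] at h1
        exact hw0 (Subtype.ext h1)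
      · rintro η e ⟨he1, he2⟩
        exact ⟨hQ η e he1, Module.End.mapsTo_genEigenspace_of_comm (hρ ξ η) c 1 he2⟩
    intro e he
    rw [← hle] at he
    exact Module.End.mem_eigenspace_iff.1 he.2
  choose c hc using hscalar
  obtain ⟨v, hv, hv0⟩ := Q.exists_mem_ne_zero_of_ne_bot hQ0
  refine ⟨{ toFun := c, map_add' := fun ξ η => ?_, map_smul' := fun a ξ => ?_ }, v,
    fun ξ => hc ξ v hv, hv0⟩
  · refine smul_left_injective K hv0 ?_
    change c (ξ + η) • v = (c ξ + c η) • v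
    rw [add_smul, ← hc _ v hv, ← hc _ v hv, ← hc _ v hv, map_add, LinearMap.add_apply]
  · refine smul_left_injective K hv0 ?_
    change c (a • ξ) • v = (a • c ξ) • v
    rw [smul_assoc, ← hc _ v hv, ← hc _ v hv, map_smul, LinearMap.smul_apply]

end Weights

/-! ### Diagonalizability of the adjoint action of the torus -/

section Torus

variable {K : Type*} [Field K] {n : ℕ}

/-- The Lie algebra of a diagonalizable group is diagonalizable. -/
lemma isDiag_of_isTangent {H : Subgroup (GL (Fin n) K)} {P : GL (Fin n) K}
    (hP : ∀ g ∈ H, ((P * g * P⁻¹ : GL (Fin n) K) : Matrix (Fin n) (Fin n) K).IsDiag)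
    {X : Matrix (Fin n) (Fin n) K} (hX : IsTangent H X) :
    ((P : Matrix (Fin n) (Fin n) K) * X * (P⁻¹ : GL (Fin n) K)).IsDiag := by
  intro i j hij
  -- The off-diagonal entries of `P g P⁻¹` are polynomials in `g` vanishing on `H`, hence their
  -- derivatives along `X` vanish.
  have h1 := hX (substMatrix (P : Matrix _ _ K) ((P⁻¹ : GL (Fin n) K) : Matrix _ _ K)
    (MvPolynomial.X (i, j))) fun g hg => by
      rw [evalAt_substMatrix_self]
      simpa [evalAt] using hP g hg hij
  rw [evalAt_substMatrix, map_eq_dualMatrix, map_eq_dualMatrix, dualMatrix_mul, dualMatrix_mul] at h1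
  have h2 := congrArg snd h1
  simpa [evalAt, dualMatrix] using h2

namespace Datum

variable (D : Datum K n)

lemma commute_lieAlg_T (ξ η : lieAlg D.T) : ξ.1 * η.1 = η.1 * ξ.1 := by
  obtain ⟨P, hP⟩ := D.maximalTorus.torus.diagonalizable
  have h1 := (isDiag_of_isTangent hP ξ.2).diagonal_diag
  have h2 := (isDiag_of_isTangent hP η.2).diagonal_diag
  have h3 : ((P⁻¹ : GL (Fin n) K) : Matrix (Fin n) (Fin n) K) * P = 1 := by
    rw [← Units.val_mul, inv_mul_cancel, Units.val_one]
  have h4 : ∀ X Y : Matrix (Fin n) (Fin n) K, X * Y = ((P⁻¹ : GL (Fin n) K) : Matrix _ _ K) *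
      (((P : Matrix (Fin n) (Fin n) K) * X * ((P⁻¹ : GL (Fin n) K) : Matrix _ _ K)) *
        ((P : Matrix (Fin n) (Fin n) K) * Y * ((P⁻¹ : GL (Fin n) K) : Matrix _ _ K))) *
          (P : Matrix (Fin n) (Fin n) K) := by
    intro X Y
    generalize ((P⁻¹ : GL (Fin n) K) : Matrix (Fin n) (Fin n) K) = Q at h3
    generalize (P : Matrix (Fin n) (Fin n) K) = R at h3
    calc X * Y = (Q * R) * X * (Q * R) * Y * (Q * R) := by rw [h3]; simp
      _ = _ := by simp only [mul_assoc]
  rw [h4 ξ.1, h4 η.1, ← h1, ← h2, Matrix.diagonal_mul_diagonal, Matrix.diagonal_mul_diagonal]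
  simp only [mul_comm]

/-- The adjoint action of `𝔱` on matrices. -/
def adMatrix : lieAlg D.T →ₗ[K] Module.End K (Matrix (Fin n) (Fin n) K) :=
  (LieModule.toEnd K (Matrix (Fin n) (Fin n) K) (Matrix (Fin n) (Fin n) K) :
    Matrix (Fin n) (Fin n) K →ₗ[K] _) ∘ₗ (lieAlg D.T).toSubmodule.subtype

lemma iSup_jointEigenspace_adMatrix : ⨆ μ, jointEigenspace D.adMatrix μ = ⊤ := by
  obtain ⟨P, hP⟩ := D.maximalTorus.torus.diagonalizable
  let Pm : Matrix (Fin n) (Fin n) K := P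
  let Pi : Matrix (Fin n) (Fin n) K := (P⁻¹ : GL (Fin n) K)
  have hPi : Pi * Pm = 1 := by rw [← Units.val_mul, inv_mul_cancel, Units.val_one]
  have hPi' : Pm * Pi = 1 := by rw [← Units.val_mul, mul_inv_cancel, Units.val_one]
  let μ : Fin n → Module.Dual K (lieAlg D.T) := fun i =>
    { toFun := fun ξ => (Pm * ξ.1 * Pi) i i
      map_add' := fun ξ η => by simp [mul_add, add_mul]
      map_smul' := fun c ξ => by simp }
  have hdiag : ∀ ξ : lieAlg D.T, Pm * ξ.1 * Pi = Matrix.diagonal fun i => μ i ξ := fun ξ =>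
    (isDiag_of_isTangent hP ξ.2).diagonal_diag.symm
  rw [eq_top_iff]
  intro M _
  have hM : M = Pi * (Pm * M * Pi) * Pm := by
    simp only [← mul_assoc, hPi, one_mul]
    rw [mul_assoc, hPi, mul_one]
  rw [hM, Matrix.matrix_eq_sum_single (Pm * M * Pi), Finset.mul_sum, Finset.sum_mul]
  refine sum_mem fun i _ => ?_
  rw [Finset.mul_sum, Finset.sum_mul]
  -- The conjugated matrix units are the root vectors, of weight `μ i - μ j`.
  refine sum_mem fun j _ => Submodule.mem_iSup_of_mem (μ i - μ j) ?_
  intro ξ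
  generalize (Pm * M * Pi) i j = c
  change ξ.1 * (Pi * Matrix.single i j c * Pm) - (Pi * Matrix.single i j c * Pm) * ξ.1 = _
  have h1 : ξ.1 * Pi = Pi * (Pm * ξ.1 * Pi) := by simp only [← mul_assoc, hPi, one_mul]
  have h2 : Pm * ξ.1 = (Pm * ξ.1 * Pi) * Pm := by rw [mul_assoc (Pm * ξ.1), hPi, mul_one]
  have h3 : Matrix.diagonal (fun i => μ i ξ) * Matrix.single i j c = μ i ξ • Matrix.single i j c := by
    ext a b
    rw [Matrix.diagonal_mul, Matrix.smul_apply, smul_eq_mul, Matrix.single_apply]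
    split_ifs with h
    · rw [h.1]
    · simp
  have h4 : Matrix.single i j c * Matrix.diagonal (fun i => μ i ξ) = μ j ξ • Matrix.single i j c := by
    ext a b
    rw [Matrix.mul_diagonal, Matrix.smul_apply, smul_eq_mul, Matrix.single_apply]
    split_ifs with h
    · rw [h.2, mul_comm]
    · simp
  rw [mul_assoc (Pi * _), h2, hdiag, ← mul_assoc, ← mul_assoc, h1, hdiag, mul_assoc Pi, h3,
    ← mul_assoc, mul_assoc Pi (Matrix.single i j c), h4, LinearMap.sub_apply, sub_smul]
  simp only [Matrix.mul_smul, Matrix.smul_mul]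

/-- The adjoint action of `𝔱` on `𝔤`. -/
def adLie : lieAlg D.T →ₗ[K] Module.End K (lieAlg D.G) :=
  (LieModule.toEnd K (lieAlg D.G) (lieAlg D.G) : lieAlg D.G →ₗ[K] _) ∘ₗ D.torusIncl

lemma iSup_jointEigenspace_adLie : ⨆ μ, jointEigenspace D.adLie μ = ⊤ := by
  rw [eq_top_iff]
  intro x _
  have h1 := mem_iSup_inf_of_stable (ρ := D.adMatrix) (S := (lieAlg D.G).toSubmodule)
    (fun ξ e he => (lieAlg D.G).lie_mem (D.torusIncl ξ).2 he) x.2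
    (by rw [iSup_jointEigenspace_adMatrix]; trivial)
  have h2 : ⨆ μ, jointEigenspace D.adMatrix μ ⊓ (lieAlg D.G).toSubmodule ≤
      (⨆ μ, jointEigenspace D.adLie μ).map (lieAlg D.G).toSubmodule.subtype := by
    refine iSup_le fun μ e he => ⟨⟨e, he.2⟩, ?_, rfl⟩
    exact Submodule.mem_iSup_of_mem μ fun ξ => Subtype.ext (he.1 ξ)
  obtain ⟨y, hy, hyx⟩ := h2 h1
  rwa [← Subtype.ext hyx]

/-- The adjoint action of `𝔱` on `U(𝔤)`. -/
def adEnveloping : lieAlg D.T →ₗ[K] Module.End K (UniversalEnvelopingAlgebra K (lieAlg D.G)) :=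
  (LieModule.toEnd K (UniversalEnvelopingAlgebra K (lieAlg D.G))
    (UniversalEnvelopingAlgebra K (lieAlg D.G)) : _ →ₗ[K] _) ∘ₗ
    (ι K : lieAlg D.G →ₗ⁅K⁆ UniversalEnvelopingAlgebra K (lieAlg D.G)).toLinearMap ∘ₗ D.torusIncl

lemma adEnveloping_apply (ξ : lieAlg D.T) (a : UniversalEnvelopingAlgebra K (lieAlg D.G)) :
    D.adEnveloping ξ a = ι K (D.torusIncl ξ) * a - a * ι K (D.torusIncl ξ) := rfl

lemma mul_mem_iSup_jointEigenspace_adEnveloping {a b : UniversalEnvelopingAlgebra K (lieAlg D.G)}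
    (ha : a ∈ ⨆ μ, jointEigenspace D.adEnveloping μ)
    (hb : b ∈ ⨆ μ, jointEigenspace D.adEnveloping μ) :
    a * b ∈ ⨆ μ, jointEigenspace D.adEnveloping μ := by
  induction ha using Submodule.iSup_induction' with
  | zero => rw [zero_mul]; exact zero_mem _
  | add x y _ _ hx hy => rw [add_mul]; exact add_mem hx hy
  | mem μ a ha =>
    induction hb using Submodule.iSup_induction' with
    | zero => rw [mul_zero]; exact zero_mem _
    | add x y _ _ hx hy => rw [mul_add]; exact add_mem hx hy
    | mem ν b hb =>
      refine Submodule.mem_iSup_of_mem (μ + ν) fun ξ => ?_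
      have h1 := ha ξ
      have h2 := hb ξ
      rw [adEnveloping_apply] at h1 h2 ⊢
      rw [LinearMap.add_apply, add_smul, ← smul_mul_assoc, ← mul_smul_comm, ← h1, ← h2]
      noncomm_ring

/-- The adjoint action is by derivations, so products of weight vectors are weight vectors and it
suffices to treat the generators `𝔤`. -/
lemma iSup_jointEigenspace_adEnveloping : ⨆ μ, jointEigenspace D.adEnveloping μ = ⊤ := by
  rw [eq_top_iff]
  intro a _
  have ha : a ∈ Algebra.adjoin K (Set.range (ι K : lieAlg D.G → _)) := by
    rw [adjoin_range_ι]; trivial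
  induction ha using Algebra.adjoin_induction with
  | mem a ha =>
    obtain ⟨x, rfl⟩ := ha
    have hx : x ∈ ⨆ μ, jointEigenspace D.adLie μ := by
      rw [iSup_jointEigenspace_adLie]; trivial
    induction hx using Submodule.iSup_induction' with
    | zero => rw [map_zero]; exact zero_mem _
    | add x y _ _ hx hy => rw [map_add]; exact add_mem (hx trivial) (hy trivial)
    | mem μ x hx =>
      refine Submodule.mem_iSup_of_mem μ fun ξ => ?_
      rw [adEnveloping_apply, ι_mul_sub, ← map_smul]
      exact congrArg _ (hx ξ)
  | algebraMap c =>
    refine Submodule.mem_iSup_of_mem 0 fun ξ => ?_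
    rw [adEnveloping_apply, Algebra.commutes, sub_self, LinearMap.zero_apply, zero_smul]
  | add a b _ _ ha hb => exact add_mem (ha trivial) (hb trivial)
  | mul a b _ _ ha hb =>
    exact D.mul_mem_iSup_jointEigenspace_adEnveloping (ha trivial) (hb trivial)

/-- The adjoint action of `𝔱` on the W-algebra. -/
def adW : lieAlg D.T →ₗ[K] Module.End K D.W :=
  (LinearMap.mul K D.W - (LinearMap.mul K D.W).flip) ∘ₗ D.torusToW

/-- The adjoint action of `𝔱` on the W-algebra is diagonalizable. -/
theorem iSup_jointEigenspace_adW : ⨆ μ, jointEigenspace D.adW μ = ⊤ := by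
  rw [eq_top_iff]
  intro w _
  obtain ⟨a, rfl⟩ := Reduction.mk_surjective w
  have hmem : ∀ ξ, ι K (D.torusIncl ξ) ∈ adInvariants D.m D.χ := fun ξ =>
    ι_mem_adInvariants (D.torusIncl_lie_mem ξ) fun η _ => D.χ_torusIncl_lie ξ η
  -- The subalgebra `adInvariants` contains the image of `𝔱`, so it is `ad 𝔱`-stable and inherits
  -- weight decompositions; these then pass to the quotient.
  have h1 := mem_iSup_inf_of_stable (ρ := D.adEnveloping)
    (S := Subalgebra.toSubmodule (adInvariants D.m D.χ))
    (fun ξ e he => (adInvariants D.m D.χ).sub_mem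
      ((adInvariants D.m D.χ).mul_mem (hmem ξ) he) ((adInvariants D.m D.χ).mul_mem he (hmem ξ))) a.2
    (by rw [iSup_jointEigenspace_adEnveloping]; trivial)
  have h2 : ⨆ μ, jointEigenspace D.adEnveloping μ ⊓ Subalgebra.toSubmodule (adInvariants D.m D.χ) ≤
      ((⨆ μ, jointEigenspace D.adW μ).comap (Reduction.mk D.m D.χ).toLinearMap).map
        (Subalgebra.toSubmodule (adInvariants D.m D.χ)).subtype := by
    refine iSup_le fun μ e he => ⟨⟨e, he.2⟩, ?_, rfl⟩
    refine Submodule.mem_iSup_of_mem μ fun ξ => ?_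
    change Reduction.mk D.m D.χ ⟨_, hmem ξ⟩ * Reduction.mk D.m D.χ ⟨e, he.2⟩ -
      Reduction.mk D.m D.χ ⟨e, he.2⟩ * Reduction.mk D.m D.χ ⟨_, hmem ξ⟩ =
        μ ξ • Reduction.mk D.m D.χ ⟨e, he.2⟩
    rw [← map_mul, ← map_mul, ← map_sub, ← map_smul]
    exact congrArg _ (Subtype.ext (he.1 ξ))
  obtain ⟨b, hb, hba⟩ := h2 h1
  rwa [← Subtype.ext hba]

lemma commute_torusToW (ξ η : lieAlg D.T) :
    D.torusToW ξ * D.torusToW η = D.torusToW η * D.torusToW ξ := by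
  have hmem : ∀ ξ, ι K (D.torusIncl ξ) ∈ adInvariants D.m D.χ := fun ξ =>
    ι_mem_adInvariants (D.torusIncl_lie_mem ξ) fun η _ => D.χ_torusIncl_lie ξ η
  change Reduction.mk D.m D.χ ⟨_, hmem ξ⟩ * Reduction.mk D.m D.χ ⟨_, hmem η⟩ =
    Reduction.mk D.m D.χ ⟨_, hmem η⟩ * Reduction.mk D.m D.χ ⟨_, hmem ξ⟩
  rw [← map_mul, ← map_mul]
  refine congrArg _ (Subtype.ext ?_)
  change ι K (D.torusIncl ξ) * ι K (D.torusIncl η) = ι K (D.torusIncl η) * ι K (D.torusIncl ξ)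
  have h1 : ⁅D.torusIncl ξ, D.torusIncl η⁆ = 0 := by
    refine Subtype.ext ?_
    change ξ.1 * η.1 - η.1 * ξ.1 = 0
    rw [commute_lieAlg_T, sub_self]
  rw [← sub_eq_zero, ι_mul_sub, h1, map_zero]

end Datum

end Torus

/-! ### Annihilation spaces in modules of the category `O` -/

namespace Datum

section Weights

variable {K : Type*} [Field K] [Infinite K] {n : ℕ} (D : Datum K n)

lemma mul_mem_weightSpace {α β : ℤ} {w w' : D.W} (hw : w ∈ D.weightSpace α)
    (hw' : w' ∈ D.weightSpace β) : w * w' ∈ D.weightSpace (α + β) := by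
  have h1 : D.torusToW D.θLie * w - w * D.torusToW D.θLie = (α : K) • w := hw
  have h2 : D.torusToW D.θLie * w' - w' * D.torusToW D.θLie = (β : K) • w' := hw'
  change D.torusToW D.θLie * (w * w') - w * w' * D.torusToW D.θLie = ((α + β : ℤ) : K) • (w * w')
  rw [Int.cast_add, add_smul, ← smul_mul_assoc, ← mul_smul_comm, ← h1, ← h2]
  noncomm_ring

lemma t₀ToW_mem_weightSpace (ξ : lieAlg D.T₀) : D.t₀ToW ξ ∈ D.weightSpace 0 := by
  change D.torusToW D.θLie * D.t₀ToW ξ - D.t₀ToW ξ * D.torusToW D.θLie = ((0 : ℤ) : K) • _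
  rw [Int.cast_zero, zero_smul, sub_eq_zero]
  exact D.commute_torusToW _ _

variable (M : Type*) [AddCommGroup M] [Module K M] [Module D.W M] [IsScalarTower K D.W M]

/-- The vectors killed by all `W_β` with `β ≥ α`. -/
def killedBy (α : ℤ) : Submodule K M where
  carrier := {x | ∀ β : ℤ, α ≤ β → ∀ w ∈ D.weightSpace β, w • x = 0}
  zero_mem' := fun _ _ w _ => smul_zero w
  add_mem' := fun {x y} hx hy β hβ w hw => by rw [smul_add, hx β hβ w hw, hy β hβ w hw, add_zero]
  smul_mem' := fun c x hx β hβ w hw => by rw [smul_comm, hx β hβ w hw, smul_zero]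

variable {M}

lemma killedBy_mono {α β : ℤ} (h : α ≤ β) : D.killedBy M α ≤ D.killedBy M β :=
  fun _ hx γ hγ => hx γ (h.trans hγ)

lemma killedBy_one : D.killedBy M 1 = D.invariants M := by
  refine le_antisymm (fun x hx w hw => ?_) fun x hx β hβ w hw => hx w ?_
  · have hle : D.Wpos ≤ LinearMap.ker
        ((LinearMap.toSpanSingleton D.W M x).restrictScalars K) :=
      iSup₂_le fun β hβ w hw => hx β hβ w hw
    exact hle hw
  · exact Submodule.mem_iSup_of_mem β (Submodule.mem_iSup_of_mem (by omega) hw)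

/-- A further factor of positive weight makes the total weight at least `α + 1`. -/
lemma smul_mem_killedBy_one {α : ℤ} {x : M} (hx : x ∈ D.killedBy M (α + 1)) {w : D.W}
    {γ : ℤ} (hγ : α ≤ γ) (hw : w ∈ D.weightSpace γ) : w • x ∈ D.killedBy M 1 := by
  intro β hβ w' hw'
  rw [← mul_smul]
  exact hx _ (by omega) _ (D.mul_mem_weightSpace hw' hw)

lemma t₀ToW_smul_mem_killedBy {α : ℤ} {x : M} (hx : x ∈ D.killedBy M α) (ξ : lieAlg D.T₀) :
    D.t₀ToW ξ • x ∈ D.killedBy M α := by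
  intro β hβ w hw
  rw [← mul_smul]
  exact hx _ (by omega) _ (D.mul_mem_weightSpace hw (D.t₀ToW_mem_weightSpace ξ))

lemma eq_zero_of_mem_killedBy (h : D.killedBy M 1 = ⊥) {α : ℤ} (hα : 1 ≤ α) {x : M}
    (hx : x ∈ D.killedBy M α) : x = 0 := by
  induction α, hα using Int.leInduction with
  | base => rwa [h] at hx
  | succ α hα ih =>
    refine ih fun β hβ w hw => ?_
    have h1 := D.smul_mem_killedBy_one hx hβ hw
    rwa [h] at h1

/-- Noetherianity replaces the infinitely many conditions `W_β x = 0`, `β ≥ α`, by finitely many,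
each with values in the finite dimensional space of invariants. -/
lemma finiteDimensional_killedBy [IsNoetherianRing D.W]
    (hfin : FiniteDimensional K (D.invariants M)) {α : ℤ} (hα : 1 ≤ α) :
    FiniteDimensional K (D.killedBy M α) := by
  induction α, hα using Int.leInduction with
  | base => rwa [killedBy_one]
  | succ α hα ih =>
    have hfin1 : FiniteDimensional K (D.killedBy M 1) := by rwa [killedBy_one]
    -- Homogeneous elements of weight at least `α`. The finite generating set `t` is chosen inside
    -- `A`, so each generator is homogeneous and maps `killedBy (α + 1)` into `killedBy 1`.
    let A : Set D.W := {w | ∃ β, α ≤ β ∧ w ∈ D.weightSpace β}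
    obtain ⟨t, htA, ht⟩ := (Submodule.fg_span_iff_fg_span_finset_subset A).1
      (IsNoetherian.noetherian (Ideal.span A))
    let f : M →ₗ[K] (t → M) := LinearMap.pi fun w => Algebra.lsmul K K M w.1
    have hmap : ∀ x ∈ D.killedBy M (α + 1), ∀ w : t, f x w ∈ D.killedBy M 1 := by
      intro x hx w
      obtain ⟨β, hβ, hw⟩ := htA w.2
      exact D.smul_mem_killedBy_one hx hβ hw
    have hker : D.killedBy M (α + 1) ⊓ LinearMap.ker f ≤ D.killedBy M α := by
      rintro x ⟨-, hx⟩ β hβ w hw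
      have hx' : ∀ w ∈ t, w • x = 0 := fun w hw => congrFun (LinearMap.mem_ker.1 hx) ⟨w, hw⟩
      have hw' : w ∈ Submodule.span D.W (t : Set D.W) := by
        rw [← ht]; exact Submodule.subset_span ⟨β, hβ, hw⟩
      have hle : Submodule.span D.W (t : Set D.W) ≤
          LinearMap.ker (LinearMap.toSpanSingleton D.W M x) := Submodule.span_le.2 hx'
      exact hle hw'
    rw [← Submodule.fg_iff_finiteDimensional]
    refine Submodule.fg_of_fg_map_of_fg_inf_ker f ?_ ?_
    · rw [Submodule.fg_iff_finiteDimensional]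
      refine Submodule.finiteDimensional_of_le
        (S₂ := LinearMap.range ((D.killedBy M 1).subtype.compLeft t)) ?_
      rintro _ ⟨x, hx, rfl⟩
      exact ⟨fun w => ⟨f x w, hmap x hx w⟩, rfl⟩
    · rw [Submodule.fg_iff_finiteDimensional]
      exact Submodule.finiteDimensional_of_le hker

end Weights

/-! ### The two assertions of the theorem -/

variable {K : Type*} [Field K] [IsAlgClosed K] [CharZero K] {n : ℕ} (D : Datum K n)
  (M : Type*) [AddCommGroup M] [Module K M] [Module D.W M] [IsScalarTower K D.W M]

variable {M} in
theorem MemO.isT₀LocallyFinite (hM : D.MemO M) : D.IsT₀LocallyFinite M := by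
  have := D.isNoetherianRing_W
  intro x
  obtain ⟨α, hα⟩ := hM.bounded x
  exact ⟨D.killedBy M (max α 1), D.killedBy_mono (le_max_left _ _) hα,
    D.finiteDimensional_killedBy hM.finiteDimensional (le_max_right _ _),
    fun ξ v hv => D.t₀ToW_smul_mem_killedBy hv ξ⟩

variable {M} in
lemma MemO.submodule (hM : D.MemO M) {N : Submodule D.W M} (hN : Module.Finite D.W N) :
    D.MemO N where
  finite := hN
  bounded := fun x => (hM.bounded x).imp fun α h β hβ w hw => Subtype.ext (h β hβ w hw)
  finiteDimensional := by
    have := hM.finiteDimensional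
    let j : D.invariants N →ₗ[K] D.invariants M :=
      (N.subtype.restrictScalars K).restrict fun x hx w hw => congrArg Subtype.val (hx w hw)
    refine FiniteDimensional.of_injective j fun x y hxy => ?_
    exact Subtype.ext (Subtype.ext (show (j x : M) = j y from congrArg Subtype.val hxy))

variable {M} in
lemma MemO.exists_eigenvector [Nontrivial M] (hM : D.MemO M) :
    ∃ μ, ∃ v ∈ D.t₀WeightSpace M μ, v ≠ 0 := by
  have hne : D.killedBy M 1 ≠ ⊥ := by
    intro h
    obtain ⟨x, hx⟩ := exists_ne (0 : M)
    obtain ⟨α, hα⟩ := hM.bounded x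
    -- If there were no invariants, multiplication by elements of weight at least `α` would vanish
    -- on `killedBy (α + 1)`, and descending induction would kill every vector.
    exact hx (D.eq_zero_of_mem_killedBy h (le_max_right α 1) (D.killedBy_mono (le_max_left _ _) hα))
  have : Nontrivial (D.killedBy M 1) := Submodule.nontrivial_iff_ne_bot.2 hne
  have : FiniteDimensional K (D.killedBy M 1) := by
    rw [killedBy_one]; exact hM.finiteDimensional
  let ρ : lieAlg D.T₀ →ₗ[K] Module.End K (D.killedBy M 1) :=
    { toFun := fun ξ => (Algebra.lsmul K K M (D.t₀ToW ξ)).restrict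
        fun x hx => D.t₀ToW_smul_mem_killedBy hx ξ
      map_add' := fun ξ η => LinearMap.ext fun x => Subtype.ext <| by
        change D.t₀ToW (ξ + η) • (x : M) = D.t₀ToW ξ • (x : M) + D.t₀ToW η • (x : M)
        rw [map_add, add_smul]
      map_smul' := fun c ξ => LinearMap.ext fun x => Subtype.ext <| by
        change D.t₀ToW (c • ξ) • (x : M) = c • D.t₀ToW ξ • (x : M)
        rw [map_smul, smul_assoc] }
  obtain ⟨μ, v, hv, hv0⟩ := exists_joint_eigenvector ρ fun ξ η => by
    refine LinearMap.ext fun x => Subtype.ext ?_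
    change D.t₀ToW ξ • D.t₀ToW η • (x : M) = D.t₀ToW η • D.t₀ToW ξ • (x : M)
    rw [← mul_smul, ← mul_smul]
    exact congrArg (· • (x : M)) (D.commute_torusToW _ _)
  exact ⟨μ, v, fun ξ => congrArg Subtype.val (hv ξ), fun h => hv0 (Subtype.ext h)⟩

variable {M} in
lemma isT₀Diagonalizable_span_singleton {μ : Module.Dual K (lieAlg D.T₀)} {v : M}
    (hv : v ∈ D.t₀WeightSpace M μ) : D.IsT₀Diagonalizable (Submodule.span D.W {v}) := by
  let N := Submodule.span D.W {v}
  let v' : N := ⟨v, Submodule.mem_span_singleton_self v⟩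
  let res : lieAlg D.T₀ →ₗ[K] lieAlg D.T :=
    (LieSubalgebra.inclusion (lieAlg_mono D.T₀_le_T) : lieAlg D.T₀ →ₗ[K] lieAlg D.T)
  let f : D.W →ₗ[K] N := (LinearMap.toSpanSingleton D.W N v').restrictScalars K
  have hf : ∀ w ∈ ⨆ ν, jointEigenspace D.adW ν, f w ∈ ⨆ ν, D.t₀WeightSpace N ν := by
    intro w hw
    have hle : ⨆ ν, jointEigenspace D.adW ν ≤ (⨆ ν, D.t₀WeightSpace N ν).comap f := by
      -- If `w` has adjoint weight `ν` and `v` has weight `μ`, then `w v` has weight `μ` plus the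
      -- restriction of `ν` to `𝔱₀`.
      refine iSup_le fun ν w hw => Submodule.mem_iSup_of_mem (ν ∘ₗ res + μ) fun ξ => ?_
      refine Subtype.ext ?_
      change D.t₀ToW ξ • w • v = (ν (res ξ) + μ ξ) • w • v
      have h1 : D.t₀ToW ξ * w - w * D.t₀ToW ξ = ν (res ξ) • w := hw (res ξ)
      rw [← mul_smul, ← sub_add_cancel (D.t₀ToW ξ * w) (w * D.t₀ToW ξ), h1, add_smul, mul_smul,
        hv ξ, add_smul, smul_assoc, smul_comm w]
    exact hle hw
  refine eq_top_iff.2 fun x _ => ?_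
  obtain ⟨w, hw⟩ := Submodule.mem_span_singleton.1 x.2
  have h1 := hf w (by rw [iSup_jointEigenspace_adW]; trivial)
  rwa [show f w = x from Subtype.ext hw] at h1

end Datum

end FiniteW

end

theorem mainTheorem5 {K : Type*} [Field K] [IsAlgClosed K] [CharZero K] {n : ℕ}
    (D : FiniteW.Datum K n) (M : Type*) [AddCommGroup M] [Module K M] [Module D.W M]
    [IsScalarTower K D.W M] (hM : D.MemO M) :
    D.IsT₀LocallyFinite M ∧
      ∃ N : Submodule D.W M, D.MemOT₀ N ∧ (Nontrivial M → N ≠ ⊥) := by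
  refine ⟨FiniteW.Datum.MemO.isT₀LocallyFinite D hM, ?_⟩
  by_cases h : Nontrivial M
  · obtain ⟨μ, v, hv, hv0⟩ := FiniteW.Datum.MemO.exists_eigenvector D hM
    refine ⟨Submodule.span D.W {v}, ⟨hM.submodule D inferInstance,
      D.isT₀Diagonalizable_span_singleton hv⟩, fun _ hbot => ?_⟩
    exact hv0 (Submodule.span_singleton_eq_bot.1 hbot)
  · have h0 : (0 : M) ∈ D.t₀WeightSpace M 0 := zero_mem _
    exact ⟨Submodule.span D.W {0}, ⟨hM.submodule D inferInstance,
      D.isT₀Diagonalizable_span_singleton h0⟩, fun h' => absurd h' h⟩
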